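/- Graphs have vertices labelled $1,\dots,n$ ($n\ge 1$), no loops, and a fixed total order on their edges. For $a\ge 2$, $C_a$ is the cycle on $1,\dots,a$ with edges ordered $(1,2)<(2,3)<\cdots<(a-1,a)<(a,1)$ (for $a=2$ it is a single edge). For graphs $G_1,G_2$ with $k_1,k_2$ vertices, $G_1+G_2$ is the graph on $1,\dots,k_1+k_2-1$ with edge set $E(G_1)\cup\{(i+k_1-1,j+k_1-1):(i,j)\in E(G_2)\}$; the edge orders of $G_1$ and $G_2$ are kept and every edge of $G_1$ is smaller than every edge of $G_2$. An adjacent cycle chain is a graph $C_{a_1}+\cdots+C_{a_m}$ with $m\ge 1$ and all $a_i\ge 2$. A broken circuit of $G$ is a cycle of $G$ with its largest edge removed; a non-broken circuit is a spanning subgraph $F$ of $G$ that contains no broken circuit (so $F$ is a forest). A forest triple $\mathcal F$ of $G$ consists of a non-broken circuit $F$ of $G$ and, for every tree (connected component) $T$ of $F$, a composition $\alpha^{T}=(\alpha^T_1,\dots,\alpha^T_\ell)$ of $|T|$ and an integer $r_T$ with $1\le r_T\le \alpha^{T}_1$. Its type is the partition formed by all parts of all the $\alpha^T$, its sign is $(-1)^{\sum_T(\mathrm{len}(\alpha^T)-1)}$,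 and it is unit if every $\alpha^T$ has length $1$. Let $T_{\min}$ be the tree containing the vertex $1$. A first-preserving involution is a map $\varphi$ from the set $\mathrm{FT}(G)$ of forest triples of $G$ to itself with $\varphi\circ\varphi=\mathrm{id}$ that preserves type, changes the sign of every $\mathcal F$ with $\varphi(\mathcal F)\ne\mathcal F$, has only unit fixed points (which therefore have sign $1$), and preserves the values $\alpha^{T_{\min}}_1$ and $r_{T_{\min}}$. The chromatic symmetric function of $G$ is $X_G=\sum_\kappa\prod_{v}x_{\kappa(v)}$, summed over all proper colorings $\kappa:V(G)\to\mathbb N$; $G$ is $e$-positive if $X_G=\sum_{\lambda\vdash n}c_\lambda e_\lambda$ with all $c_\lambda\ge 0$, where $e_\lambda=\prod_i e_{\lambda_i}$ and $e_k=\sum_{i_1<\cdots<i_k}x_{i_1}\cdots x_{i_k}$. **Statement.** Every adjacent cycle chain $G$ has a first-preserving involution on $\mathrm{FT}(G)$, and $G$ is $e$-positive. -/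

import Mathlib

/-- A loopless undirected graph with `n ≥ 1` vertices, labelled by `Fin n = {0, …, n - 1}`, together
with a total order on its edges: `edges` lists the edges, each exactly once, in increasing order. -/
structure EdgeOrderedGraph where
  n : ℕ
  pos : 0 < n
  edges : List (Sym2 (Fin n))
  nodup : edges.Nodup
  loopless : ∀ e ∈ edges, ¬ e.IsDiag

namespace EdgeOrderedGraph

/-- The underlying graph. -/
def graph (G : EdgeOrderedGraph) : SimpleGraph (Fin G.n) :=
  SimpleGraph.fromEdgeSet {e | e ∈ G.edges}

/-- The smallest vertex. -/
def first (G : EdgeOrderedGraph) : Fin G.n := ⟨0, G.pos⟩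

/-- The order on the edges: `G.edgeLE e f` says that `e` does not come after `f` in the list. -/
def edgeLE (G : EdgeOrderedGraph) (e f : Sym2 (Fin G.n)) : Prop :=
  G.edges.idxOf e ≤ G.edges.idxOf f

/-- The cycle `C_a` on `{0, …, a - 1}` with edges `01 < 12 < ⋯ < (a-2)(a-1) < (a-1)0`.
For `a = 2` the two pairs `01` and `10` are the same edge, which is listed once. -/
def cycle (a : ℕ) (ha : 2 ≤ a) : EdgeOrderedGraph where
  n := a
  pos := by omega
  edges := (List.ofFn fun i : Fin a =>
    s(i, (⟨(i.1 + 1) % a, Nat.mod_lt _ (by omega)⟩ : Fin a))).dedup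
  nodup := List.nodup_dedup _
  loopless := by
    intro e he hd
    simp only [List.mem_dedup, List.mem_ofFn] at he
    obtain ⟨i, rfl⟩ := he
    rw [Sym2.mk_isDiag_iff, Fin.ext_iff] at hd
    simp only at hd
    have hi := i.2
    by_cases h : i.1 + 1 = a
    · rw [h, Nat.mod_self] at hd; omega
    · rw [Nat.mod_eq_of_lt (by omega)] at hd; omega

/-- The position of the vertex `i` of `G₁` in `G₁ + G₂`. -/
def inl (G₁ G₂ : EdgeOrderedGraph) (i : Fin G₁.n) : Fin (G₁.n + G₂.n - 1) :=
  ⟨i.1, by have := i.2; have := G₂.pos; omega⟩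

/-- The position of the vertex `i` of `G₂` in `G₁ + G₂`. -/
def inr (G₁ G₂ : EdgeOrderedGraph) (i : Fin G₂.n) : Fin (G₁.n + G₂.n - 1) :=
  ⟨i.1 + (G₁.n - 1), by have := i.2; have := G₁.pos; omega⟩

theorem inl_injective (G₁ G₂ : EdgeOrderedGraph) : Function.Injective (inl G₁ G₂) := by
  intro i j h
  simpa [inl, Fin.ext_iff] using h

theorem inr_injective (G₁ G₂ : EdgeOrderedGraph) : Function.Injective (inr G₁ G₂) := by
  intro i j h
  simpa [inr, Fin.ext_iff] using h

/-- The graph `G₁ + G₂`: the largest vertex of `G₁` is identified with the smallest vertex of `G₂`,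
and every edge of `G₁` is smaller than every edge of `G₂`. -/
def add (G₁ G₂ : EdgeOrderedGraph) : EdgeOrderedGraph where
  n := G₁.n + G₂.n - 1
  pos := by have := G₁.pos; have := G₂.pos; omega
  edges := G₁.edges.map (Sym2.map (inl G₁ G₂)) ++ G₂.edges.map (Sym2.map (inr G₁ G₂))
  nodup := by
    refine List.nodup_append.2 ⟨G₁.nodup.map (Sym2.map.injective (inl_injective G₁ G₂)),
      G₂.nodup.map (Sym2.map.injective (inr_injective G₁ G₂)), ?_⟩
    intro x hx y hy hxy
    subst hxy
    simp only [List.mem_map] at hx hy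
    obtain ⟨e, he, rfl⟩ := hx
    obtain ⟨f, hf, hef⟩ := hy
    have hl := G₁.loopless e he
    induction e using Sym2.ind with
    | _ a b =>
    induction f using Sym2.ind with
    | _ c d =>
    have h1 := a.2
    have h2 := b.2
    rw [Sym2.mk_isDiag_iff, Fin.ext_iff] at hl
    simp only [Sym2.map_mk, Sym2.eq_iff, inl, inr, Fin.ext_iff] at hef
    omega
  loopless := by
    intro e he hd
    simp only [List.mem_append, List.mem_map] at he
    rcases he with ⟨f, hf, rfl⟩ | ⟨f, hf, rfl⟩
    · exact G₁.loopless f hf ((Sym2.isDiag_map (inl_injective G₁ G₂)).1 hd)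
    · exact G₂.loopless f hf ((Sym2.isDiag_map (inr_injective G₁ G₂)).1 hd)

/-- Adjacent cycle chains: the graphs `C_{a₁} + ⋯ + C_{aₘ}` with `m ≥ 1` and all `aᵢ ≥ 2`. -/
inductive IsAdjacentCycleChain : EdgeOrderedGraph → Prop
  | single (a : ℕ) (ha : 2 ≤ a) : IsAdjacentCycleChain (cycle a ha)
  | cons (a : ℕ) (ha : 2 ≤ a) (G : EdgeOrderedGraph) (hG : IsAdjacentCycleChain G) :
      IsAdjacentCycleChain (add (cycle a ha) G)

/-- `B` is the edge set of a broken circuit: a cycle of `G` without its largest edge. -/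
def IsBrokenCircuit (G : EdgeOrderedGraph) (B : Set (Sym2 (Fin G.n))) : Prop :=
  ∃ (v : Fin G.n) (p : G.graph.Walk v v), p.IsCycle ∧
    ∃ e ∈ p.edges, (∀ f ∈ p.edges, G.edgeLE f e) ∧ B = {f | f ∈ p.edges ∧ f ≠ e}

/-- A (spanning) subgraph `F` of `G` containing no broken circuit. -/
def IsNonBroken (G : EdgeOrderedGraph) (F : SimpleGraph (Fin G.n)) : Prop :=
  F ≤ G.graph ∧ ∀ B, G.IsBrokenCircuit B → ¬ B ⊆ F.edgeSet

/-- A forest triple of `G`: a non-broken circuit `F` of `G` and, for each of its trees `T` (the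
connected components of `F`), a composition `α` of `|T|` and an integer `r` with `1 ≤ r ≤ α₁`. -/
@[ext]
structure ForestTriple (G : EdgeOrderedGraph) where
  forest : SimpleGraph (Fin G.n)
  nonBroken : G.IsNonBroken forest
  comp : (T : forest.ConnectedComponent) → Composition T.supp.ncard
  r : forest.ConnectedComponent → ℕ
  one_le_r : ∀ T, 1 ≤ r T
  r_le : ∀ T, r T ≤ (comp T).blocks.headD 0

namespace ForestTriple

variable {G : EdgeOrderedGraph}

open Classical in
/-- The type of a forest triple: all parts of all its compositions. A partition is given here by
its multiset of parts. -/
noncomputable def type (𝓕 : ForestTriple G) : Multiset ℕ :=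
  ∑ T : 𝓕.forest.ConnectedComponent, ((𝓕.comp T).blocks : Multiset ℕ)

open Classical in
/-- The sign of a forest triple. -/
noncomputable def sign (𝓕 : ForestTriple G) : ℤ :=
  (-1) ^ ∑ T : 𝓕.forest.ConnectedComponent, ((𝓕.comp T).length - 1)

/-- All compositions of the forest triple have length one. -/
def IsUnit (𝓕 : ForestTriple G) : Prop := ∀ T, (𝓕.comp T).length = 1

/-- The tree that contains the smallest vertex of `G`. -/
def minTree (𝓕 : ForestTriple G) : 𝓕.forest.ConnectedComponent :=
  𝓕.forest.connectedComponentMk G.first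

/-- The first part of the composition of the tree that contains the smallest vertex. -/
def minPart (𝓕 : ForestTriple G) : ℕ := (𝓕.comp 𝓕.minTree).blocks.headD 0

/-- The integer `r` of the tree that contains the smallest vertex. -/
def minR (𝓕 : ForestTriple G) : ℕ := 𝓕.r 𝓕.minTree

end ForestTriple

/-- Sign-reversing involutions on the set of forest triples of `G`. -/
structure IsSignReversingInvolution (G : EdgeOrderedGraph)
    (φ : ForestTriple G → ForestTriple G) : Prop where
  involutive : ∀ 𝓕, φ (φ 𝓕) = 𝓕
  type_eq : ∀ 𝓕, (φ 𝓕).type = 𝓕.type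
  sign_ne : ∀ 𝓕, φ 𝓕 ≠ 𝓕 → (φ 𝓕).sign ≠ 𝓕.sign
  sign_eq_one : ∀ 𝓕, φ 𝓕 = 𝓕 → 𝓕.sign = 1

/-- First-preserving involutions on the set of forest triples of `G`. -/
structure IsFirstPreservingInvolution (G : EdgeOrderedGraph)
    (φ : ForestTriple G → ForestTriple G) : Prop extends IsSignReversingInvolution G φ where
  isUnit : ∀ 𝓕, φ 𝓕 = 𝓕 → 𝓕.IsUnit
  minPart_eq : ∀ 𝓕, (φ 𝓕).minPart = 𝓕.minPart
  minR_eq : ∀ 𝓕, (φ 𝓕).minR = 𝓕.minR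

end EdgeOrderedGraph

/-- The chromatic symmetric function `∑_κ ∏_v x_{κ(v)}`, the sum over the proper colourings
`κ : V → ℕ`: the coefficient of a monomial `x^d` is the (finite) number of proper colourings `κ`
with `∏_v x_{κ(v)} = x^d`. -/
noncomputable def chromaticSymmetricFunction {V : Type*} [Fintype V] (G : SimpleGraph V) :
    MvPowerSeries ℕ ℤ :=
  fun d => ({κ : G.Coloring ℕ | ∑ v, Finsupp.single (κ v) 1 = d}.ncard : ℤ)

open Classical in
/-- The elementary symmetric function `e_k = ∑_{i₁ < ⋯ < i_k} x_{i₁} ⋯ x_{i_k}`: the sum of all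
squarefree monomials of degree `k`. -/
noncomputable def elementarySymmetric (k : ℕ) : MvPowerSeries ℕ ℤ :=
  fun d => if (∀ i, d i ≤ 1) ∧ d.degree = k then 1 else 0

/-- `e_lam`, the product of the `e_k` over the parts `k` of the partition `lam`. -/
noncomputable def elementarySymmetricPartition {n : ℕ} (lam : n.Partition) : MvPowerSeries ℕ ℤ :=
  (lam.parts.map elementarySymmetric).prod

/-- A graph is `e`-positive if its chromatic symmetric function is a combination of the
elementary symmetric functions `e_lam`, `lam` a partition of the number of vertices, with
nonnegative coefficients. -/
def IsEPositive {V : Type*} [Fintype V] (G : SimpleGraph V) : Prop :=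
  ∃ c : (Fintype.card V).Partition → ℤ, (∀ lam, 0 ≤ c lam) ∧
    chromaticSymmetricFunction G = ∑ lam, c lam • elementarySymmetricPartition lam

/-!
No explicit involution is needed. A first-preserving involution exists as soon as, for every class
of forest triples with the same type and the same values of `α₁` and `r` at the tree of the first
vertex, the sum `S` of the signs satisfies `0 ≤ S ≤ U`, where `U` is the number of unit triples in
the class: the negative triples can then be matched with positive ones so that exactly `S` positive
triples are left over, all of them unit (`exists_involution_of_count`).

*Generating functions.* Let `e_1, e_2, …` be variables and `e_0 = 1`. Summing over the compositions
first, the generating function of the signs, with `e_λ` recording the type, is a sum over the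
non-broken circuits of products of tree weights `EdgeOrderedGraph.forestSum`. With
`E = ∑ e_i X^i`, `H = 1 / E` and `D = X E'`, a tree with `m` vertices has as its weight the
coefficient of `X^m` in `D H`, and for the tree of the first vertex, with `α₁ = k` and `r`
prescribed, it is `e_k` times the coefficient of `X^(m-k)` in `H`. For unit triples the weights are
`m e_m` and `e_k [m = k]`. It has to be shown that the signed generating function and its
difference from the unit one have nonnegative coefficients
(`EdgeOrderedGraph.IsAdjacentCycleChain.forestSum_mem`).

*Transfer.* A non-broken circuit of `C_a + G` is a non-broken circuit of `G` together with a proper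
subset of the path `1, 2, …, a` and possibly the closing edge
(`EdgeOrderedGraph.sum_isNonBroken_add_cycle`). Hence attaching `C_a` amounts to applying a linear
operator to the weight of the tree of the first vertex (`EdgeOrderedGraph.forestSum_add_cycle`),
whose closed form is `cycleTransfer_eq`. A chain arises from a single vertex by attaching cycles.

*Positivity.* The operator of the signed count maps the shifted coefficients of `H` to combinations
of each other, and all terms with a sign cancel because `E H = 1` (`cycleTransfer_shiftedInv`). The
resulting matrix `transferCoeff` is nonnegative, and entrywise at most the matrix of the operator
of the unit count (`cycleTransfer_sizeIs_sub_transferCoeff_mem`). Both bounds then follow by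
induction on the number of cycles.

*The chromatic symmetric function.* Whitney's broken circuit theorem, applied to one colouring at a
time (`EdgeOrderedGraph.IsAdjacentCycleChain.sum_monoWeight`) and proved along the same
decomposition, expresses the chromatic symmetric function as a sum of signed products of power sums
over the non-broken circuits. By Newton's identities the factors are the coefficients of `D H`, so
that the function is the signed sum of `e_λ` over all forest triples, and the coefficient of `e_λ`
is a sum of the numbers `S`. To use the polynomial form of Newton's identities, coefficients are
compared in finitely many variables.
-/

/-! ### Connected components as finite sets of vertices -/

namespace SimpleGraph

open Finset

section Classes

variable {V : Type*}

/-- Adding an edge `uv` to a graph joins the component of `u` to the component of `v`. -/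
theorem reachable_sup_edge_iff (F : SimpleGraph V) (u v x y : V) :
    (F ⊔ edge u v).Reachable x y ↔ F.Reachable x y ∨ (F.Reachable x u ∧ F.Reachable v y) ∨
      (F.Reachable x v ∧ F.Reachable u y) := by
  constructor
  · rintro ⟨p⟩
    induction p with
    | nil => exact Or.inl (Reachable.refl _)
    | @cons a b c h p ih =>
      rw [sup_adj, edge_adj] at h
      rcases h with h | ⟨⟨rfl, rfl⟩ | ⟨rfl, rfl⟩, -⟩
      · have h' := h.reachable
        rcases ih with h1 | ⟨h1, h2⟩ | ⟨h1, h2⟩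
        · exact Or.inl (h'.trans h1)
        · exact Or.inr (Or.inl ⟨h'.trans h1, h2⟩)
        · exact Or.inr (Or.inr ⟨h'.trans h1, h2⟩)
      · rcases ih with h1 | ⟨h1, h2⟩ | ⟨h1, h2⟩
        · exact Or.inr (Or.inl ⟨Reachable.refl _, h1⟩)
        · exact Or.inr (Or.inl ⟨Reachable.refl _, h2⟩)
        · exact Or.inl h2
      · rcases ih with h1 | ⟨h1, h2⟩ | ⟨h1, h2⟩
        · exact Or.inr (Or.inr ⟨Reachable.refl _, h1⟩)
        · exact Or.inl h2
        · exact Or.inr (Or.inr ⟨Reachable.refl _, h2⟩)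
  · have hle : F ≤ F ⊔ edge u v := le_sup_left
    have huv : (F ⊔ edge u v).Reachable u v := by
      by_cases h : u = v
      · subst h; exact Reachable.refl _
      · exact Adj.reachable (by simp [edge_adj, h])
    rintro (h | ⟨h1, h2⟩ | ⟨h1, h2⟩)
    · exact h.mono hle
    · exact ((h1.mono hle).trans huv).trans (h2.mono hle)
    · exact ((h1.mono hle).trans huv.symm).trans (h2.mono hle)

/-- A vertex all of whose potential edges are missing reaches only itself. -/
theorem reachable_isolated_iff (F : SimpleGraph V) {v : V} (hv : ∀ x, ¬ F.Adj v x) (x : V) :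
    F.Reachable v x ↔ v = x := by
  constructor
  · rintro ⟨p⟩
    cases p with
    | nil => rfl
    | cons h _ => exact absurd h (hv _)
  · rintro rfl
    exact Reachable.refl _

/-- Two vertices separated by a function that is constant along every edge are not reachable
from one another. -/
theorem Reachable.apply_eq {F : SimpleGraph V} {β : Type*} (χ : V → β)
    (hχ : ∀ x y, F.Adj x y → χ x = χ y) {x y : V} (h : F.Reachable x y) : χ x = χ y := by
  obtain ⟨p⟩ := h
  induction p with
  | nil => rfl
  | cons h _ ih => exact (hχ _ _ h).trans ih

variable [Fintype V] [DecidableEq V]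

open Classical in
/-- The connected component of `v`, as a finite set of vertices. -/
noncomputable def cls (F : SimpleGraph V) (v : V) : Finset V := univ.filter (F.Reachable v)

/-- The connected components of the vertices in `S`, as finite sets of vertices. -/
noncomputable def classes (F : SimpleGraph V) (S : Finset V) : Finset (Finset V) :=
  S.image F.cls

@[simp]
theorem mem_cls (F : SimpleGraph V) (v x : V) : x ∈ F.cls v ↔ F.Reachable v x := by
  simp [cls]

theorem self_mem_cls (F : SimpleGraph V) (v : V) : v ∈ F.cls v := by simp

theorem cls_eq_iff (F : SimpleGraph V) (u v : V) : F.cls u = F.cls v ↔ F.Reachable u v := by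
  constructor
  · intro h
    have := self_mem_cls F v
    rw [← h] at this
    simpa using this
  · intro h
    ext x
    simp only [mem_cls]
    exact ⟨fun h' => h.symm.trans h', fun h' => h.trans h'⟩

theorem disjoint_cls (F : SimpleGraph V) {u v : V} (h : ¬ F.Reachable u v) :
    Disjoint (F.cls u) (F.cls v) := by
  rw [Finset.disjoint_left]
  intro x hx hx'
  simp only [mem_cls] at hx hx'
  exact h (hx.trans hx'.symm)

theorem mem_classes (F : SimpleGraph V) (S : Finset V) (A : Finset V) :
    A ∈ F.classes S ↔ ∃ v ∈ S, F.cls v = A := by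
  simp [classes]

theorem cls_mem_classes (F : SimpleGraph V) {S : Finset V} {v : V} (hv : v ∈ S) :
    F.cls v ∈ F.classes S := (F.mem_classes S _).2 ⟨v, hv, rfl⟩

theorem cls_isolated (F : SimpleGraph V) {v : V} (hv : ∀ x, ¬ F.Adj v x) : F.cls v = {v} := by
  ext x
  rw [mem_cls, reachable_isolated_iff F hv, mem_singleton, eq_comm]

theorem cls_sup_edge_left (F : SimpleGraph V) (u v : V) :
    (F ⊔ edge u v).cls u = F.cls u ∪ F.cls v := by
  ext x
  rw [mem_cls, mem_union, mem_cls, mem_cls, reachable_sup_edge_iff]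
  have := Reachable.refl (G := F) u
  tauto

theorem cls_sup_edge_of_not_reachable (F : SimpleGraph V) {u v x : V} (hu : ¬ F.Reachable u x)
    (hv : ¬ F.Reachable v x) : (F ⊔ edge u v).cls x = F.cls x := by
  ext y
  rw [mem_cls, mem_cls, reachable_sup_edge_iff]
  rw [reachable_comm] at hu hv
  tauto

/-- Adding an edge between two components replaces them by their union. -/
theorem classes_sup_edge (F : SimpleGraph V) {S : Finset V} {u v : V} (hu : u ∈ S) :
    (F ⊔ edge u v).classes S =
      insert (F.cls u ∪ F.cls v) (F.classes S \ {F.cls u, F.cls v}) := by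
  have hv' : (F ⊔ edge u v).cls v = F.cls u ∪ F.cls v := by
    rw [← cls_sup_edge_left, cls_eq_iff, reachable_sup_edge_iff]
    exact Or.inr (Or.inr ⟨Reachable.refl _, Reachable.refl _⟩)
  ext A
  simp only [mem_classes, mem_insert, mem_sdiff, mem_singleton, not_or]
  constructor
  · rintro ⟨x, hx, rfl⟩
    by_cases h1 : F.Reachable u x
    · left
      rw [← cls_sup_edge_left, cls_eq_iff, reachable_comm]
      exact h1.mono le_sup_left
    by_cases h2 : F.Reachable v x
    · left
      rw [← hv', cls_eq_iff, reachable_comm]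
      exact h2.mono le_sup_left
    · right
      rw [cls_sup_edge_of_not_reachable F h1 h2]
      refine ⟨⟨x, hx, rfl⟩, ?_, ?_⟩
      · rw [cls_eq_iff, reachable_comm]; exact h1
      · rw [cls_eq_iff, reachable_comm]; exact h2
  · rintro (rfl | ⟨⟨x, hx, rfl⟩, h1, h2⟩)
    · exact ⟨u, hu, cls_sup_edge_left F u v⟩
    · rw [cls_eq_iff, reachable_comm] at h1 h2
      exact ⟨x, hx, cls_sup_edge_of_not_reachable F h1 h2⟩

theorem union_cls_notMem_classes_sdiff (F : SimpleGraph V) {S : Finset V} {u v : V} :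
    F.cls u ∪ F.cls v ∉ F.classes S \ {F.cls u, F.cls v} := by
  intro h
  simp only [mem_sdiff, mem_classes, mem_insert, mem_singleton, not_or] at h
  obtain ⟨⟨x, -, hx⟩, h1, -⟩ := h
  have hu : u ∈ F.cls x := by rw [hx]; simp
  rw [mem_cls, ← cls_eq_iff] at hu
  exact h1 (hx ▸ hu)

theorem prod_classes_sup_edge {R : Type*} [CommMonoid R] (F : SimpleGraph V) {S : Finset V}
    {u v : V} (hu : u ∈ S) (f : Finset V → R) :
    ∏ A ∈ (F ⊔ edge u v).classes S, f A =
      f (F.cls u ∪ F.cls v) * ∏ A ∈ F.classes S \ {F.cls u, F.cls v}, f A := by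
  rw [classes_sup_edge F hu, prod_insert (union_cls_notMem_classes_sdiff F)]

theorem prod_classes_eq_mul_mul {R : Type*} [CommMonoid R] (F : SimpleGraph V) {S : Finset V}
    {u v : V} (hu : u ∈ S) (hv : v ∈ S) (h : ¬ F.Reachable u v) (f : Finset V → R) :
    ∏ A ∈ F.classes S, f A =
      f (F.cls u) * f (F.cls v) * ∏ A ∈ F.classes S \ {F.cls u, F.cls v}, f A := by
  have hsub : ({F.cls u, F.cls v} : Finset (Finset V)) ⊆ F.classes S := by
    intro A hA
    rw [mem_insert, mem_singleton] at hA
    rcases hA with rfl | rfl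
    · exact cls_mem_classes F hu
    · exact cls_mem_classes F hv
  rw [← prod_sdiff hsub, prod_pair (by rwa [Ne, cls_eq_iff]), mul_comm]

open Classical in
/-- Products over connected components are products over the finite sets `classes`. -/
theorem prod_connectedComponent {R : Type*} [CommMonoid R] (F : SimpleGraph V)
    (f : Finset V → R) :
    ∏ T : F.ConnectedComponent, f T.supp.toFinset = ∏ A ∈ F.classes univ, f A := by
  have key : ∀ v, (F.connectedComponentMk v).supp.toFinset = F.cls v := by
    intro v
    ext x
    rw [Set.mem_toFinset, ConnectedComponent.mem_supp_iff, ConnectedComponent.eq, mem_cls,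
      reachable_comm]
  refine Finset.prod_nbij (fun T => T.supp.toFinset) ?_ ?_ ?_ (fun _ _ => rfl)
  · intro T _
    induction T using ConnectedComponent.ind with | _ v => ?_
    rw [key]
    exact cls_mem_classes F (mem_univ _)
  · intro T _ T' _ h
    simpa using h
  · intro A hA
    rw [mem_coe, mem_classes] at hA
    obtain ⟨v, -, rfl⟩ := hA
    exact ⟨F.connectedComponentMk v, by simp, key v⟩

end Classes

end SimpleGraph

/-! ### Graphs with two marked components -/

namespace SimpleGraph

open Finset

section TwoMarked

variable {V : Type*} [Fintype V] [DecidableEq V] {R : Type*} [CommSemiring R]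

open Classical in
/-- The weight of a graph in which the components of `j` and `z` are marked: an unmarked component
with a vertex in `S` has the weight `p m`, where `m` is its size; the marked components together
have the weight `φ l` if they coincide and have size `l`, and the weight `ψ s l` if they are
different and have the sizes `s` and `l`. -/
noncomputable def twoMarked (F : SimpleGraph V) (S : Finset V) (j z : V) (p φ : ℕ → R)
    (ψ : ℕ → ℕ → R) : R :=
  (if F.Reachable j z then φ #(F.cls z) else ψ #(F.cls j) #(F.cls z)) *
    ∏ A ∈ F.classes S \ {F.cls j, F.cls z}, p #A

variable (F : SimpleGraph V) {S : Finset V} {j z v : V} (p φ : ℕ → R) (ψ : ℕ → ℕ → R)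

theorem twoMarked_add (φ' : ℕ → R) (ψ' : ℕ → ℕ → R) :
    F.twoMarked S j z p φ ψ + F.twoMarked S j z p φ' ψ' =
      F.twoMarked S j z p (fun l => φ l + φ' l) (fun s l => ψ s l + ψ' s l) := by
  unfold twoMarked
  split_ifs <;> rw [add_mul]

theorem twoMarked_self (hz : z ∈ S) : F.twoMarked S z z p φ ψ =
    ∏ A ∈ F.classes S, if z ∈ A then φ #A else p #A := by
  have h : F.cls z ∈ F.classes S := cls_mem_classes F hz
  rw [twoMarked, if_pos (Reachable.refl _), ← mul_prod_erase _ _ h,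
    if_pos (self_mem_cls F z)]
  congr 1
  have : F.classes S \ {F.cls z, F.cls z} = (F.classes S).erase (F.cls z) := by
    ext A; simp; tauto
  rw [this]
  refine prod_congr rfl fun A hA => ?_
  rw [if_neg]
  intro hzA
  obtain ⟨hA1, hA2⟩ := mem_erase.1 hA
  obtain ⟨x, -, rfl⟩ := (F.mem_classes S A).1 hA2
  rw [mem_cls] at hzA
  exact hA1 ((F.cls_eq_iff _ _).2 hzA)

theorem singleton_notMem_classes (hvS : v ∉ S) : {v} ∉ F.classes S := by
  intro h
  obtain ⟨x, hx, hxv⟩ := (F.mem_classes S _).1 h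
  have := F.self_mem_cls x
  rw [hxv, mem_singleton] at this
  exact hvS (this ▸ hx)

theorem classes_insert_isolated (hv : ∀ x, ¬ F.Adj v x) (S : Finset V) :
    F.classes (insert v S) = insert {v} (F.classes S) := by
  rw [classes, image_insert, cls_isolated F hv, classes]

/-- The effect of adding an isolated vertex `v` and moving the first mark to it. If the components
of `j` and `z` are different, then the component of `j` is no longer marked and contributes the
factor `p s`. -/
theorem twoMarked_insert (hv : ∀ x, ¬ F.Adj v x) (hvS : v ∉ S) (hj : j ∈ S) (hz : z ∈ S) :
    F.twoMarked (insert v S) v z p φ ψ =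
      F.twoMarked S j z p (fun l => ψ 1 l) (fun s l => p s * ψ 1 l) := by
  have hvz : ¬ F.Reachable v z := by
    rw [reachable_isolated_iff F hv]
    rintro rfl
    exact hvS hz
  have hcl : F.classes (insert v S) \ {F.cls v, F.cls z} = F.classes S \ {F.cls z} := by
    have h1 := F.classes_insert_isolated hv S
    have h2 := F.singleton_notMem_classes hvS
    rw [h1, cls_isolated F hv]
    ext A
    simp only [mem_sdiff, mem_insert, mem_singleton]
    constructor
    · tauto
    · rintro ⟨h3, h4⟩
      refine ⟨Or.inr h3, ?_⟩
      rintro (rfl | h5)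
      · exact h2 h3
      · exact h4 h5
  unfold twoMarked
  rw [if_neg hvz, hcl, cls_isolated F hv, card_singleton]
  by_cases hjz : F.Reachable j z
  · rw [if_pos hjz, (F.cls_eq_iff _ _).2 hjz]
    simp
  · rw [if_neg hjz]
    beta_reduce
    rw [mul_comm (p _), mul_assoc]
    congr 1
    have hmem : F.cls j ∈ F.classes S \ {F.cls z} := by
      rw [mem_sdiff, mem_singleton, cls_eq_iff]
      exact ⟨cls_mem_classes F hj, hjz⟩
    rw [← mul_prod_erase _ _ hmem]
    congr 2
    ext A
    simp only [mem_sdiff, mem_insert, mem_singleton, mem_erase]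
    tauto

/-- The effect of adding a vertex `v` that is joined to `j` and moving the first mark to it. -/
theorem twoMarked_insert_edge (hv : ∀ x, ¬ F.Adj v x) (hvS : v ∉ S) (hj : j ∈ S) (hz : z ∈ S) :
    (F ⊔ edge v j).twoMarked (insert v S) v z p φ ψ =
      F.twoMarked S j z p (fun l => φ (l + 1)) (fun s l => ψ (s + 1) l) := by
  have hvz : ∀ x ∈ S, ¬ F.Reachable v x := by
    intro x hx
    rw [reachable_isolated_iff F hv]
    rintro rfl
    exact hvS hx
  have hclsv : (F ⊔ edge v j).cls v = insert v (F.cls j) := by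
    rw [cls_sup_edge_left, cls_isolated F hv, insert_eq]
  have hvj : v ∉ F.cls j := by
    rw [mem_cls, reachable_comm]; exact hvz j hj
  have hcl : (F ⊔ edge v j).classes (insert v S) \ {(F ⊔ edge v j).cls v} =
      F.classes S \ {F.cls j} := by
    have h1 := F.classes_insert_isolated hv S
    rw [classes_sup_edge F (mem_insert_self v S), cls_sup_edge_left, h1]
    have h2 := F.singleton_notMem_classes hvS
    have h3 : F.cls v ∪ F.cls j ∉ F.classes S := by
      intro h
      obtain ⟨x, hx, hxv⟩ := (F.mem_classes S _).1 h
      have : v ∈ F.cls x := by rw [hxv]; simp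
      rw [mem_cls, reachable_comm] at this
      exact hvz x hx this
    rw [cls_isolated F hv] at h3 ⊢
    ext A
    simp only [mem_sdiff, mem_insert, mem_singleton]
    constructor
    · tauto
    · rintro ⟨h4, h5⟩
      refine ⟨Or.inr ⟨Or.inr h4, ?_⟩, ?_⟩
      · rintro (rfl | h6)
        · exact h2 h4
        · exact h5 h6
      · rintro rfl
        exact h3 h4
  have hreach : (F ⊔ edge v j).Reachable v z ↔ F.Reachable j z := by
    rw [← mem_cls, hclsv, mem_insert, mem_cls, or_iff_right]
    rintro rfl
    exact hvS hz
  have hpair : ∀ (s : Finset (Finset V)) (a b : Finset V), s \ {a, b} = (s \ {a}) \ {b} := by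
    intro s a b
    ext A
    simp only [mem_sdiff, mem_insert, mem_singleton]
    tauto
  unfold twoMarked
  rw [hpair, hcl]
  by_cases hjz : F.Reachable j z
  · rw [if_pos hjz, if_pos (hreach.2 hjz), ← (cls_eq_iff _ _ _).2 (hreach.2 hjz), hclsv,
      card_insert_of_notMem hvj, ← (F.cls_eq_iff _ _).2 hjz]
    congr 2
    ext A
    simp only [mem_sdiff, mem_insert, mem_singleton]
    constructor
    · tauto
    · rintro ⟨h4, h5⟩
      refine ⟨⟨h4, by tauto⟩, ?_⟩
      rintro rfl
      obtain ⟨x, hx, hxv⟩ := (F.mem_classes S _).1 h4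
      have : v ∈ F.cls x := by rw [hxv]; simp
      rw [mem_cls, reachable_comm] at this
      exact hvz x hx this
  · rw [if_neg hjz, if_neg (mt hreach.1 hjz), hclsv, card_insert_of_notMem hvj,
      cls_sup_edge_of_not_reachable F (hvz z hz) hjz, hpair]

/-- Closing up: the total weight of a graph with different marked components, once without and
once with an edge that joins them. The weight `φ` of a single marked component is irrelevant. -/
theorem prod_classes_add_prod_classes_sup_edge (q : ℕ → R) (hj : j ∈ S) (hz : z ∈ S)
    (hjz : ¬ F.Reachable j z) :
    (∏ A ∈ F.classes S, if j ∈ A then q #A else p #A) +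
        (∏ A ∈ (F ⊔ edge z j).classes S, if j ∈ A then q #A else p #A) =
      F.twoMarked S j z p φ (fun s l => q (s + l) + q s * p l) := by
  have hzj : j ∉ F.cls z := by rw [mem_cls, reachable_comm]; exact hjz
  have hrest : ∏ A ∈ F.classes S \ {F.cls j, F.cls z}, (if j ∈ A then q #A else p #A) =
      ∏ A ∈ F.classes S \ {F.cls j, F.cls z}, p #A := by
    refine prod_congr rfl fun A hA => ?_
    rw [if_neg]
    intro hjA
    simp only [mem_sdiff, mem_insert, mem_singleton, not_or] at hA
    obtain ⟨hA2, hA1, -⟩ := hA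
    obtain ⟨x, -, rfl⟩ := (F.mem_classes S A).1 hA2
    rw [mem_cls] at hjA
    exact hA1 ((F.cls_eq_iff _ _).2 hjA)
  rw [prod_classes_eq_mul_mul F hj hz hjz, prod_classes_sup_edge F hz, pair_comm (F.cls z), hrest,
    if_pos (self_mem_cls F j), if_neg hzj, if_pos (by simp),
    card_union_of_disjoint (disjoint_cls F hjz).symm, twoMarked, if_neg hjz, ← add_mul,
    add_comm #(F.cls z), add_comm (q _)]

end TwoMarked

end SimpleGraph

/-! ### Attaching a path -/

/-- One step of the transfer along a path: `x.1 l` is the weight of a single marked component of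
size `l`, and `x.2 s l` is the weight of two different marked components of sizes `s` and `l`. The
step adds one vertex to the path, once without and once with the edge to the preceding vertex. -/
def pathStep {R : Type*} [CommSemiring R] (p : ℕ → R) (x : (ℕ → R) × (ℕ → ℕ → R)) :
    (ℕ → R) × (ℕ → ℕ → R) :=
  (fun l => x.1 (l + 1) + x.2 1 l, fun s l => p s * x.2 1 l + x.2 (s + 1) l)

/-- The transfer operator of the cycle `C_{n+1}`, acting on the weights of the component of the
root. The initial weights account for the closing edge of the cycle, which is absent or joins the
two marked components; the initial weight `0` of a single marked component excludes the complete
path. -/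
def cycleTransfer {R : Type*} [CommSemiring R] (p : ℕ → R) (n : ℕ) (q : ℕ → R) : ℕ → R :=
  ((pathStep p)^[n] (fun _ => 0, fun s l => q (s + l) + q s * p l)).1

namespace SimpleGraph

open Finset

section Path

variable {V : Type*}

/-- The graph `F` with the edges `u i — u (i + 1)`, `i ∈ B`, added. -/
def addPath (F : SimpleGraph V) (u : ℕ → V) (B : Finset ℕ) : SimpleGraph V :=
  F ⊔ B.sup fun i => edge (u i) (u (i + 1))

theorem addPath_empty (F : SimpleGraph V) (u : ℕ → V) : F.addPath u ∅ = F := by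
  simp [addPath]

theorem addPath_insert (F : SimpleGraph V) (u : ℕ → V) (B : Finset ℕ) (i : ℕ) :
    F.addPath u (insert i B) = F.addPath u B ⊔ edge (u i) (u (i + 1)) := by
  rw [addPath, addPath, sup_insert, sup_assoc, sup_comm (edge _ _)]

theorem finset_sup_adj {ι : Type*} (B : Finset ι) (H : ι → SimpleGraph V) (x y : V) :
    (B.sup H).Adj x y ↔ ∃ i ∈ B, (H i).Adj x y := by
  rw [Finset.sup_eq_iSup]
  simp [SimpleGraph.iSup_adj]

theorem addPath_adj (F : SimpleGraph V) (u : ℕ → V) (B : Finset ℕ) (x y : V) :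
    (F.addPath u B).Adj x y ↔
      F.Adj x y ∨ ∃ i ∈ B, s(u i, u (i + 1)) = s(x, y) ∧ x ≠ y := by
  simp only [addPath, sup_adj, finset_sup_adj, adj_edge]

variable {F : SimpleGraph V} {u : ℕ → V} {n : ℕ} {B : Finset ℕ}

theorem not_addPath_adj (hu : Set.InjOn u (Set.Iic n)) (hF : ∀ i < n, ∀ x, ¬ F.Adj (u i) x)
    {j : ℕ} (hB : B ⊆ Ico (j + 1) n) (hj : j < n) (x : V) : ¬ (F.addPath u B).Adj (u j) x := by
  rw [addPath_adj]
  rintro (h | ⟨i, hi, h, -⟩)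
  · exact hF j hj x h
  · have hi' := mem_Ico.1 (hB hi)
    rw [Sym2.eq_iff] at h
    rcases h with ⟨h, -⟩ | ⟨-, h⟩
    · have := hu (Set.mem_Iic.2 hi'.2.le) (Set.mem_Iic.2 hj.le) h
      omega
    · have := hu (Set.mem_Iic.2 hi'.2) (Set.mem_Iic.2 hj.le) h
      omega

/-- A missing edge of the path separates its two sides. -/
theorem not_reachable_addPath (hu : Set.InjOn u (Set.Iic n))
    (hF : ∀ i < n, ∀ x, ¬ F.Adj (u i) x) (hB : B ⊆ range n) {i b c : ℕ} (hiB : i ∉ B)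
    (hbi : b ≤ i) (hic : i < c) (hcn : c ≤ n) : ¬ (F.addPath u B).Reachable (u b) (u c) := by
  intro h
  have hχ : ∀ k ≤ n, (∃ j ≤ i, u k = u j) ↔ k ≤ i := by
    intro k hk
    constructor
    · rintro ⟨j, hj, h⟩
      have := hu (Set.mem_Iic.2 hk) (Set.mem_Iic.2 (by omega)) h
      omega
    · exact fun h => ⟨k, h, rfl⟩
  have key := Reachable.apply_eq (fun x => ∃ j ≤ i, x = u j) ?_ h
  · rw [eq_iff_iff, hχ b (by omega), hχ c hcn] at key
    omega
  · intro x y hxy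
    rw [addPath_adj] at hxy
    rw [eq_iff_iff]
    rcases hxy with hxy | ⟨k, hk, hxy, -⟩
    · constructor
      · rintro ⟨j, hj, rfl⟩
        exact absurd hxy (hF j (by omega) _)
      · rintro ⟨j, hj, rfl⟩
        exact absurd hxy.symm (hF j (by omega) _)
    · have hkn := mem_range.1 (hB hk)
      have hki : k ≠ i := fun h => hiB (h ▸ hk)
      rw [Sym2.eq_iff] at hxy
      rcases hxy with ⟨rfl, rfl⟩ | ⟨rfl, rfl⟩
      · rw [hχ k hkn.le, hχ (k + 1) hkn]; omega
      · rw [hχ k hkn.le, hχ (k + 1) hkn]; omega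

theorem reachable_addPath_range (F : SimpleGraph V) (u : ℕ → V) (n : ℕ) :
    ∀ k ≤ n, (F.addPath u (range n)).Reachable (u 0) (u k) := by
  intro k
  induction k with
  | zero => exact fun _ => Reachable.refl _
  | succ k ih =>
    intro hk
    refine (ih (by omega)).trans ?_
    by_cases h : u k = u (k + 1)
    · rw [← h]
    · exact Adj.reachable ((addPath_adj _ _ _ _ _).2
        (Or.inr ⟨k, mem_range.2 (by omega), rfl, h⟩))

theorem reachable_addPath_iff (hu : Set.InjOn u (Set.Iic n))
    (hF : ∀ i < n, ∀ x, ¬ F.Adj (u i) x) (hB : B ⊆ range n) :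
    (F.addPath u B).Reachable (u 0) (u n) ↔ B = range n := by
  constructor
  · intro h
    by_contra hne
    obtain ⟨i, hi, hiB⟩ := exists_of_ssubset (hB.ssubset_of_ne hne)
    exact not_reachable_addPath hu hF hB hiB (Nat.zero_le i) (mem_range.1 hi) le_rfl h
  · rintro rfl
    exact reachable_addPath_range F u n n le_rfl

variable [Fintype V] [DecidableEq V] {R : Type*} [CommSemiring R]

/-- The vertices that are not among the first `j` vertices of the path `u`. -/
def pathCompl (u : ℕ → V) (j : ℕ) : Finset V := univ.filter fun x => ∀ i < j, x ≠ u i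

theorem pathCompl_zero (u : ℕ → V) : pathCompl u 0 = univ := by
  simp [pathCompl]

theorem mem_pathCompl_of_le (hu : Set.InjOn u (Set.Iic n)) {j k : ℕ} (hjk : j ≤ k) (hk : k ≤ n) :
    u k ∈ pathCompl u j := by
  simp only [pathCompl, mem_filter, mem_univ, true_and]
  intro i hi h
  have := hu (Set.mem_Iic.2 hk) (Set.mem_Iic.2 (by omega)) h
  omega

theorem notMem_pathCompl (u : ℕ → V) (j : ℕ) : u j ∉ pathCompl u (j + 1) := by
  simp only [pathCompl, mem_filter, mem_univ, true_and]
  exact fun h => h j (by omega) rfl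

theorem pathCompl_eq_insert (hu : Set.InjOn u (Set.Iic n)) {j : ℕ} (hj : j ≤ n) :
    pathCompl u j = insert (u j) (pathCompl u (j + 1)) := by
  ext x
  simp only [pathCompl, mem_insert, mem_filter, mem_univ, true_and]
  constructor
  · intro h
    by_cases hx : x = u j
    · exact Or.inl hx
    · refine Or.inr fun i hi => ?_
      rcases Nat.lt_succ_iff_lt_or_eq.1 hi with hi | rfl
      · exact h i hi
      · exact hx
  · rintro (rfl | h)
    · intro i hi h
      have := hu (Set.mem_Iic.2 hj) (Set.mem_Iic.2 (by omega)) h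
      omega
    · exact fun i hi => h i (by omega)

/-- The vertices of the path are removed one at a time, starting with `u j`, which carries the first
mark. Each removal moves the mark to the next vertex and applies `pathStep` to the weights. -/
theorem sum_twoMarked_addPath (hu : Set.InjOn u (Set.Iic n))
    (hF : ∀ i < n, ∀ x, ¬ F.Adj (u i) x) (p : ℕ → R) :
    ∀ (d j : ℕ), j + d = n → ∀ x : (ℕ → R) × (ℕ → ℕ → R),
      ∑ B ∈ (Ico j n).powerset,
          (F.addPath u B).twoMarked (pathCompl u j) (u j) (u n) p x.1 x.2 =
        F.twoMarked (pathCompl u n) (u n) (u n) p ((pathStep p)^[d] x).1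
          ((pathStep p)^[d] x).2 := by
  intro d
  induction d with
  | zero =>
    rintro j rfl x
    simp [addPath_empty]
  | succ d ih =>
    intro j hj x
    have hjn : j < n := by omega
    rw [Function.iterate_succ_apply, ← ih (j + 1) (by omega),
      ← Finset.insert_Ico_succ_left_eq_Ico hjn, sum_powerset_insert (by simp),
      ← sum_add_distrib]
    refine sum_congr rfl fun B hB => ?_
    have hB' : B ⊆ Ico (j + 1) n := mem_powerset.1 hB
    have hiso := not_addPath_adj hu hF hB' hjn
    have h1 := notMem_pathCompl u j
    have h2 := mem_pathCompl_of_le hu (le_refl (j + 1)) hjn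
    have h3 := mem_pathCompl_of_le hu (Nat.succ_le_of_lt hjn) le_rfl
    rw [addPath_insert, pathCompl_eq_insert hu hjn.le,
      twoMarked_insert _ _ _ _ hiso h1 h2 h3, twoMarked_insert_edge _ _ _ _ hiso h1 h2 h3,
      twoMarked_add]
    congr 1
    funext l
    exact add_comm _ _

/-- Attaching a cycle at `u n`: the sum of the weights of the graphs that arise from `F` by adding
a proper subset of the edges of the path `u 0, …, u n` and possibly the closing edge. -/
theorem sum_prod_classes_addPath (hu : Set.InjOn u (Set.Iic n))
    (hF : ∀ i < n, ∀ x, ¬ F.Adj (u i) x) (p q : ℕ → R) :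
    ∑ B ∈ (range n).ssubsets,
        ((∏ A ∈ (F.addPath u B).classes univ, if u 0 ∈ A then q #A else p #A) +
          ∏ A ∈ (F.addPath u B ⊔ edge (u n) (u 0)).classes univ,
            if u 0 ∈ A then q #A else p #A) =
      ∏ A ∈ F.classes (pathCompl u n),
        if u n ∈ A then cycleTransfer p n q #A else p #A := by
  have h := sum_twoMarked_addPath hu hF p n 0 (zero_add n)
    (fun _ => 0, fun s l => q (s + l) + q s * p l)
  rw [twoMarked_self _ _ _ _ (mem_pathCompl_of_le hu le_rfl le_rfl), pathCompl_zero,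
    ← range_eq_Ico] at h
  rw [cycleTransfer, ← h]
  have hsub : (range n).ssubsets ⊆ (range n).powerset := erase_subset _ _
  refine sum_subset_zero_on_sdiff hsub ?_ ?_
  · intro B hB
    rw [mem_sdiff, mem_powerset, mem_ssubsets] at hB
    -- the complete path connects the two marked vertices
    rw [twoMarked, if_pos ((reachable_addPath_iff hu hF hB.1).2 ?_), zero_mul]
    by_contra hne
    exact hB.2 (hB.1.ssubset_of_ne hne)
  · intro B hB
    rw [mem_ssubsets] at hB
    exact prod_classes_add_prod_classes_sup_edge _ _ _ _ (mem_univ _) (mem_univ _)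
      (mt (reachable_addPath_iff hu hF hB.1).1 hB.ne)

theorem prod_classes_sup_edge_of_mul (F : SimpleGraph V) {v w : V} (hvw : ¬ F.Reachable v w)
    (f : Finset V → R) (c : R)
    (hf : ∀ A A' : Finset V, Disjoint A A' → v ∈ A → w ∈ A' → f (A ∪ A') = c * (f A * f A')) :
    ∏ A ∈ (F ⊔ edge v w).classes univ, f A = c * ∏ A ∈ F.classes univ, f A := by
  rw [prod_classes_sup_edge F (mem_univ _),
    prod_classes_eq_mul_mul F (mem_univ v) (mem_univ w) hvw,
    hf _ _ (disjoint_cls F hvw) (self_mem_cls F v) (self_mem_cls F w)]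
  ring

/-- If a weight of vertex sets is multiplicative up to a factor `c v w` when sets containing `v`
and `w` are joined, then attaching a subset of the edges of a path contributes these factors. -/
theorem prod_classes_addPath_of_mul (hu : Set.InjOn u (Set.Iic n))
    (hF : ∀ i < n, ∀ x, ¬ F.Adj (u i) x) (f : Finset V → R) (c : V → V → R)
    (hf : ∀ v w, ∀ A A' : Finset V, Disjoint A A' → v ∈ A → w ∈ A' →
      f (A ∪ A') = c v w * (f A * f A')) (hB : B ⊆ range n) :
    ∏ A ∈ (F.addPath u B).classes univ, f A =
      (∏ i ∈ B, c (u i) (u (i + 1))) * ∏ A ∈ F.classes univ, f A := by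
  induction B using Finset.induction_on with
  | empty => simp [addPath_empty]
  | insert i B hi ih =>
    have hB' : B ⊆ range n := (subset_insert i B).trans hB
    have hin := mem_range.1 (hB (mem_insert_self i B))
    rw [addPath_insert, prod_classes_sup_edge_of_mul _
      (not_reachable_addPath hu hF hB' hi le_rfl (Nat.lt_succ_self i) hin) f _ (hf _ _),
      ih hB', prod_insert hi, mul_assoc]

end Path

end SimpleGraph

/-! ### Cycles and broken circuits of a cycle attached to a graph -/

namespace List

theorem idxOf_map_of_injective {α β : Type*} [DecidableEq α] [DecidableEq β] {f : α → β}
    (hf : Function.Injective f) (a : α) (l : List α) : (l.map f).idxOf (f a) = l.idxOf a := by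
  induction l with
  | nil => rfl
  | cons b l ih =>
    by_cases h : b = a
    · subst h; simp
    · have h' : f b ≠ f a := fun h' => h (hf h')
      rw [map_cons, idxOf_cons_ne _ h', idxOf_cons_ne _ h, ih]

end List

namespace EdgeOrderedGraph

open Finset SimpleGraph

variable (a : ℕ) (ha : 2 ≤ a) (G : EdgeOrderedGraph)

/-- The vertices `0, …, a - 1` of the cycle in `C_a + G`. -/
def cycleVertex (i : ℕ) : Fin (add (cycle a ha) G).n :=
  ⟨min i (a - 1), by have := G.pos; change min i (a - 1) < a + G.n - 1; omega⟩

/-- The `i`-th edge of the cycle in `C_a + G`; the closing edge has the index `a - 1`. -/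
def cycleEdge (i : ℕ) : Sym2 (Fin (add (cycle a ha) G).n) :=
  s(cycleVertex a ha G i, cycleVertex a ha G ((i + 1) % a))

/-- The inclusion of the vertices of `G` into those of `C_a + G`. -/
def inrEmb : Fin G.n ↪ Fin (add (cycle a ha) G).n :=
  ⟨inr (cycle a ha) G, inr_injective _ _⟩

/-- The map that contracts the cycle of `C_a + G` to the first vertex of `G`. -/
def contract (x : Fin (add (cycle a ha) G).n) : Fin G.n :=
  ⟨x.1 - (a - 1), by
    have h1 := G.pos
    have h2 : x.1 < a + G.n - 1 := x.2
    omega⟩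

@[simp]
theorem cycleVertex_val (i : ℕ) : (cycleVertex a ha G i).1 = min i (a - 1) := rfl

@[simp]
theorem inrEmb_val (x : Fin G.n) : (inrEmb a ha G x).1 = x.1 + (a - 1) := rfl

@[simp]
theorem contract_val (x : Fin (add (cycle a ha) G).n) : (contract a ha G x).1 = x.1 - (a - 1) := rfl

@[simp]
theorem contract_inrEmb (x : Fin G.n) : contract a ha G (inrEmb a ha G x) = x := by
  ext; simp

theorem cycleVertex_injOn : Set.InjOn (cycleVertex a ha G) (Set.Iic (a - 1)) := by
  intro i hi j hj h
  simp only [Set.mem_Iic, Fin.ext_iff, cycleVertex_val] at hi hj h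
  omega

theorem inrEmb_first : inrEmb a ha G G.first = cycleVertex a ha G (a - 1) := by
  ext
  simp [first]

theorem first_add_cycle : (add (cycle a ha) G).first = cycleVertex a ha G 0 := by
  ext
  simp [first]

theorem cycleEdge_of_lt {i : ℕ} (hi : i < a - 1) :
    cycleEdge a ha G i = s(cycleVertex a ha G i, cycleVertex a ha G (i + 1)) := by
  rw [cycleEdge, Nat.mod_eq_of_lt (by omega)]

theorem cycleEdge_last :
    cycleEdge a ha G (a - 1) = s(cycleVertex a ha G (a - 1), cycleVertex a ha G 0) := by
  rw [cycleEdge, Nat.sub_add_cancel (by omega), Nat.mod_self]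

/-- The inclusion of the vertices of the cycle into those of `C_a + G`. -/
def inlEmb : Fin a ↪ Fin (add (cycle a ha) G).n :=
  ⟨inl (cycle a ha) G, inl_injective _ _⟩

/-- The `i`-th edge of the cycle, as an edge of `C_a` itself. -/
def cycleOwnEdge (i : Fin a) : Sym2 (Fin a) :=
  s(i, (⟨(i.1 + 1) % a, Nat.mod_lt _ i.pos⟩ : Fin a))

theorem map_inlEmb_cycleOwnEdge (i : Fin a) :
    (cycleOwnEdge a i).map (inlEmb a ha G) = cycleEdge a ha G i := by
  have h1 := i.2
  have h2 : (i.1 + 1) % a < a := Nat.mod_lt _ (by omega)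
  have key : ∀ k : Fin a, inlEmb a ha G k = cycleVertex a ha G k := by
    intro k
    have := k.2
    ext
    change k.1 = min k.1 (a - 1)
    omega
  rw [cycleOwnEdge, Sym2.map_mk, cycleEdge, key, key]

theorem edges_add_cycle : (add (cycle a ha) G).edges =
    ((List.ofFn (cycleOwnEdge a)).dedup).map (Sym2.map (inlEmb a ha G)) ++
      G.edges.map (Sym2.map (inrEmb a ha G)) := rfl

theorem mem_edges_add_cycle (e : Sym2 (Fin (add (cycle a ha) G).n)) :
    e ∈ (add (cycle a ha) G).edges ↔
      (∃ i < a, e = cycleEdge a ha G i) ∨ ∃ f ∈ G.edges, e = f.map (inrEmb a ha G) := by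
  rw [edges_add_cycle, List.mem_append, List.mem_map, List.mem_map]
  refine or_congr ?_ ?_
  · constructor
    · rintro ⟨f, hf, rfl⟩
      rw [List.mem_dedup, List.mem_ofFn] at hf
      obtain ⟨i, rfl⟩ := hf
      exact ⟨i, i.2, map_inlEmb_cycleOwnEdge a ha G i⟩
    · rintro ⟨i, hi, rfl⟩
      refine ⟨cycleOwnEdge a ⟨i, hi⟩, ?_, map_inlEmb_cycleOwnEdge a ha G ⟨i, hi⟩⟩
      rw [List.mem_dedup, List.mem_ofFn]
      exact ⟨⟨i, hi⟩, rfl⟩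
  · exact ⟨fun ⟨f, h1, h2⟩ => ⟨f, h1, h2.symm⟩, fun ⟨f, h1, h2⟩ => ⟨f, h1, h2.symm⟩⟩

theorem mem_edgeSet_graph (H : EdgeOrderedGraph) (e : Sym2 (Fin H.n)) :
    e ∈ H.graph.edgeSet ↔ e ∈ H.edges := by
  rw [graph, edgeSet_fromEdgeSet, Set.mem_sdiff]
  exact ⟨fun h => h.1, fun h => ⟨h, H.loopless e h⟩⟩

theorem cycleEdge_not_isDiag {i : ℕ} (hi : i < a) : ¬ (cycleEdge a ha G i).IsDiag :=
  (add (cycle a ha) G).loopless _ ((mem_edges_add_cycle a ha G _).2 (Or.inl ⟨i, hi, rfl⟩))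

theorem inrEmb_ne_of_lt {i : ℕ} (hi : i < a - 1) (x : Fin G.n) :
    inrEmb a ha G x ≠ cycleVertex a ha G i := by
  intro h
  rw [Fin.ext_iff, inrEmb_val, cycleVertex_val] at h
  omega

/-- No edge of the cycle is an edge of the attached graph. -/
theorem map_inrEmb_ne_cycleEdge {i : ℕ} (hi : i < a) (f : Sym2 (Fin G.n)) :
    f.map (inrEmb a ha G) ≠ cycleEdge a ha G i := by
  induction f using Sym2.ind with | _ x y => ?_
  intro h
  rcases Nat.lt_or_ge i (a - 1) with h' | h'
  · rw [cycleEdge_of_lt a ha G h', Sym2.map_mk, Sym2.eq_iff] at h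
    rcases h with ⟨h, -⟩ | ⟨-, h⟩ <;> exact inrEmb_ne_of_lt a ha G h' _ h
  · obtain rfl : i = a - 1 := by omega
    rw [cycleEdge_last a ha G, Sym2.map_mk, Sym2.eq_iff] at h
    rcases h with ⟨-, h⟩ | ⟨h, -⟩ <;> exact inrEmb_ne_of_lt a ha G (by omega) _ h

theorem cycleEdge_injOn (ha3 : 3 ≤ a) {i j : ℕ} (hi : i < a) (hj : j < a)
    (h : cycleEdge a ha G i = cycleEdge a ha G j) : i = j := by
  have key : ∀ k < a, cycleEdge a ha G k =
      s(cycleVertex a ha G k, cycleVertex a ha G (if k = a - 1 then 0 else k + 1)) := by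
    intro k hk
    split_ifs with h
    · rw [h, cycleEdge_last]
    · exact cycleEdge_of_lt a ha G (by omega)
  rw [key i hi, key j hj, Sym2.eq_iff] at h
  simp only [Fin.ext_iff, cycleVertex_val] at h
  split_ifs at h <;> omega

/-- A cycle of `C_a + G` that contains an edge of `C_a` contains all of them, and `a ≥ 3`: if
`e` and `g` are edges of `C_a`, then `e` is a bridge as soon as `g` is removed. -/
theorem cycleEdge_mem_of_isCycle {v : Fin (add (cycle a ha) G).n}
    (p : (add (cycle a ha) G).graph.Walk v v) (hp : p.IsCycle) {i : ℕ} (hi : i < a)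
    (hip : cycleEdge a ha G i ∈ p.edges) : 3 ≤ a ∧ ∀ j < a, cycleEdge a ha G j ∈ p.edges := by
  have key : ∀ j < a, j ≠ i → ¬ (cycleEdge a ha G j ∉ p.edges ∨ a = 2) := by
    intro j hj hji hor
    set H : SimpleGraph (Fin (add (cycle a ha) G).n) := fromEdgeSet {e | e ∈ p.edges} with hH
    have hpH : ∀ e ∈ p.edges, e ∈ H.edgeSet := by
      intro e he
      rw [hH, edgeSet_fromEdgeSet]
      exact ⟨he, not_isDiag_of_mem_edgeSet _ (p.edges_subset_edgeSet he)⟩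
    have hc := (hp.transfer hpH)
    have hr := (adj_and_reachable_delete_edges_iff_exists_cycle (G := H)
      (v := cycleVertex a ha G i) (w := cycleVertex a ha G ((i + 1) % a))).2
        ⟨v, _, hc, by rw [Walk.edges_transfer]; exact hip⟩
    -- Without the edges `i` and `j`, no edge joins the vertices of the cycle with indices in
    -- `(min i j, max i j]` to the other vertices.
    have hχ := Reachable.apply_eq
      (fun x : Fin (add (cycle a ha) G).n => min i j < min x.1 (a - 1) ∧
        min x.1 (a - 1) ≤ max i j) ?_ hr.2
    · rw [eq_iff_iff] at hχ
      simp only [cycleVertex_val] at hχ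
      rcases Nat.lt_or_ge (i + 1) a with h | h
      · rw [Nat.mod_eq_of_lt h] at hχ
        omega
      · obtain rfl : i + 1 = a := by omega
        rw [Nat.mod_self] at hχ
        omega
    · intro x y hxy
      rw [deleteEdges_adj, Set.mem_singleton_iff, hH, fromEdgeSet_adj] at hxy
      obtain ⟨⟨hxy, -⟩, hne⟩ := hxy
      have hxy' := (mem_edges_add_cycle a ha G _).1
        ((mem_edgeSet_graph _ _).1 (p.edges_subset_edgeSet hxy))
      rw [eq_iff_iff]
      rcases hxy' with ⟨k, hk, hke⟩ | ⟨f, -, hf⟩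
      · have hki : k ≠ i := by
          rintro rfl
          exact hne hke
        have hkj : k ≠ j := by
          rintro rfl
          rcases hor with h | h
          · exact h (hke ▸ hxy)
          · -- for `a = 2` the two edges coincide
            subst h
            apply hne
            rw [hke]
            have h01 : (i = 0 ∧ k = 1) ∨ (i = 1 ∧ k = 0) := by omega
            rcases h01 with ⟨rfl, rfl⟩ | ⟨rfl, rfl⟩
            · exact Sym2.eq_swap
            · exact Sym2.eq_swap
        rcases Nat.lt_or_ge k (a - 1) with h | h
        · rw [cycleEdge_of_lt a ha G h, Sym2.eq_iff] at hke
          rcases hke with ⟨rfl, rfl⟩ | ⟨rfl, rfl⟩ <;> simp only [cycleVertex_val] <;> omega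
        · obtain rfl : k = a - 1 := by omega
          rw [cycleEdge_last, Sym2.eq_iff] at hke
          rcases hke with ⟨rfl, rfl⟩ | ⟨rfl, rfl⟩ <;> simp only [cycleVertex_val] <;> omega
      · induction f using Sym2.ind with | _ b c => ?_
        rw [Sym2.map_mk, Sym2.eq_iff] at hf
        rcases hf with ⟨rfl, rfl⟩ | ⟨rfl, rfl⟩ <;> simp only [inrEmb_val] <;> omega
  constructor
  · by_contra h
    obtain rfl : a = 2 := by omega
    exact key (1 - i) (by omega) (by omega) (Or.inr rfl)
  · intro j hj
    by_cases hji : j = i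
    · rwa [hji]
    · exact not_not.1 fun h => key j hj hji (Or.inl h)

theorem edgeLE_map_inrEmb (e f : Sym2 (Fin G.n)) :
    (add (cycle a ha) G).edgeLE (e.map (inrEmb a ha G)) (f.map (inrEmb a ha G)) ↔
      G.edgeLE e f := by
  have key : ∀ f : Sym2 (Fin G.n), (add (cycle a ha) G).edges.idxOf (f.map (inrEmb a ha G)) =
      (((List.ofFn (cycleOwnEdge a)).dedup).map (Sym2.map (inlEmb a ha G))).length +
        G.edges.idxOf f := by
    intro f
    rw [edges_add_cycle, List.idxOf_append_of_notMem,
      List.idxOf_map_of_injective (Sym2.map.injective (inrEmb a ha G).injective)]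
    rw [List.mem_map]
    rintro ⟨g, hg, hgf⟩
    rw [List.mem_dedup, List.mem_ofFn] at hg
    obtain ⟨i, rfl⟩ := hg
    exact map_inrEmb_ne_cycleEdge a ha G i.2 f
      (hgf.symm.trans (map_inlEmb_cycleOwnEdge a ha G i))
  rw [edgeLE, edgeLE, key, key]
  omega

theorem edgeLE_cycleEdge (ha3 : 3 ≤ a) {i j : ℕ} (hi : i < a) (hj : j < a) :
    (add (cycle a ha) G).edgeLE (cycleEdge a ha G i) (cycleEdge a ha G j) ↔ i ≤ j := by
  have hinj : Function.Injective fun i : Fin a => cycleEdge a ha G i := fun i j hij =>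
    Fin.ext (cycleEdge_injOn a ha G ha3 i.2 j.2 hij)
  have hcomp : (Sym2.map (inlEmb a ha G)) ∘ cycleOwnEdge a = fun i : Fin a => cycleEdge a ha G i :=
    funext fun i => map_inlEmb_cycleOwnEdge a ha G i
  have hinj' : Function.Injective (cycleOwnEdge a) := by
    rw [← hcomp] at hinj
    exact hinj.of_comp
  have key : ∀ k < a, (add (cycle a ha) G).edges.idxOf (cycleEdge a ha G k) = k := by
    intro k hk
    rw [edges_add_cycle, (List.nodup_ofFn.2 hinj').dedup, List.map_ofFn, hcomp,
      List.idxOf_append_of_mem (by rw [List.mem_ofFn]; exact ⟨⟨k, hk⟩, rfl⟩)]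
    have h2 := (List.nodup_ofFn.2 hinj).idxOf_getElem k (by simpa using hk)
    rwa [List.getElem_ofFn] at h2
  rw [edgeLE, key i hi, key j hj]

end EdgeOrderedGraph

/-! ### Non-broken circuits of a cycle attached to a graph -/

namespace EdgeOrderedGraph

open Finset SimpleGraph

variable (a : ℕ) (ha : 2 ≤ a) (G : EdgeOrderedGraph)

/-- The subgraph of `C_a + G` that consists of the subgraph `F` of `G`, the edges `i — (i + 1)` of
the cycle with `i ∈ B`, and, if `ε` is true, the closing edge of the cycle. -/
def glue (B : Finset ℕ) (ε : Bool) (F : SimpleGraph (Fin G.n)) :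
    SimpleGraph (Fin (add (cycle a ha) G).n) :=
  if ε then (F.map (inrEmb a ha G)).addPath (cycleVertex a ha G) B ⊔
      edge (cycleVertex a ha G (a - 1)) (cycleVertex a ha G 0)
    else (F.map (inrEmb a ha G)).addPath (cycleVertex a ha G) B

theorem not_map_inrEmb_adj (F : SimpleGraph (Fin G.n)) {i : ℕ} (hi : i < a - 1)
    (x : Fin (add (cycle a ha) G).n) :
    ¬ (F.map (inrEmb a ha G)).Adj (cycleVertex a ha G i) x := by
  rw [map_adj]
  rintro ⟨y, z, -, hy, -⟩
  exact inrEmb_ne_of_lt a ha G hi y hy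

variable {a ha G} in
theorem mem_edgeSet_glue {B : Finset ℕ} (hB : B ⊆ range (a - 1)) {ε : Bool}
    {F : SimpleGraph (Fin G.n)} (e : Sym2 (Fin (add (cycle a ha) G).n)) :
    e ∈ (glue a ha G B ε F).edgeSet ↔ (∃ f ∈ F.edgeSet, f.map (inrEmb a ha G) = e) ∨
      (∃ i ∈ B, cycleEdge a ha G i = e) ∨ (ε = true ∧ cycleEdge a ha G (a - 1) = e) := by
  induction e using Sym2.ind with | _ x y => ?_
  have h1 : (F.map (inrEmb a ha G)).Adj x y ↔
      ∃ f ∈ F.edgeSet, f.map (inrEmb a ha G) = s(x, y) := by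
    rw [← mem_edgeSet, edgeSet_map]
    rfl
  have h2 : (∃ i ∈ B, s(cycleVertex a ha G i, cycleVertex a ha G (i + 1)) = s(x, y) ∧ x ≠ y) ↔
      ∃ i ∈ B, cycleEdge a ha G i = s(x, y) := by
    refine exists_congr fun i => and_congr_right fun hi => ?_
    have hia := mem_range.1 (hB hi)
    rw [← cycleEdge_of_lt a ha G hia]
    refine ⟨fun h => h.1, fun h => ⟨h, ?_⟩⟩
    have := cycleEdge_not_isDiag a ha G (i := i) (by omega)
    rwa [h, Sym2.mk_isDiag_iff] at this
  have h3 : (edge (cycleVertex a ha G (a - 1)) (cycleVertex a ha G 0)).Adj x y ↔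
      cycleEdge a ha G (a - 1) = s(x, y) := by
    rw [adj_edge, ← cycleEdge_last]
    refine ⟨fun h => h.1, fun h => ⟨h, ?_⟩⟩
    have := cycleEdge_not_isDiag a ha G (i := a - 1) (by omega)
    rwa [h, Sym2.mk_isDiag_iff] at this
  rw [mem_edgeSet, glue]
  cases ε
  · simp only [Bool.false_eq_true, if_false, false_and, or_false]
    rw [addPath_adj, h1, h2]
  · simp only [if_true, true_and]
    rw [sup_adj, addPath_adj, h1, h2, h3, or_assoc]

variable {a ha G}

theorem comap_glue {B : Finset ℕ} (hB : B ⊆ range (a - 1)) {ε : Bool}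
    {F : SimpleGraph (Fin G.n)} : (glue a ha G B ε F).comap (inrEmb a ha G) = F := by
  ext x y
  rw [comap_adj, ← mem_edgeSet, mem_edgeSet_glue hB, ← mem_edgeSet, ← Sym2.map_mk]
  constructor
  · rintro (⟨f, hf, h⟩ | ⟨i, hi, h⟩ | ⟨-, h⟩)
    · rwa [← Sym2.map.injective (inrEmb a ha G).injective h]
    · have := mem_range.1 (hB hi)
      exact absurd h.symm (map_inrEmb_ne_cycleEdge a ha G (by omega) _)
    · exact absurd h.symm (map_inrEmb_ne_cycleEdge a ha G (by omega) _)
  · exact fun h => Or.inl ⟨_, h, rfl⟩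

/-- The edges of the cycle can be recovered from a glued graph. For `a = 2` the only edge of the cycle
is governed by `ε`, because `B` is empty. -/
theorem subset_of_glue_eq {B B' : Finset ℕ} (hB : B ⊂ range (a - 1)) (hB' : B' ⊂ range (a - 1))
    {ε ε' : Bool} {F F' : SimpleGraph (Fin G.n)}
    (h : glue a ha G B ε F = glue a ha G B' ε' F') : B ⊆ B' ∧ (ε = true → ε' = true) := by
  have ha3 : 3 ≤ a ∨ (B = ∅ ∧ B' = ∅) := by
    by_cases h3 : 3 ≤ a
    · exact Or.inl h3
    · obtain rfl : a = 2 := by omega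
      right
      constructor
      · simpa using hB
      · simpa using hB'
  have hmem : ∀ e, e ∈ (glue a ha G B ε F).edgeSet → e ∈ (glue a ha G B' ε' F').edgeSet := by
    rw [h]; exact fun _ => id
  constructor
  · intro i hi
    rcases ha3 with ha3 | ⟨rfl, -⟩
    · have hia := mem_range.1 (hB.1 hi)
      have := hmem (cycleEdge a ha G i)
        ((mem_edgeSet_glue hB.1 _).2 (Or.inr (Or.inl ⟨i, hi, rfl⟩)))
      rw [mem_edgeSet_glue hB'.1] at this
      rcases this with ⟨f, -, hf⟩ | ⟨j, hj, hij⟩ | ⟨-, hij⟩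
      · exact absurd hf (map_inrEmb_ne_cycleEdge a ha G (by omega) _)
      · have hja := mem_range.1 (hB'.1 hj)
        rwa [← cycleEdge_injOn a ha G ha3 (by omega) (by omega) hij]
      · have := cycleEdge_injOn a ha G ha3 (by omega) (by omega) hij
        omega
    · exact absurd hi (notMem_empty i)
  · intro hε
    have := hmem (cycleEdge a ha G (a - 1))
      ((mem_edgeSet_glue hB.1 _).2 (Or.inr (Or.inr ⟨hε, rfl⟩)))
    rw [mem_edgeSet_glue hB'.1] at this
    rcases this with ⟨f, -, hf⟩ | ⟨j, hj, hij⟩ | ⟨h, -⟩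
    · exact absurd hf (map_inrEmb_ne_cycleEdge a ha G (by omega) _)
    · rcases ha3 with ha3 | ⟨-, rfl⟩
      · have hja := mem_range.1 (hB'.1 hj)
        have := cycleEdge_injOn a ha G ha3 (by omega) (by omega) hij
        omega
      · exact absurd hj (notMem_empty j)
    · exact h

/-- The broken circuits of `G` are broken circuits of `C_a + G`. -/
theorem IsBrokenCircuit.map_inrEmb {B : Set (Sym2 (Fin G.n))} (hB : G.IsBrokenCircuit B) :
    (add (cycle a ha) G).IsBrokenCircuit (Sym2.map (inrEmb a ha G) '' B) := by
  obtain ⟨v, p, hp, e, he, hmax, rfl⟩ := hB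
  have hhom : ∀ x y, G.graph.Adj x y →
      (add (cycle a ha) G).graph.Adj (inrEmb a ha G x) (inrEmb a ha G y) := by
    intro x y hxy
    rw [← mem_edgeSet, mem_edgeSet_graph] at hxy ⊢
    exact (mem_edges_add_cycle a ha G _).2 (Or.inr ⟨_, hxy, rfl⟩)
  let φ : G.graph →g (add (cycle a ha) G).graph := ⟨inrEmb a ha G, fun {x y} => hhom x y⟩
  have hedges : (p.map φ).edges = p.edges.map (Sym2.map (inrEmb a ha G)) := p.edges_map φ
  have hinj := Sym2.map.injective (inrEmb a ha G).injective
  refine ⟨_, p.map φ, hp.map (inrEmb a ha G).injective, e.map (inrEmb a ha G), ?_, ?_, ?_⟩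
  · rw [hedges]
    exact List.mem_map_of_mem he
  · intro f hf
    rw [hedges, List.mem_map] at hf
    obtain ⟨g, hg, rfl⟩ := hf
    exact (edgeLE_map_inrEmb a ha G g e).2 (hmax g hg)
  · ext f
    simp only [hedges, List.mem_map, Set.mem_image, Set.mem_ofPred_eq]
    constructor
    · rintro ⟨g, ⟨hg1, hg2⟩, rfl⟩
      exact ⟨⟨g, hg1, rfl⟩, fun h => hg2 (hinj h)⟩
    · rintro ⟨⟨g, hg1, rfl⟩, hg2⟩
      exact ⟨g, ⟨hg1, fun h => hg2 (h ▸ rfl)⟩, rfl⟩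

/-- For `a ≥ 3` the edges of the cycle other than the closing edge form a broken circuit. -/
theorem isBrokenCircuit_path (ha3 : 3 ≤ a) :
    (add (cycle a ha) G).IsBrokenCircuit {e | ∃ i < a - 1, cycleEdge a ha G i = e} := by
  set H : SimpleGraph (Fin (add (cycle a ha) G).n) :=
    fromEdgeSet {e | ∃ i < a, cycleEdge a ha G i = e} with hH
  have hmemH : ∀ e, e ∈ H.edgeSet ↔ ∃ i < a, cycleEdge a ha G i = e := by
    intro e
    rw [hH, edgeSet_fromEdgeSet, Set.mem_sdiff, Set.mem_ofPred_eq]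
    refine ⟨fun h => h.1, fun h => ⟨h, ?_⟩⟩
    obtain ⟨i, hi, rfl⟩ := h
    exact cycleEdge_not_isDiag a ha G hi
  have hle : H ≤ (add (cycle a ha) G).graph := by
    rw [← edgeSet_subset_edgeSet]
    intro e he
    obtain ⟨i, hi, rfl⟩ := (hmemH e).1 he
    rw [mem_edgeSet_graph]
    exact (mem_edges_add_cycle a ha G _).2 (Or.inl ⟨i, hi, rfl⟩)
  -- The path closes up to a cycle, which then contains all edges of `C_a`.
  have hreach : (H.deleteEdges {s(cycleVertex a ha G (a - 1), cycleVertex a ha G 0)}).Reachable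
      (cycleVertex a ha G (a - 1)) (cycleVertex a ha G 0) := by
    refine Reachable.mono ?_
      (reachable_addPath_range ⊥ (cycleVertex a ha G) (a - 1) (a - 1) le_rfl).symm
    intro x y hxy
    rw [addPath_adj] at hxy
    rcases hxy with hxy | ⟨i, hi, hxy, -⟩
    · exact absurd hxy (by simp)
    · have hia := mem_range.1 hi
      rw [← cycleEdge_of_lt a ha G hia] at hxy
      rw [deleteEdges_adj, ← mem_edgeSet, hmemH, Set.mem_singleton_iff, ← cycleEdge_last, ← hxy]
      refine ⟨⟨i, by omega, rfl⟩, fun h => ?_⟩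
      have := cycleEdge_injOn a ha G ha3 (by omega) (by omega) h
      omega
  obtain ⟨v, p, hp, hclose⟩ := (adj_and_reachable_delete_edges_iff_exists_cycle (G := H)).1
    ⟨by rw [← mem_edgeSet, hmemH]; exact ⟨a - 1, by omega, cycleEdge_last a ha G⟩, hreach⟩
  rw [← cycleEdge_last] at hclose
  have hedges := Walk.edges_mapLe_eq_edges hle p
  have hall := (cycleEdge_mem_of_isCycle a ha G _ (hp.mapLe hle) (i := a - 1) (by omega)
    (by rw [hedges]; exact hclose)).2
  rw [hedges] at hall
  refine ⟨v, _, hp.mapLe hle, cycleEdge a ha G (a - 1), ?_, ?_, ?_⟩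
  · rw [hedges]; exact hclose
  · intro f hf
    rw [hedges] at hf
    obtain ⟨i, hi, rfl⟩ := (hmemH f).1 (p.edges_subset_edgeSet hf)
    rw [edgeLE_cycleEdge a ha G ha3 hi (by omega)]
    omega
  · ext f
    rw [hedges]
    constructor
    · rintro ⟨i, hi, rfl⟩
      refine ⟨hall i (by omega), fun h => ?_⟩
      have := cycleEdge_injOn a ha G ha3 (by omega) (by omega) h
      omega
    · rintro ⟨hf, hne⟩
      obtain ⟨i, hi, rfl⟩ := (hmemH f).1 (p.edges_subset_edgeSet hf)
      refine ⟨i, ?_, rfl⟩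
      by_contra h
      obtain rfl : i = a - 1 := by omega
      exact hne rfl

/-- A broken circuit of `C_a + G` contains the path of the cycle or comes from `G`. -/
theorem IsBrokenCircuit.path_subset_or {B : Set (Sym2 (Fin (add (cycle a ha) G).n))}
    (hB : (add (cycle a ha) G).IsBrokenCircuit B) :
    (3 ≤ a ∧ ∀ i < a - 1, cycleEdge a ha G i ∈ B) ∨
      ∃ B', G.IsBrokenCircuit B' ∧ B = Sym2.map (inrEmb a ha G) '' B' := by
  obtain ⟨v, p, hp, e, he, hmax, rfl⟩ := hB
  by_cases hcyc : ∃ i < a, cycleEdge a ha G i ∈ p.edges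
  · obtain ⟨i, hi, hip⟩ := hcyc
    obtain ⟨ha3, hall⟩ := cycleEdge_mem_of_isCycle a ha G p hp hi hip
    refine Or.inl ⟨ha3, fun j hj => ⟨hall j (by omega), ?_⟩⟩
    rintro rfl
    have := (edgeLE_cycleEdge a ha G ha3 (by omega) (by omega)).1
      (hmax _ (hall (a - 1) (by omega)))
    omega
  · right
    push Not at hcyc
    have hinr : ∀ f ∈ p.edges, ∃ g ∈ G.edges, f = g.map (inrEmb a ha G) := by
      intro f hf
      have := (mem_edges_add_cycle a ha G _).1
        ((mem_edgeSet_graph _ _).1 (p.edges_subset_edgeSet hf))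
      rcases this with ⟨i, hi, rfl⟩ | h
      · exact absurd hf (hcyc i hi)
      · exact h
    have hcontract : ∀ g : Sym2 (Fin G.n),
        (g.map (inrEmb a ha G)).map (contract a ha G) = g := by
      intro g
      induction g using Sym2.ind with | _ x y => ?_
      simp only [Sym2.map_mk, contract_inrEmb]
    have hcontract' : ∀ f ∈ p.edges, (f.map (contract a ha G)).map (inrEmb a ha G) = f := by
      intro f hf
      obtain ⟨g, -, rfl⟩ := hinr f hf
      rw [hcontract]
    -- the walk stays in the image of `G`, so that it can be contracted to a walk in `G`
    let H : SimpleGraph (Fin (add (cycle a ha) G).n) := G.graph.map (inrEmb a ha G)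
    have hpH : ∀ f ∈ p.edges, f ∈ H.edgeSet := by
      intro f hf
      obtain ⟨g, hg, rfl⟩ := hinr f hf
      rw [edgeSet_map]
      exact ⟨g, (mem_edgeSet_graph _ _).2 hg, rfl⟩
    have hhom : ∀ x y, H.Adj x y → G.graph.Adj (contract a ha G x) (contract a ha G y) := by
      intro x y hxy
      rw [map_adj] at hxy
      obtain ⟨x, y, hxy, rfl, rfl⟩ := hxy
      rwa [contract_inrEmb, contract_inrEmb]
    let φ : H →g G.graph := ⟨contract a ha G, fun {x y} => hhom x y⟩
    have hedges : ((p.transfer H hpH).map φ).edges = p.edges.map (Sym2.map (contract a ha G)) := by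
      rw [Walk.edges_map, Walk.edges_transfer]
      rfl
    have hsupp : ∀ x ∈ p.support, ∃ y, x = inrEmb a ha G y := by
      intro x hx
      have hx' : ∃ f ∈ p.edges, x ∈ f := by
        rcases Walk.mem_support_iff_exists_mem_edges.1 hx with rfl | h
        · cases p with
          | nil => exact absurd rfl hp.ne_nil
          | cons h q => exact ⟨_, by rw [Walk.edges_cons]; exact List.mem_cons_self, by simp⟩
        · exact h
      obtain ⟨f, hf, hxf⟩ := hx'
      obtain ⟨g, -, rfl⟩ := hinr f hf
      obtain ⟨y, -, rfl⟩ := Sym2.mem_map.1 hxf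
      exact ⟨y, rfl⟩
    have hcyc' : ((p.transfer H hpH).map φ).IsCycle := by
      rw [Walk.isCycle_def, Walk.isTrail_def, hedges]
      refine ⟨?_, ?_, ?_⟩
      · refine List.Nodup.map_on ?_ hp.edges_nodup
        intro f hf g hg hfg
        rw [← hcontract' f hf, hfg, hcontract' g hg]
      · intro h
        have : ((p.transfer H hpH).map φ).edges = [] := by rw [h]; rfl
        rw [hedges, List.map_eq_nil_iff] at this
        rw [this] at he
        exact absurd he List.not_mem_nil
      · rw [Walk.support_map, Walk.support_transfer, ← List.map_tail]
        refine List.Nodup.map_on ?_ hp.support_nodup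
        intro x hx y hy hxy
        obtain ⟨x, rfl⟩ := hsupp x (List.mem_of_mem_tail hx)
        obtain ⟨y, rfl⟩ := hsupp y (List.mem_of_mem_tail hy)
        change contract a ha G _ = contract a ha G _ at hxy
        rw [contract_inrEmb, contract_inrEmb] at hxy
        rw [hxy]
    refine ⟨_, ⟨_, _, hcyc', e.map (contract a ha G), ?_, ?_, rfl⟩, ?_⟩
    · rw [hedges]; exact List.mem_map_of_mem he
    · intro f hf
      rw [hedges, List.mem_map] at hf
      obtain ⟨g, hg, rfl⟩ := hf
      rw [← edgeLE_map_inrEmb a ha, hcontract' g hg, hcontract' e he]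
      exact hmax g hg
    · ext f
      simp only [hedges, List.mem_map, Set.mem_image, Set.mem_ofPred_eq]
      constructor
      · rintro ⟨hf, hne⟩
        refine ⟨f.map (contract a ha G), ⟨⟨f, hf, rfl⟩, fun h => hne ?_⟩, hcontract' f hf⟩
        rw [← hcontract' f hf, h, hcontract' e he]
      · rintro ⟨_, ⟨⟨g, hg, rfl⟩, hne⟩, rfl⟩
        rw [hcontract' g hg]
        exact ⟨hg, fun h => hne (h ▸ rfl)⟩

theorem isNonBroken_glue {B : Finset ℕ} (hB : B ⊂ range (a - 1)) (ε : Bool)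
    {F : SimpleGraph (Fin G.n)} (hF : G.IsNonBroken F) :
    (add (cycle a ha) G).IsNonBroken (glue a ha G B ε F) := by
  constructor
  · rw [← edgeSet_subset_edgeSet]
    intro e he
    rw [mem_edgeSet_graph, mem_edges_add_cycle]
    rcases (mem_edgeSet_glue hB.1 e).1 he with ⟨f, hf, rfl⟩ | ⟨i, hi, rfl⟩ | ⟨-, rfl⟩
    · exact Or.inr ⟨f, (mem_edgeSet_graph _ _).1 (edgeSet_mono hF.1 hf), rfl⟩
    · have := mem_range.1 (hB.1 hi)
      exact Or.inl ⟨i, by omega, rfl⟩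
    · exact Or.inl ⟨a - 1, by omega, rfl⟩
  · intro C hC hsub
    rcases hC.path_subset_or with ⟨ha3, h⟩ | ⟨C', hC', rfl⟩
    · apply hB.2
      intro i hi
      have hia := mem_range.1 hi
      rcases (mem_edgeSet_glue hB.1 _).1 (hsub (h i hia)) with ⟨f, -, hf⟩ | ⟨j, hj, hij⟩ | ⟨-, hij⟩
      · exact absurd hf (map_inrEmb_ne_cycleEdge a ha G (by omega) _)
      · have := mem_range.1 (hB.1 hj)
        rwa [← cycleEdge_injOn a ha G ha3 (by omega) (by omega) hij]
      · have := cycleEdge_injOn a ha G ha3 (by omega) (by omega) hij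
        omega
    · apply hF.2 C' hC'
      intro f hf
      rcases (mem_edgeSet_glue hB.1 _).1 (hsub ⟨f, hf, rfl⟩) with ⟨g, hg, h⟩ | ⟨j, hj, h⟩ | ⟨-, h⟩
      · rwa [← Sym2.map.injective (inrEmb a ha G).injective h]
      · have := mem_range.1 (hB.1 hj)
        exact absurd h.symm (map_inrEmb_ne_cycleEdge a ha G (by omega) _)
      · exact absurd h.symm (map_inrEmb_ne_cycleEdge a ha G (by omega) _)

open Classical in
/-- Every non-broken circuit of `C_a + G` is glued from a non-broken circuit of `G` and a proper
subset of the path. -/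
theorem IsNonBroken.exists_eq_glue {F : SimpleGraph (Fin (add (cycle a ha) G).n)}
    (hF : (add (cycle a ha) G).IsNonBroken F) :
    ∃ B ⊂ range (a - 1), ∃ ε : Bool, ∃ F', G.IsNonBroken F' ∧ glue a ha G B ε F' = F := by
  -- for `a = 2` the only edge of the cycle is regarded as the closing edge
  have hsub : (range (a - 1)).filter (fun i => cycleEdge a ha G i ∈ F.edgeSet ∧
      cycleEdge a ha G i ≠ cycleEdge a ha G (a - 1)) ⊆ range (a - 1) := filter_subset _ _
  refine ⟨_, ⟨hsub, ?_⟩, decide (cycleEdge a ha G (a - 1) ∈ F.edgeSet),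
    F.comap (inrEmb a ha G), ⟨?_, ?_⟩, ?_⟩
  · intro hall
    by_cases ha3 : 3 ≤ a
    · apply hF.2 _ (isBrokenCircuit_path ha3)
      rintro e ⟨i, hi, rfl⟩
      exact (mem_filter.1 (hall (mem_range.2 hi))).2.1
    · obtain rfl : a = 2 := by omega
      have := (mem_filter.1 (hall (mem_range.2 (by norm_num : 0 < 2 - 1)))).2.2
      exact this Sym2.eq_swap
  · intro x y hxy
    have h := hF.1 (comap_adj.1 hxy)
    rw [← mem_edgeSet, mem_edgeSet_graph, mem_edges_add_cycle, ← Sym2.map_mk] at h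
    rw [← mem_edgeSet, mem_edgeSet_graph]
    rcases h with ⟨i, hi, h⟩ | ⟨f, hf, h⟩
    · exact absurd h (map_inrEmb_ne_cycleEdge a ha G hi _)
    · rwa [Sym2.map.injective (inrEmb a ha G).injective h]
  · intro C hC hsub
    apply hF.2 _ hC.map_inrEmb
    rintro _ ⟨f, hf, rfl⟩
    have := hsub hf
    induction f using Sym2.ind with | _ x y => ?_
    exact this
  · rw [← edgeSet_inj]
    ext e
    rw [mem_edgeSet_glue hsub]
    constructor
    · rintro (⟨f, hf, rfl⟩ | ⟨i, hi, rfl⟩ | ⟨h, rfl⟩)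
      · induction f using Sym2.ind with | _ x y => ?_
        exact hf
      · exact (mem_filter.1 hi).2.1
      · exact of_decide_eq_true h
    · intro he
      have h := edgeSet_mono hF.1 he
      rw [mem_edgeSet_graph, mem_edges_add_cycle] at h
      rcases h with ⟨i, hi, rfl⟩ | ⟨f, hf, rfl⟩
      · right
        by_cases hlast : cycleEdge a ha G i = cycleEdge a ha G (a - 1)
        · exact Or.inr ⟨decide_eq_true (hlast ▸ he), hlast.symm⟩
        · refine Or.inl ⟨i, mem_filter.2 ⟨mem_range.2 ?_, he, hlast⟩, rfl⟩
          by_contra h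
          obtain rfl : i = a - 1 := by omega
          exact hlast rfl
      · refine Or.inl ⟨f, ?_, rfl⟩
        induction f using Sym2.ind with | _ x y => ?_
        exact he

open Classical in
/-- Sums over the non-broken circuits of `C_a + G`, by the bijection `glue`. -/
theorem sum_isNonBroken_add_cycle {R : Type*} [AddCommMonoid R]
    (Ψ : SimpleGraph (Fin (add (cycle a ha) G).n) → R) :
    ∑ F : {F // (add (cycle a ha) G).IsNonBroken F}, Ψ F =
      ∑ F : {F // G.IsNonBroken F}, ∑ B ∈ (range (a - 1)).ssubsets,
        (Ψ (glue a ha G B false F) + Ψ (glue a ha G B true F)) := by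
  have h1 : ∀ (F : {F // G.IsNonBroken F}) (B : Finset ℕ),
      Ψ (glue a ha G B false F) + Ψ (glue a ha G B true F) =
        ∑ ε : Bool, Ψ (glue a ha G B ε F) := by
    intro F B
    rw [Fintype.sum_bool, add_comm]
  simp only [h1]
  simp only [← Finset.sum_product']
  symm
  refine Finset.sum_bij'
    (i := fun x hx => ⟨glue a ha G x.2.1 x.2.2 x.1, isNonBroken_glue
      (mem_ssubsets.1 (mem_product.1 (mem_product.1 hx).2).1) _ x.1.2⟩)
    (j := fun F _ => (⟨F.2.exists_eq_glue.choose_spec.2.choose_spec.choose,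
      F.2.exists_eq_glue.choose_spec.2.choose_spec.choose_spec.1⟩,
      F.2.exists_eq_glue.choose, F.2.exists_eq_glue.choose_spec.2.choose)) ?_ ?_ ?_ ?_ ?_
  · exact fun _ _ => mem_univ _
  · intro F _
    exact mem_product.2 ⟨mem_univ _, mem_product.2
      ⟨mem_ssubsets.2 F.2.exists_eq_glue.choose_spec.1, mem_univ _⟩⟩
  · rintro ⟨F, B, ε⟩ hx
    have hB := mem_ssubsets.1 (mem_product.1 (mem_product.1 hx).2).1
    have hnb := isNonBroken_glue (ha := ha) hB ε F.2
    have hB' := hnb.exists_eq_glue.choose_spec.1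
    have heq := hnb.exists_eq_glue.choose_spec.2.choose_spec.choose_spec.2
    have e1 := subset_of_glue_eq hB' hB heq
    have e2 := subset_of_glue_eq hB hB' heq.symm
    have e3 := congrArg (fun F => F.comap (inrEmb a ha G)) heq
    simp only [comap_glue hB.1, comap_glue hB'.1] at e3
    refine Prod.ext (Subtype.ext e3) (Prod.ext (e1.1.antisymm e2.1) ?_)
    exact Bool.eq_iff_iff.2 ⟨e1.2, e2.2⟩
  · intro F _
    exact Subtype.ext F.2.exists_eq_glue.choose_spec.2.choose_spec.choose_spec.2
  · exact fun _ _ => rfl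

end EdgeOrderedGraph

/-! ### Sums over non-broken circuits of a chain -/

namespace EdgeOrderedGraph

open Finset SimpleGraph

/-- The graph with one vertex. -/
def point : EdgeOrderedGraph where
  n := 1
  pos := Nat.one_pos
  edges := []
  nodup := List.nodup_nil
  loopless := fun _ h => absurd h List.not_mem_nil

theorem add_cycle_point (a : ℕ) (ha : 2 ≤ a) : add (cycle a ha) point = cycle a ha := by
  have h : (add (cycle a ha) point).edges = (cycle a ha).edges := by
    refine (List.append_nil _).trans ?_
    have hid : ∀ e : Sym2 (Fin a), e.map (inl (cycle a ha) point) = e := by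
      intro e
      induction e using Sym2.ind with | _ x y => rfl
    exact (List.map_congr_left (g := id) fun e _ => hid e).trans (List.map_id _)
  cases hA : add (cycle a ha) point with | mk n1 p1 e1 d1 l1 => ?_
  cases hB : cycle a ha with | mk n2 p2 e2 d2 l2 => ?_
  have hn : n1 = n2 := by
    have h1 : (add (cycle a ha) point).n = n1 := by rw [hA]
    have h2 : (cycle a ha).n = n2 := by rw [hB]
    rw [← h1, ← h2]
    rfl
  subst hn
  have he : HEq e1 e2 := by
    have h1 : HEq (add (cycle a ha) point).edges e1 := by rw [hA]
    have h2 : HEq (cycle a ha).edges e2 := by rw [hB]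
    exact (h1.symm.trans (heq_of_eq h)).trans h2
  cases he
  rfl

/-- Every adjacent cycle chain arises from a point by attaching cycles. -/
theorem IsAdjacentCycleChain.induction_point {P : EdgeOrderedGraph → Prop} (h0 : P point)
    (hstep : ∀ (a : ℕ) (ha : 2 ≤ a) (G : EdgeOrderedGraph), P G → P (add (cycle a ha) G))
    {G : EdgeOrderedGraph} (hG : G.IsAdjacentCycleChain) : P G := by
  induction hG with
  | single a ha => rw [← add_cycle_point]; exact hstep a ha _ h0
  | cons a ha G _ ih => exact hstep a ha G ih

section Classes

variable (a : ℕ) (ha : 2 ≤ a) (G : EdgeOrderedGraph)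

theorem reachable_map_inrEmb (F : SimpleGraph (Fin G.n)) (x y : Fin G.n) :
    (F.map (inrEmb a ha G)).Reachable (inrEmb a ha G x) (inrEmb a ha G y) ↔ F.Reachable x y := by
  constructor
  · intro h
    have hhom : ∀ x y, (F.map (inrEmb a ha G)).Adj x y →
        F.Adj (contract a ha G x) (contract a ha G y) := by
      intro x y hxy
      rw [map_adj] at hxy
      obtain ⟨x, y, hxy, rfl, rfl⟩ := hxy
      rwa [contract_inrEmb, contract_inrEmb]
    let φ : F.map (inrEmb a ha G) →g F := ⟨contract a ha G, fun {x y} => hhom x y⟩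
    have h' : F.Reachable (contract a ha G _) (contract a ha G _) := h.map φ
    rwa [contract_inrEmb, contract_inrEmb] at h'
  · intro h
    let φ : F →g F.map (inrEmb a ha G) :=
      ⟨inrEmb a ha G, fun {x y} h => (map_adj _ _ _ _).2 ⟨x, y, h, rfl, rfl⟩⟩
    exact h.map φ

theorem pathCompl_cycleVertex :
    pathCompl (cycleVertex a ha G) (a - 1) = univ.map (inrEmb a ha G) := by
  ext x
  simp only [pathCompl, mem_filter, mem_univ, true_and, mem_map]
  constructor
  · intro h
    refine ⟨contract a ha G x, ?_⟩
    have hx : a - 1 ≤ x.1 := by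
      by_contra hlt
      exact h x.1 (by omega) (by ext; simp; omega)
    ext
    simp only [inrEmb_val, contract_val]
    omega
  · rintro ⟨y, rfl⟩ i hi
    exact inrEmb_ne_of_lt a ha G hi y

theorem cls_map_inrEmb (F : SimpleGraph (Fin G.n)) (x : Fin G.n) :
    (F.map (inrEmb a ha G)).cls (inrEmb a ha G x) = (F.cls x).map (inrEmb a ha G) := by
  ext y
  rw [mem_cls, mem_map]
  constructor
  · intro h
    have hy : ∃ y', inrEmb a ha G y' = y := by
      by_contra hy
      have hiso : ∀ z, ¬ (F.map (inrEmb a ha G)).Adj y z := by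
        intro z hz
        rw [map_adj] at hz
        obtain ⟨y', _, _, hy', _⟩ := hz
        exact hy ⟨y', hy'⟩
      exact hy ⟨x, ((reachable_isolated_iff _ hiso _).1 h.symm).symm⟩
    obtain ⟨y, rfl⟩ := hy
    exact ⟨y, (mem_cls _ _ _).2 ((reachable_map_inrEmb a ha G F x y).1 h), rfl⟩
  · rintro ⟨y, hy, rfl⟩
    exact (reachable_map_inrEmb a ha G F x y).2 ((mem_cls _ _ _).1 hy)

theorem prod_classes_map_inrEmb {R : Type*} [CommMonoid R] (F : SimpleGraph (Fin G.n))
    (f : Finset (Fin (add (cycle a ha) G).n) → R) :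
    ∏ A ∈ (F.map (inrEmb a ha G)).classes (pathCompl (cycleVertex a ha G) (a - 1)), f A =
      ∏ A ∈ F.classes univ, f (A.map (inrEmb a ha G)) := by
  have h : (F.map (inrEmb a ha G)).classes (pathCompl (cycleVertex a ha G) (a - 1)) =
      (F.classes univ).map (mapEmbedding (inrEmb a ha G)).toEmbedding := by
    rw [pathCompl_cycleVertex]
    ext A
    simp only [mem_classes, mem_map, mem_univ, true_and]
    constructor
    · rintro ⟨_, ⟨x, rfl⟩, rfl⟩
      exact ⟨_, ⟨x, rfl⟩, (cls_map_inrEmb a ha G F x).symm⟩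
    · rintro ⟨_, ⟨x, rfl⟩, rfl⟩
      exact ⟨_, ⟨x, rfl⟩, cls_map_inrEmb a ha G F x⟩
  rw [h, prod_map]
  rfl

end Classes

section ForestSum

open Classical in
/-- The sum over all non-broken circuits of the products of the weights of their trees, where the
weight is `q m` for the tree that contains the first vertex and `p m` for any other tree, `m` the
size of the tree. -/
noncomputable def forestSum {R : Type*} [CommSemiring R] (G : EdgeOrderedGraph) (q p : ℕ → R) :
    R :=
  ∑ F : {F // G.IsNonBroken F}, ∏ A ∈ F.1.classes univ, if G.first ∈ A then q #A else p #A

/-- Attaching a cycle amounts to applying its transfer operator to the weight of the root. -/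
theorem forestSum_add_cycle {R : Type*} [CommSemiring R] (a : ℕ) (ha : 2 ≤ a)
    (G : EdgeOrderedGraph) (q p : ℕ → R) :
    (add (cycle a ha) G).forestSum q p = G.forestSum (cycleTransfer p (a - 1) q) p := by
  classical
  rw [forestSum, sum_isNonBroken_add_cycle fun F => ∏ A ∈ F.classes univ,
    if (add (cycle a ha) G).first ∈ A then q #A else p #A, forestSum]
  refine sum_congr rfl fun F _ => ?_
  have h := sum_prod_classes_addPath (cycleVertex_injOn a ha G)
    (fun i hi x => not_map_inrEmb_adj a ha G F hi x) p q
  rw [prod_classes_map_inrEmb] at h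
  rw [first_add_cycle]
  refine h.trans (prod_congr rfl fun A _ => ?_)
  simp only [← inrEmb_first, card_map, mem_map']

instance : Unique {F // point.IsNonBroken F} where
  default := ⟨⊥, bot_le, by
    rintro B ⟨v, p, -, e, he, -⟩
    have := (mem_edgeSet_graph point e).1 (p.edges_subset_edgeSet he)
    exact absurd this List.not_mem_nil⟩
  uniq := by
    rintro ⟨F, hF⟩
    refine Subtype.ext (le_antisymm ?_ bot_le)
    intro x y hxy
    have := (mem_edgeSet_graph point s(x, y)).1 (hF.1 hxy)
    exact absurd this List.not_mem_nil

theorem sum_point {R : Type*} [CommSemiring R] (f : Finset (Fin point.n) → R)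
    [Fintype {F // point.IsNonBroken F}] :
    ∑ F : {F // point.IsNonBroken F}, ∏ A ∈ F.1.classes univ, f A = f univ := by
  have huniv : (univ : Finset (Fin point.n)) = {point.first} := rfl
  have hcls : ∀ F : SimpleGraph (Fin point.n), F.cls point.first = {point.first} := by
    intro F
    refine Subset.antisymm (huniv ▸ subset_univ _) ?_
    rw [singleton_subset_iff]
    exact self_mem_cls F _
  have : ∀ F : {F // point.IsNonBroken F}, ∏ A ∈ F.1.classes univ, f A = f univ := by
    intro F
    rw [classes, huniv, image_singleton, prod_singleton, hcls]
  rw [Fintype.sum_congr _ _ this, sum_const, card_univ, Fintype.card_unique, one_smul]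

theorem forestSum_point {R : Type*} [CommSemiring R] (q p : ℕ → R) :
    point.forestSum q p = q 1 := by
  classical
  exact (sum_point fun A => if point.first ∈ A then q #A else p #A).trans
    ((if_pos (mem_univ _)).trans rfl)

end ForestSum

section Coloring

variable {V C : Type*} [DecidableEq C]

/-- The weight of a set `A` of vertices with respect to a colouring: `(-1) ^ (|A| - 1)` if all its
vertices have the same colour, and `0` otherwise. -/
def monoWeight (κ : V → C) (A : Finset V) : ℤ :=
  if ∀ x ∈ A, ∀ y ∈ A, κ x = κ y then (-1) ^ (#A - 1) else 0

/-- Joining two trees by an edge `vw` multiplies their weights by `-1` if `v` and `w` have the same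
colour, and makes the weight zero otherwise. -/
theorem monoWeight_union [DecidableEq V] (κ : V → C) {v w : V} {A A' : Finset V}
    (h : Disjoint A A') (hv : v ∈ A) (hw : w ∈ A') :
    monoWeight κ (A ∪ A') =
      (if κ v = κ w then -1 else 0) * (monoWeight κ A * monoWeight κ A') := by
  have hA : 0 < #A := card_pos.2 ⟨v, hv⟩
  have hA' : 0 < #A' := card_pos.2 ⟨w, hw⟩
  have hmem : ∀ x, x ∈ A ∪ A' ↔ x ∈ A ∨ x ∈ A' := fun x => mem_union
  unfold monoWeight
  by_cases h1 : ∀ x ∈ A, ∀ y ∈ A, κ x = κ y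
  swap
  · rw [if_neg h1, zero_mul, mul_zero, if_neg]
    exact fun h' => h1 fun x hx y hy => h' x ((hmem x).2 (Or.inl hx)) y ((hmem y).2 (Or.inl hy))
  by_cases h2 : ∀ x ∈ A', ∀ y ∈ A', κ x = κ y
  swap
  · rw [if_neg h2, mul_zero, mul_zero, if_neg]
    exact fun h' => h2 fun x hx y hy => h' x ((hmem x).2 (Or.inr hx)) y ((hmem y).2 (Or.inr hy))
  rw [if_pos h1, if_pos h2]
  by_cases h3 : κ v = κ w
  · rw [if_pos h3, if_pos, card_union_of_disjoint h, ← pow_add, ← pow_succ']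
    · congr 1
      omega
    · have hall : ∀ x ∈ A ∪ A', κ x = κ v := by
        intro x hx
        rcases (hmem x).1 hx with hx | hx
        · exact h1 x hx v hv
        · exact (h2 x hx w hw).trans h3.symm
      exact fun x hx y hy => (hall x hx).trans (hall y hy).symm
  · rw [if_neg h3, zero_mul, if_neg]
    exact fun h' => h3 (h' v ((hmem v).2 (Or.inl hv)) w ((hmem w).2 (Or.inr hw)))

theorem monoWeight_singleton (κ : V → C) (v : V) : monoWeight κ {v} = 1 := by
  rw [monoWeight, if_pos]
  · simp
  · simp

theorem sum_ssubsets_range_prod {n : ℕ} (c : ℕ → ℤ) :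
    ∑ B ∈ (range n).ssubsets, ∏ i ∈ B, c i =
      ∏ i ∈ range n, (1 + c i) - ∏ i ∈ range n, c i := by
  rw [prod_one_add, ssubsets, ← add_sum_erase _ _ (mem_powerset_self (range n))]
  ring

open Classical in
/-- Whitney's theorem for a single colouring of an adjacent cycle chain: the signed count of the
non-broken circuits all of whose edges are monochromatic detects whether the colouring is
proper. -/
theorem IsAdjacentCycleChain.sum_monoWeight {G : EdgeOrderedGraph} (hG : G.IsAdjacentCycleChain)
    (κ : Fin G.n → C) :
    ∑ F : {F // G.IsNonBroken F}, ∏ A ∈ F.1.classes univ, monoWeight κ A =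
      if ∀ e ∈ G.edges, ¬ (e.map κ).IsDiag then 1 else 0 := by
  revert κ
  refine hG.induction_point (P := fun G => ∀ κ : Fin G.n → C,
    ∑ F : {F // G.IsNonBroken F}, ∏ A ∈ F.1.classes univ, monoWeight κ A =
      if ∀ e ∈ G.edges, ¬ (e.map κ).IsDiag then 1 else 0) ?_ ?_
  · intro κ
    rw [sum_point, if_pos]
    · exact monoWeight_singleton κ point.first
    · exact fun e he => absurd he List.not_mem_nil
  · intro a ha G ih κ
    set u := cycleVertex a ha G with hu
    set c : Fin (add (cycle a ha) G).n → Fin (add (cycle a ha) G).n → ℤ :=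
      fun v w => if κ v = κ w then -1 else 0 with hc
    have hmul : ∀ v w, ∀ A A' : Finset (Fin (add (cycle a ha) G).n), Disjoint A A' → v ∈ A →
        w ∈ A' → monoWeight κ (A ∪ A') = c v w * (monoWeight κ A * monoWeight κ A') :=
      fun v w A A' h hv hw => monoWeight_union κ h hv hw
    -- Every edge of the cycle contributes its factor `c`.
    have hterm : ∀ (F : {F // G.IsNonBroken F}), ∀ B ∈ (range (a - 1)).ssubsets,
        (∏ A ∈ (glue a ha G B false F).classes univ, monoWeight κ A) +
          (∏ A ∈ (glue a ha G B true F).classes univ, monoWeight κ A) =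
        (∏ i ∈ B, c (u i) (u (i + 1))) * ((1 + c (u (a - 1)) (u 0)) *
          ∏ A ∈ F.1.classes univ, monoWeight (κ ∘ inrEmb a ha G) A) := by
      intro F B hB
      have hB := mem_ssubsets.1 hB
      have hiso : ∀ i < a - 1, ∀ x, ¬ (F.1.map (inrEmb a ha G)).Adj (u i) x :=
        fun i hi x => not_map_inrEmb_adj a ha G F hi x
      have hinj : Set.InjOn u (Set.Iic (a - 1)) := cycleVertex_injOn a ha G
      have hpath := prod_classes_addPath_of_mul hinj hiso (monoWeight κ) c hmul hB.1
      have hclose := prod_classes_sup_edge_of_mul ((F.1.map (inrEmb a ha G)).addPath u B)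
        (v := u (a - 1)) (w := u 0)
        (fun h => hB.ne ((reachable_addPath_iff hinj hiso hB.1).1 h.symm)) (monoWeight κ) _
        (hmul _ _)
      -- The vertices of the path are isolated in the image of `F`, so that their weight is `1`.
      have hcompl : ∀ j ≤ a - 1,
          ∏ A ∈ (F.1.map (inrEmb a ha G)).classes (pathCompl u j), monoWeight κ A =
            ∏ A ∈ (F.1.map (inrEmb a ha G)).classes univ, monoWeight κ A := by
        intro j
        induction j with
        | zero => intro _; rw [pathCompl_zero]
        | succ j ihj =>
          intro hj
          rw [← ihj (by omega), pathCompl_eq_insert hinj (by omega : j ≤ a - 1),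
            classes_insert_isolated _ (hiso j (by omega)), prod_insert
            (singleton_notMem_classes _ (notMem_pathCompl u j)), monoWeight_singleton, one_mul]
      have hF : ∏ A ∈ (F.1.map (inrEmb a ha G)).classes univ, monoWeight κ A =
          ∏ A ∈ F.1.classes univ, monoWeight (κ ∘ inrEmb a ha G) A := by
        rw [← hcompl (a - 1) le_rfl, prod_classes_map_inrEmb]
        refine prod_congr rfl fun A _ => ?_
        simp only [monoWeight, card_map, forall_mem_map, Function.comp_apply]
        congr
      rw [glue, glue, if_neg Bool.false_ne_true, if_pos rfl, hclose, hpath, hF]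
      ring
    rw [sum_isNonBroken_add_cycle fun F => ∏ A ∈ F.classes univ, monoWeight κ A,
      sum_congr rfl fun F _ => sum_congr rfl (hterm F)]
    simp only [← sum_mul, ← mul_sum]
    rw [ih, sum_ssubsets_range_prod fun i => c (u i) (u (i + 1))]
    have hdiag : ∀ i < a, ((cycleEdge a ha G i).map κ).IsDiag ↔
        κ (u i) = κ (u ((i + 1) % a)) := by
      intro i hi
      rw [cycleEdge, Sym2.map_mk, Sym2.mk_isDiag_iff]
    have hproper : (∀ e ∈ (add (cycle a ha) G).edges, ¬ (e.map κ).IsDiag) ↔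
        (∀ i < a, κ (u i) ≠ κ (u ((i + 1) % a))) ∧
          ∀ e ∈ G.edges, ¬ (e.map (κ ∘ inrEmb a ha G)).IsDiag := by
      constructor
      · intro h
        constructor
        · intro i hi
          rw [Ne, ← hdiag i hi]
          exact h _ ((mem_edges_add_cycle a ha G _).2 (Or.inl ⟨i, hi, rfl⟩))
        · intro e he
          rw [← Sym2.map_map]
          exact h _ ((mem_edges_add_cycle a ha G _).2 (Or.inr ⟨e, he, rfl⟩))
      · rintro ⟨h1, h2⟩ e he
        rcases (mem_edges_add_cycle a ha G _).1 he with ⟨i, hi, rfl⟩ | ⟨f, hf, rfl⟩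
        · rw [hdiag i hi]; exact h1 i hi
        · rw [Sym2.map_map]; exact h2 f hf
    have hlast : (a - 1 + 1) % a = 0 := by rw [Nat.sub_add_cancel (by omega), Nat.mod_self]
    -- The factor `1 + c` vanishes for a monochromatic edge and is `1` otherwise.
    have hcycle : (∏ i ∈ range (a - 1), (1 + c (u i) (u (i + 1))) -
        ∏ i ∈ range (a - 1), c (u i) (u (i + 1))) * (1 + c (u (a - 1)) (u 0)) =
          if ∀ i < a, κ (u i) ≠ κ (u ((i + 1) % a)) then 1 else 0 := by
      by_cases hz : κ (u (a - 1)) = κ (u 0)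
      · rw [if_neg]
        · simp [hc, hz]
        · intro h
          have := h (a - 1) (by omega)
          rw [hlast] at this
          exact this hz
      have hcz : c (u (a - 1)) (u 0) = 0 := if_neg hz
      rw [hcz, add_zero, mul_one]
      -- not all edges of the path are monochromatic, as its ends have different colours
      have hsome : ∃ i ∈ range (a - 1), c (u i) (u (i + 1)) = 0 := by
        by_contra h
        push Not at h
        have : ∀ k ≤ a - 1, κ (u k) = κ (u 0) := by
          intro k
          induction k with
          | zero => exact fun _ => rfl
          | succ k ihk =>
            intro hk
            have h1 := h k (mem_range.2 (by omega))
            rw [← ihk (by omega)]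
            by_contra h2
            exact h1 (if_neg fun h3 => h2 h3.symm)
        exact hz (this _ le_rfl)
      obtain ⟨i, hi, hi0⟩ := hsome
      rw [prod_eq_zero (f := fun i => c (u i) (u (i + 1))) hi hi0, sub_zero]
      split_ifs with h
      · refine prod_eq_one fun j hj => ?_
        have hj := mem_range.1 hj
        have := h j (by omega)
        rw [Nat.mod_eq_of_lt (by omega)] at this
        rw [hc]
        simp only [if_neg this, add_zero]
      · push Not at h
        obtain ⟨j, hj, hjeq⟩ := h
        have hj' : j < a - 1 := by
          by_contra hge
          obtain rfl : j = a - 1 := by omega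
          rw [hlast] at hjeq
          exact hz hjeq
        rw [Nat.mod_eq_of_lt (by omega)] at hjeq
        refine prod_eq_zero (mem_range.2 hj') ?_
        rw [hc]
        simp only [if_pos hjeq]
        norm_num
    rw [← mul_assoc, hcycle]
    by_cases h1 : ∀ i < a, κ (u i) ≠ κ (u ((i + 1) % a))
    · by_cases h2 : ∀ e ∈ G.edges, ¬ (e.map (κ ∘ inrEmb a ha G)).IsDiag
      · rw [if_pos h1, if_pos h2, if_pos (hproper.2 ⟨h1, h2⟩), one_mul]
      · rw [if_neg h2, if_neg fun h => h2 (hproper.1 h).2, mul_zero]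
    · rw [if_neg h1, if_neg fun h => h1 (hproper.1 h).1, zero_mul]

end Coloring

end EdgeOrderedGraph

/-! ### The transfer operator in closed form -/

section

open Finset PowerSeries

/-- For fixed `l`, the weights of two marked components satisfy a renewal equation, which is solved by
the series `W = 1 / (1 - P)`. -/
theorem pathStep_iterate_snd {R : Type*} [CommRing R] (p : ℕ → R) (hp : p 0 = 0) (W : R⟦X⟧)
    (hW : W * (1 - mk p) = 1) (x : (ℕ → R) × (ℕ → ℕ → R)) (l i : ℕ) :
    ((pathStep p)^[i] x).2 1 l =
      ∑ bc ∈ antidiagonal i, coeff bc.1 W * x.2 (bc.2 + 1) l := by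
  set g : ℕ → ℕ → R := fun i s => ((pathStep p)^[i] x).2 s l with hg
  have hstep : ∀ i s, g (i + 1) s = p s * g i 1 + g i (s + 1) := by
    intro i s
    simp only [hg]
    rw [Function.iterate_succ_apply']
    rfl
  have hexp : ∀ i s, g i s = g 0 (s + i) + ∑ j ∈ range i, p (s + j) * g (i - 1 - j) 1 := by
    intro i
    induction i with
    | zero => intro s; simp
    | succ i ih =>
      intro s
      rw [hstep, ih (s + 1), sum_range_succ', add_right_comm s 1 i, add_assoc s i 1]
      have : ∀ j, p (s + 1 + j) * g (i - 1 - j) 1 = p (s + (j + 1)) * g (i + 1 - 1 - (j + 1)) 1 := by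
        intro j
        rw [show s + 1 + j = s + (j + 1) by omega, show i + 1 - 1 - (j + 1) = i - 1 - j by omega]
      simp only [this, Nat.add_sub_cancel, Nat.sub_zero, add_zero]
      ring
  have hU : mk (fun i => g i 1) * (1 - mk p) = mk fun i => g 0 (i + 1) := by
    ext i
    rw [mul_sub, mul_one, map_sub, coeff_mk, coeff_mk, sub_eq_iff_eq_add, mul_comm, coeff_mul,
      Nat.sum_antidiagonal_eq_sum_range_succ fun a b => coeff a (mk p) * coeff b (mk fun i => g i 1)]
    rw [hexp i 1, sum_range_succ', add_comm 1 i]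
    simp only [coeff_mk, hp, zero_mul, add_zero]
    congr 1
    refine sum_congr rfl fun j _ => ?_
    rw [show i - 1 - j = i - (j + 1) by omega, add_comm 1 j]
  have hU' : mk (fun i => g i 1) = W * mk fun i => g 0 (i + 1) := by
    rw [← hU, mul_left_comm, hW, mul_one]
  have := congrArg (coeff i) hU'
  rw [coeff_mk, coeff_mul] at this
  simp only [coeff_mk] at this
  exact this

theorem pathStep_iterate_fst {R : Type*} [CommSemiring R] (p : ℕ → R) (ψ : ℕ → ℕ → R) (n l : ℕ) :
    ((pathStep p)^[n] (fun _ => 0, ψ)).1 l =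
      ∑ i ∈ range n, ((pathStep p)^[i] (fun _ => 0, ψ)).2 1 (l + (n - 1 - i)) := by
  induction n generalizing l with
  | zero => simp
  | succ n ih =>
    rw [sum_range_succ, Function.iterate_succ_apply']
    have h : (pathStep p ((pathStep p)^[n] (fun _ => 0, ψ))).1 l =
      ((pathStep p)^[n] (fun _ => 0, ψ)).1 (l + 1) + ((pathStep p)^[n] (fun _ => 0, ψ)).2 1 l := rfl
    rw [h, ih]
    congr 1
    · refine sum_congr rfl fun i hi => ?_
      have := mem_range.1 hi
      rw [show l + 1 + (n - 1 - i) = l + (n + 1 - 1 - i) by omega]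
    · rw [show l + (n + 1 - 1 - n) = l by omega]

theorem sum_range_sum_antidiagonal_add {R : Type*} [AddCommMonoid R] (m : ℕ) (F : ℕ → ℕ → R) :
    ∑ τ ∈ range (m + 1), ∑ bc ∈ antidiagonal (m - τ), F bc.1 (bc.2 + τ) =
      ∑ bc ∈ antidiagonal m, (bc.2 + 1) • F bc.1 bc.2 := by
  induction m generalizing F with
  | zero => simp
  | succ m ih =>
    rw [sum_range_succ']
    have : ∀ τ, ∑ bc ∈ antidiagonal (m + 1 - (τ + 1)), F bc.1 (bc.2 + (τ + 1)) =
        ∑ bc ∈ antidiagonal (m - τ), (fun b c => F b (c + 1)) bc.1 (bc.2 + τ) := by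
      intro τ
      rw [Nat.add_sub_add_right]
      rfl
    simp only [this]
    have ih' := ih fun b c => F b (c + 1)
    beta_reduce at ih' ⊢
    rw [ih', Nat.sub_zero, Nat.sum_antidiagonal_succ', Nat.sum_antidiagonal_succ']
    simp only [add_zero, zero_add, one_smul]
    rw [add_left_comm, ← sum_add_distrib]
    congr 1
    refine sum_congr rfl fun bc _ => ?_
    exact (succ_nsmul (F bc.1 (bc.2 + 1)) (bc.2 + 1)).symm

/-- The transfer operator in closed form, in terms of the series `W = 1 / (1 - P)` that counts
weighted path graphs. -/
theorem cycleTransfer_eq {R : Type*} [CommRing R] (p : ℕ → R) (hp : p 0 = 0) (W : R⟦X⟧)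
    (hW : W * (1 - mk p) = 1) (m : ℕ) (q : ℕ → R) (l : ℕ) :
    cycleTransfer p (m + 1) q l =
      ∑ bc ∈ antidiagonal m, coeff bc.1 W * ((bc.2 + 1) * q (bc.2 + 1 + l)) +
        ∑ τ ∈ range (m + 1),
          (∑ bc ∈ antidiagonal (m - τ), coeff bc.1 W * q (bc.2 + 1)) * p (l + τ) := by
  rw [cycleTransfer, pathStep_iterate_fst, ← sum_range_reflect]
  simp only [pathStep_iterate_snd p hp W hW, mul_add, sum_add_distrib]
  congr 1
  · have h := sum_range_sum_antidiagonal_add m fun b c => coeff b W * q (c + 1 + l)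
    have h2 : ∀ bc : ℕ × ℕ, coeff bc.1 W * ((bc.2 + 1 : ℕ) * q (bc.2 + 1 + l)) =
        (bc.2 + 1) • (coeff bc.1 W * q (bc.2 + 1 + l)) := by
      intro bc
      rw [nsmul_eq_mul]
      ring
    push_cast at h2
    simp only [h2]
    rw [← h]
    refine sum_congr rfl fun τ hτ => ?_
    have hτ := mem_range.1 hτ
    have hb : m + 1 - 1 - τ = m - τ := by omega
    rw [hb]
    refine sum_congr rfl fun bc _ => ?_
    rw [show bc.2 + 1 + (l + (m + 1 - 1 - (m - τ))) = bc.2 + τ + 1 + l by omega]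
  · refine sum_congr rfl fun τ hτ => ?_
    have hτ := mem_range.1 hτ
    rw [sum_mul]
    rw [show m + 1 - 1 - τ = m - τ by omega, show m + 1 - 1 - (m - τ) = τ by omega]
    refine sum_congr rfl fun bc _ => ?_
    rw [mul_assoc]

/-! ### Positivity of the transfer coefficients -/

section Transfer

variable {R : Type*} [CommRing R] (e : ℕ → R)

/-- The generating function `D = ∑ i e_i X^i`. -/
noncomputable def derivSeries : R⟦X⟧ := mk fun i => i * e i

/-- The series `H = 1 / E`, where `E = ∑ e_i X^i`. -/
noncomputable def invSeries : R⟦X⟧ := invOfUnit (mk e) 1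

/-- The signed power sums: the coefficients of `D / E`. -/
noncomputable def signedPowerSum (n : ℕ) : R := coeff n (derivSeries e * invSeries e)

/-- The series `V = 1 / (E - D)`. -/
noncomputable def pathSeries : R⟦X⟧ := invOfUnit (mk e - derivSeries e) 1

/-- The series `1 / (1 - D)`. -/
noncomputable def unitPathSeries : R⟦X⟧ := invOfUnit (1 - derivSeries e) 1

/-- The coefficients of `H`, shifted by `k`. -/
noncomputable def shiftedInv (k j : ℕ) : R := if k ≤ j then coeff (j - k) (invSeries e) else 0

/-- The coefficients with which the transfer operator of `C_{m+2}` expresses itself in terms of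
the functions `shiftedInv e l`, see `cycleTransfer_shiftedInv`. -/
noncomputable def transferCoeff (m k l : ℕ) : R :=
  ∑ vM ∈ antidiagonal m, coeff vM.1 (pathSeries e) *
    if vM.2 + 1 < k then
      if k ≤ l + (vM.2 + 1) then ((k - l : ℕ) : R) * e (l + (vM.2 + 1) - k) else 0
    else ((l - k : ℕ) : R) * e (l + (vM.2 + 1) - k)

variable {e}

theorem mk_mul_invSeries (he : e 0 = 1) : mk e * invSeries e = 1 :=
  mul_invOfUnit _ _ (by simp [he])

theorem sub_mul_pathSeries (he : e 0 = 1) : (mk e - derivSeries e) * pathSeries e = 1 :=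
  mul_invOfUnit _ _ (by simp [he, derivSeries])

theorem sub_mul_unitPathSeries : (1 - derivSeries e) * unitPathSeries e = 1 :=
  mul_invOfUnit _ _ (by simp [derivSeries])

theorem mk_signedPowerSum : mk (signedPowerSum e) = derivSeries e * invSeries e := by
  ext n
  rw [coeff_mk, signedPowerSum]

theorem signedPowerSum_zero : signedPowerSum e 0 = 0 := by
  rw [signedPowerSum, coeff_mul]
  simp [derivSeries]

theorem mul_one_sub_signedPowerSum (he : e 0 = 1) :
    mk e * pathSeries e * (1 - mk (signedPowerSum e)) = 1 := by
  rw [mk_signedPowerSum]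
  linear_combination sub_mul_pathSeries he -
    derivSeries e * pathSeries e * mk_mul_invSeries he

theorem signedPowerSum_eq (n : ℕ) :
    signedPowerSum e n =
      ∑ i ∈ range (n + 1), (i * e i) * coeff (n - i) (invSeries e) := by
  rw [signedPowerSum, coeff_mul, Nat.sum_antidiagonal_eq_sum_range_succ
    fun a b => coeff a (derivSeries e) * coeff b (invSeries e)]
  simp only [derivSeries, coeff_mk]

theorem sum_mul_coeff_invSeries (he : e 0 = 1) {n : ℕ} (hn : 0 < n) :
    ∑ i ∈ range (n + 1), e i * coeff (n - i) (invSeries e) = 0 := by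
  have h := congrArg (coeff n) (mk_mul_invSeries he)
  rw [coeff_mul, Nat.sum_antidiagonal_eq_sum_range_succ
    fun a b => coeff a (mk e) * coeff b (invSeries e), coeff_one, if_neg hn.ne'] at h
  simpa only [coeff_mk] using h

theorem sum_range_mul_shiftedInv (f : ℕ → R) {l n : ℕ} (hl : l < n) :
    ∑ l' ∈ range n, f l' * shiftedInv e l' l =
      ∑ l' ∈ range (l + 1), f l' * coeff (l - l') (invSeries e) := by
  rw [← sum_subset (range_subset_range.2 (Nat.succ_le_of_lt hl))]
  · refine sum_congr rfl fun l' hl' => ?_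
    rw [shiftedInv, if_pos (Nat.lt_succ_iff.1 (mem_range.1 hl'))]
  · intro l' _ hl'
    rw [shiftedInv, if_neg, mul_zero]
    intro h
    exact hl' (mem_range.2 (Nat.lt_succ_of_le h))

theorem mk_shiftedInv_succ (κ : ℕ) :
    (mk fun j => shiftedInv e (κ + 1) (j + 1)) = X ^ κ * invSeries e := by
  ext j
  rw [coeff_mk, coeff_X_pow_mul', shiftedInv]
  simp only [Nat.add_le_add_iff_right, Nat.add_sub_add_right]

/-- The contribution of the coefficient of `V` at `m - M` to `cycleTransfer_shiftedInv` if `M + 1 < k`.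
The sum has no sign beyond those in `shiftedInv`. -/
theorem sum_antidiagonal_mul_shiftedInv_of_lt {M k l n : ℕ} (hM : M + 1 < k) (hn : l < n) :
    ∑ ic ∈ antidiagonal M, e ic.1 * ((ic.2 + 1) * shiftedInv e k (ic.2 + 1 + l)) =
      ∑ l' ∈ range n, (if k ≤ l' + (M + 1) then
        ((k - l' : ℕ) : R) * e (l' + (M + 1) - k) else 0) * shiftedInv e l' l := by
  rw [sum_range_mul_shiftedInv _ hn,
    ← sum_range_mul_shiftedInv _ (show l < (k - (M + 1)) + ((M + 1) + (l + 1)) by omega),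
    sum_range_add, sum_range_add, sum_eq_zero (s := range (k - (M + 1))), zero_add,
    sum_eq_zero (s := range (l + 1)), add_zero,
    Nat.sum_antidiagonal_eq_sum_range_succ
      fun i c => e i * ((c + 1 : R) * shiftedInv e k (c + 1 + l))]
  · refine sum_congr rfl fun i hi => ?_
    have hi := mem_range.1 hi
    rw [if_pos (by omega)]
    have h1 : ((k - (k - (M + 1) + i) : ℕ) : R) = ((M - i : ℕ) : R) + 1 := by
      rw [← Nat.cast_succ]
      congr 1
      omega
    have h2 : k - (M + 1) + i + (M + 1) - k = i := by omega
    have h3 : shiftedInv e k (M - i + 1 + l) = shiftedInv e (k - (M + 1) + i) l := by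
      rw [shiftedInv, shiftedInv]
      by_cases h : k - (M + 1) + i ≤ l
      · rw [if_pos h, if_pos (by omega),
          show M - i + 1 + l - k = l - (k - (M + 1) + i) by omega]
      · rw [if_neg h, if_neg (by omega)]
    rw [h1, h2, h3]
    ring
  · intro i _
    have : k - (k - (M + 1) + (M + 1 + i)) = 0 := by omega
    rw [this]
    simp
  · intro i hi
    have hi := mem_range.1 hi
    rw [if_neg (by omega), zero_mul]

/-- The contribution of the coefficient of `V` at `m - M` to `cycleTransfer_shiftedInv` if `k ≤ M + 1`.
Written in terms of `e_i H_{n-i}`, where `n = l + M + 1 - k`, the two summands on the left have the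
coefficients `max (M + 1 - i) 0` and `i`; subtracting `M + 1` times `∑ e_i H_{n-i} = 0` leaves the
coefficients `max (i - M - 1) 0`. -/
theorem sum_antidiagonal_mul_shiftedInv_of_le (he : e 0 = 1) {M k l n : ℕ} (hk : k ≤ M + 1)
    (hl : 0 < l) (hn : l < n) :
    ∑ ic ∈ antidiagonal M, e ic.1 * ((ic.2 + 1) * shiftedInv e k (ic.2 + 1 + l)) +
        signedPowerSum e (l + (M + 1 - k)) =
      ∑ l' ∈ range n, (((l' - k : ℕ) : R) * e (l' + (M + 1) - k)) * shiftedInv e l' l := by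
  obtain ⟨r, hr⟩ : ∃ r, M + 1 = r + k := ⟨M + 1 - k, by omega⟩
  have h1 : ∑ ic ∈ antidiagonal M, e ic.1 * ((ic.2 + 1) * shiftedInv e k (ic.2 + 1 + l)) =
      ∑ i ∈ range (r + l + 1), (((M + 1 - i : ℕ) : R) * e i) *
        coeff (r + l - i) (invSeries e) := by
    rw [Nat.sum_antidiagonal_eq_sum_range_succ
      fun i c => e i * ((c + 1 : R) * shiftedInv e k (c + 1 + l))]
    have hshift : ∀ i ≤ M + 1, shiftedInv e k (M + 1 - i + l) = shiftedInv e i (r + l) := by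
      intro i hi
      rw [shiftedInv, shiftedInv]
      by_cases h : i ≤ r + l
      · rw [if_pos h, if_pos (by omega), show M + 1 - i + l - k = r + l - i by omega]
      · rw [if_neg h, if_neg (by omega)]
    rw [← sum_range_mul_shiftedInv (fun i => ((M + 1 - i : ℕ) : R) * e i)
      (show r + l < (M + 1) + (r + l + 1) by omega), sum_range_add,
      sum_eq_zero (s := range (r + l + 1)), add_zero]
    · refine sum_congr rfl fun i hi => ?_
      have hi := mem_range.1 hi
      rw [← hshift i (by omega), show M - i + 1 + l = M + 1 - i + l by omega,
        show M + 1 - i = (M - i) + 1 by omega]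
      push_cast
      ring
    · intro i _
      rw [show M + 1 - (M + 1 + i) = 0 by omega]
      simp
  rw [h1, show l + (M + 1 - k) = r + l by omega, signedPowerSum_eq, ← sum_add_distrib,
    sum_range_mul_shiftedInv _ hn]
  have h0 := sum_mul_coeff_invSeries he (show 0 < r + l by omega)
  have h2 : ∑ i ∈ range (r + l + 1), ((((M + 1 - i : ℕ) : R) * e i) *
        coeff (r + l - i) (invSeries e) + (i * e i) * coeff (r + l - i) (invSeries e)) =
      ∑ i ∈ range (r + l + 1), (((i - (M + 1) : ℕ) : R) * e i) *
        coeff (r + l - i) (invSeries e) := by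
    rw [← sub_eq_zero, ← sum_sub_distrib, ← mul_zero ((M + 1 : ℕ) : R), ← h0, mul_sum]
    refine sum_congr rfl fun i _ => ?_
    have : (((M + 1 - i : ℕ) : R) + i) = ((i - (M + 1) : ℕ) : R) + (M + 1 : ℕ) := by
      rw [← Nat.cast_add, ← Nat.cast_add]
      congr 1
      omega
    linear_combination (e i * coeff (r + l - i) (invSeries e)) * this
  rw [h2, add_assoc, sum_range_add, sum_eq_zero (s := range r), zero_add]
  · refine sum_congr rfl fun i _ => ?_
    rw [show r + i - (M + 1) = i - k by omega, show i + (M + 1) - k = r + i by omega,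
      show r + l - (r + i) = l - i by omega]
  · intro i hi
    have hi := mem_range.1 hi
    rw [show i - (M + 1) = 0 by omega]
    simp

/-- The transfer operator maps the functions `shiftedInv e k` to combinations of each other. The
coefficients `transferCoeff` have no signs, because the identity `∑ e_i H_{n-i} = 0` can be used
to cancel all negative terms. -/
theorem cycleTransfer_shiftedInv (he : e 0 = 1) (m : ℕ) {k l n : ℕ} (hk : 0 < k) (hl : 0 < l)
    (hn : l < n) :
    cycleTransfer (signedPowerSum e) (m + 1) (shiftedInv e k) l =
      ∑ l' ∈ range n, transferCoeff e m k l' * shiftedInv e l' l := by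
  obtain ⟨κ, rfl⟩ : ∃ κ, k = κ + 1 := ⟨k - 1, by omega⟩
  rw [cycleTransfer_eq _ signedPowerSum_zero _ (mul_one_sub_signedPowerSum he)]
  -- Since `W = E V`, the factor `V` can be split off from both parts of the closed form.
  have hA : ∑ bc ∈ antidiagonal m, coeff bc.1 (mk e * pathSeries e) *
      ((bc.2 + 1) * shiftedInv e (κ + 1) (bc.2 + 1 + l)) =
      ∑ vM ∈ antidiagonal m, coeff vM.1 (pathSeries e) * ∑ ic ∈ antidiagonal vM.2,
        e ic.1 * ((ic.2 + 1) * shiftedInv e (κ + 1) (ic.2 + 1 + l)) := by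
    have h := congrArg (coeff m) (mul_assoc (pathSeries e) (mk e)
      (mk fun c => ((c : R) + 1) * shiftedInv e (κ + 1) (c + 1 + l)))
    rw [mul_comm (pathSeries e) (mk e), coeff_mul, coeff_mul] at h
    simp only [coeff_mk] at h
    rw [h]
    refine sum_congr rfl fun vM _ => ?_
    rw [coeff_mul]
    simp only [coeff_mk]
  -- In the second part `E` cancels against `H = 1 / E`.
  have hinner : ∀ j, ∑ bc ∈ antidiagonal j, coeff bc.1 (mk e * pathSeries e) *
      shiftedInv e (κ + 1) (bc.2 + 1) = coeff j (X ^ κ * pathSeries e) := by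
    intro j
    have h : mk e * pathSeries e * (mk fun j => shiftedInv e (κ + 1) (j + 1)) =
        X ^ κ * pathSeries e := by
      rw [mk_shiftedInv_succ]
      linear_combination (X ^ κ * pathSeries e) * mk_mul_invSeries he
    rw [← h, coeff_mul]
    simp only [coeff_mk]
  have hB : ∑ τ ∈ range (m + 1), (∑ bc ∈ antidiagonal (m - τ),
        coeff bc.1 (mk e * pathSeries e) * shiftedInv e (κ + 1) (bc.2 + 1)) *
          signedPowerSum e (l + τ) =
      ∑ vM ∈ antidiagonal m, coeff vM.1 (pathSeries e) *
        if κ ≤ vM.2 then signedPowerSum e (l + (vM.2 - κ)) else 0 := by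
    simp only [hinner]
    have h : (mk fun τ => signedPowerSum e (l + τ)) * (X ^ κ * pathSeries e) =
        pathSeries e * (X ^ κ * PowerSeries.mk fun τ => signedPowerSum e (l + τ)) := by ring
    have h' := congrArg (coeff m) h
    rw [coeff_mul, coeff_mul, Nat.sum_antidiagonal_eq_sum_range_succ
      fun a b => coeff a (mk fun τ => signedPowerSum e (l + τ)) *
        coeff b (X ^ κ * pathSeries e)] at h'
    simp only [coeff_mk] at h'
    rw [sum_congr rfl fun τ _ => mul_comm _ _, h']
    refine sum_congr rfl fun vM _ => ?_
    rw [coeff_X_pow_mul']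
    simp only [coeff_mk]
  rw [hA, hB, ← sum_add_distrib]
  simp only [transferCoeff, sum_mul]
  rw [sum_comm]
  refine sum_congr rfl fun vM _ => ?_
  rw [← mul_add]
  simp only [mul_assoc]
  rw [← mul_sum]
  congr 1
  by_cases h : vM.2 + 1 < κ + 1
  · rw [if_neg (by omega), add_zero, sum_antidiagonal_mul_shiftedInv_of_lt h hn]
    simp only [if_pos h]
  · rw [if_pos (by omega), show vM.2 - κ = vM.2 + 1 - (κ + 1) by omega,
      sum_antidiagonal_mul_shiftedInv_of_le he (by omega) hl hn]
    simp only [if_neg h]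

end Transfer

end

/-! ### Comparison of signed and unit counts -/

section

open Finset PowerSeries

section Comparison

variable {R : Type*} [CommRing R] {e : ℕ → R} (N : Subsemiring R)

theorem coeff_pathSeries_zero (he : e 0 = 1) : coeff 0 (pathSeries e) = 1 := by
  have h := congrArg (coeff 0) (sub_mul_pathSeries he)
  rw [coeff_mul, Nat.antidiagonal_zero, sum_singleton] at h
  simpa [derivSeries, he] using h

/-- The recursion for `V = 1 / (1 - ∑ (i - 1) e_i X^i)`, which has no signs. -/
theorem coeff_pathSeries_succ (he : e 0 = 1) (n : ℕ) : coeff (n + 1) (pathSeries e) =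
    ∑ ij ∈ antidiagonal n, (ij.1 * e (ij.1 + 1)) * coeff ij.2 (pathSeries e) := by
  have h := congrArg (coeff (n + 1)) (sub_mul_pathSeries he)
  rw [coeff_mul, Nat.sum_antidiagonal_succ, coeff_one, if_neg (Nat.succ_ne_zero n)] at h
  simp only [derivSeries, map_sub, coeff_mk, he, Nat.cast_zero, zero_mul, sub_zero, one_mul,
    Nat.cast_succ] at h
  have h2 : ∑ x ∈ antidiagonal n, (e (x.1 + 1) - (x.1 + 1) * e (x.1 + 1)) *
      coeff x.2 (pathSeries e) =
        -∑ ij ∈ antidiagonal n, (ij.1 * e (ij.1 + 1)) * coeff ij.2 (pathSeries e) := by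
    rw [← sum_neg_distrib]
    refine sum_congr rfl fun ij _ => ?_
    ring
  rwa [h2, add_neg_eq_zero] at h

theorem coeff_unitPathSeries_zero : coeff 0 (unitPathSeries e) = 1 := by
  have h := congrArg (coeff 0) (sub_mul_unitPathSeries (e := e))
  rw [coeff_mul, Nat.antidiagonal_zero, sum_singleton] at h
  simpa [derivSeries] using h

/-- The recursion for `1 / (1 - ∑ i e_i X^i)`. -/
theorem coeff_unitPathSeries_succ (n : ℕ) : coeff (n + 1) (unitPathSeries e) =
    ∑ ij ∈ antidiagonal n, (((ij.1 + 1 : ℕ) : R) * e (ij.1 + 1)) *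
      coeff ij.2 (unitPathSeries e) := by
  have h := congrArg (coeff (n + 1)) (sub_mul_unitPathSeries (e := e))
  rw [sub_mul, one_mul, map_sub, sub_eq_iff_eq_add, coeff_one, if_neg (Nat.succ_ne_zero n),
    zero_add, coeff_mul, Nat.sum_antidiagonal_succ] at h
  simpa only [derivSeries, coeff_mk, Nat.cast_zero, zero_mul, zero_add] using h

variable {N}

/-- Products are monotone for the order defined by `N`. -/
theorem Subsemiring.mul_sub_mul_mem {x x' y y' : R} (hx : x ∈ N) (hy' : y' ∈ N)
    (hxx : x' - x ∈ N) (hyy : y' - y ∈ N) : x' * y' - x * y ∈ N := by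
  have : x' * y' - x * y = (x' - x) * y' + x * (y' - y) := by ring
  rw [this]
  exact N.add_mem (N.mul_mem hxx hy') (N.mul_mem hx hyy)

theorem natCast_mul_mem (hN : ∀ i, e i ∈ N) (c i : ℕ) : (c : R) * e i ∈ N :=
  N.mul_mem (natCast_mem N c) (hN i)

theorem coeff_pathSeries_mem (he : e 0 = 1) (hN : ∀ i, e i ∈ N) (n : ℕ) :
    coeff n (pathSeries e) ∈ N := by
  induction n using Nat.strong_induction_on with
  | _ n ih =>
    cases n with
    | zero => rw [coeff_pathSeries_zero he]; exact N.one_mem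
    | succ n =>
      rw [coeff_pathSeries_succ he]
      refine N.sum_mem fun ij hij => N.mul_mem (natCast_mul_mem hN _ _) (ih _ ?_)
      have := mem_antidiagonal.1 hij
      omega

theorem coeff_unitPathSeries_sub_mem (he : e 0 = 1) (hN : ∀ i, e i ∈ N) (n : ℕ) :
    coeff n (unitPathSeries e) - coeff n (pathSeries e) ∈ N := by
  induction n using Nat.strong_induction_on with
  | _ n ih =>
    cases n with
    | zero =>
      rw [coeff_pathSeries_zero he, coeff_unitPathSeries_zero, sub_self]
      exact N.zero_mem
    | succ n =>
      rw [coeff_pathSeries_succ he, coeff_unitPathSeries_succ, ← sum_sub_distrib]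
      refine N.sum_mem fun ij hij => ?_
      have hlt : ij.2 < n + 1 := by
        have := mem_antidiagonal.1 hij
        omega
      have h1 := ih _ hlt
      refine Subsemiring.mul_sub_mul_mem (natCast_mul_mem hN _ _) ?_ ?_ h1
      · have := N.add_mem h1 (coeff_pathSeries_mem he hN ij.2)
        rwa [sub_add_cancel] at this
      · have : (((ij.1 + 1 : ℕ) : R) * e (ij.1 + 1)) - ij.1 * e (ij.1 + 1) = e (ij.1 + 1) := by
          push_cast
          ring
        rw [this]
        exact hN _

theorem coeff_unitPathSeries_mem (he : e 0 = 1) (hN : ∀ i, e i ∈ N) (n : ℕ) :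
    coeff n (unitPathSeries e) ∈ N := by
  have := N.add_mem (coeff_unitPathSeries_sub_mem he hN n) (coeff_pathSeries_mem he hN n)
  rwa [sub_add_cancel] at this

/-- The series `1 / (1 - D)` dominates `E V`: the coefficients of `E V` are `∑ i e_i V_{n-i}`, and
those of `1 / (1 - D)` satisfy the same formula with `1 / (1 - D)` in place of `V`. -/
theorem coeff_unitPathSeries_sub_coeff_mul_mem (he : e 0 = 1) (hN : ∀ i, e i ∈ N) (n : ℕ) :
    coeff n (unitPathSeries e) - coeff n (PowerSeries.mk e * pathSeries e) ∈ N := by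
  cases n with
  | zero =>
    have : coeff 0 (PowerSeries.mk e * pathSeries e) = 1 := by
      rw [coeff_mul, Nat.antidiagonal_zero, sum_singleton, coeff_pathSeries_zero he, coeff_mk, he,
        mul_one]
    rw [this, coeff_unitPathSeries_zero, sub_self]
    exact N.zero_mem
  | succ n =>
    have : coeff (n + 1) (PowerSeries.mk e * pathSeries e) =
        ∑ ij ∈ antidiagonal n, (((ij.1 + 1 : ℕ) : R) * e (ij.1 + 1)) *
          coeff ij.2 (pathSeries e) := by
      rw [coeff_mul, Nat.sum_antidiagonal_succ, coeff_mk, he, one_mul, coeff_pathSeries_succ he,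
        ← sum_add_distrib]
      refine sum_congr rfl fun ij _ => ?_
      rw [coeff_mk]
      push_cast
      ring
    rw [this, coeff_unitPathSeries_succ, ← sum_sub_distrib]
    refine N.sum_mem fun ij _ => ?_
    rw [← mul_sub]
    exact N.mul_mem (natCast_mul_mem hN _ _) (coeff_unitPathSeries_sub_mem he hN _)

theorem transferCoeff_mem (he : e 0 = 1) (hN : ∀ i, e i ∈ N) (m k l : ℕ) :
    transferCoeff e m k l ∈ N := by
  refine N.sum_mem fun vM _ => N.mul_mem (coeff_pathSeries_mem he hN _) ?_
  split_ifs
  · exact natCast_mul_mem hN _ _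
  · exact N.zero_mem
  · exact natCast_mul_mem hN _ _

theorem transferCoeff_zero {m k : ℕ} (hk : 0 < k) : transferCoeff e m k 0 = 0 := by
  refine sum_eq_zero fun vM _ => ?_
  split_ifs
  · omega
  · rw [mul_zero]
  · rw [Nat.zero_sub, Nat.cast_zero, zero_mul, mul_zero]

/-- The weights of the trees of the unit forest triples. -/
def unitWeight (e : ℕ → R) (i : ℕ) : R := i * e i

/-- The weight that selects the component size `k`. -/
def sizeIs (R : Type*) [CommRing R] (k j : ℕ) : R := if j = k then 1 else 0

/-- The transfer operator of the unit count. The two summands come from a tree of the root that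
contains the closing edge of the cycle and from one that does not. -/
theorem cycleTransfer_sizeIs (m : ℕ) {k l : ℕ} (hk : 0 < k) :
    cycleTransfer (unitWeight e) (m + 1) (sizeIs R k) l =
      (if l < k ∧ k ≤ l + (m + 1) then
          ((k - l : ℕ) : R) * coeff (l + (m + 1) - k) (unitPathSeries e) else 0) +
        ∑ τ ∈ range (m + 1), (if k ≤ m - τ + 1 then
          coeff (m - τ + 1 - k) (unitPathSeries e) else 0) * unitWeight e (l + τ) := by
  have hW : unitPathSeries e * (1 - PowerSeries.mk (unitWeight e)) = 1 := by
    rw [mul_comm]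
    exact sub_mul_unitPathSeries
  rw [cycleTransfer_eq _ (by simp [unitWeight]) _ hW]
  congr 1
  · by_cases h : l < k ∧ k ≤ l + (m + 1)
    · rw [if_pos h, sum_eq_single (l + (m + 1) - k, k - l - 1)]
      · have : ((k - l : ℕ) : R) = ((k - l - 1 : ℕ) : R) + 1 := by
          rw [← Nat.cast_succ]
          congr 1
          omega
        rw [sizeIs, if_pos (by omega), this, mul_one, mul_comm]
      · intro bc hbc hne
        rw [sizeIs, if_neg, mul_zero, mul_zero]
        intro h2
        have := mem_antidiagonal.1 hbc
        exact hne (Prod.ext (by simp only; omega) (by simp only; omega))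
      · intro h2
        exact absurd (HasAntidiagonal.mem_antidiagonal.2 (by simp only; omega)) h2
    · rw [if_neg h]
      refine sum_eq_zero fun bc hbc => ?_
      have := mem_antidiagonal.1 hbc
      rw [sizeIs, if_neg (by omega), mul_zero, mul_zero]
  · refine sum_congr rfl fun τ _ => ?_
    congr 1
    by_cases h : k ≤ m - τ + 1
    · rw [if_pos h, sum_eq_single (m - τ + 1 - k, k - 1)]
      · rw [sizeIs, if_pos (by omega), mul_one]
      · intro bc hbc hne
        rw [sizeIs, if_neg, mul_zero]
        intro h2
        have := mem_antidiagonal.1 hbc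
        exact hne (Prod.ext (by simp only; omega) (by simp only; omega))
      · intro h2
        exact absurd (HasAntidiagonal.mem_antidiagonal.2 (by simp only; omega)) h2
    · rw [if_neg h]
      refine sum_eq_zero fun bc hbc => ?_
      have := mem_antidiagonal.1 hbc
      rw [sizeIs, if_neg (by omega), mul_zero]

/-- The transfer coefficients of the signed count are bounded by those of the unit count. -/
theorem cycleTransfer_sizeIs_sub_transferCoeff_mem (he : e 0 = 1) (hN : ∀ i, e i ∈ N) (m : ℕ)
    {k : ℕ} (l : ℕ) (hk : 0 < k) :
    cycleTransfer (unitWeight e) (m + 1) (sizeIs R k) l - transferCoeff e m k l ∈ N := by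
  rw [cycleTransfer_sizeIs m hk]
  have hfst : (if l < k ∧ k ≤ l + (m + 1) then
      ((k - l : ℕ) : R) * coeff (l + (m + 1) - k) (unitPathSeries e) else 0) ∈ N := by
    split_ifs
    · exact N.mul_mem (natCast_mem N _) (coeff_unitPathSeries_mem he hN _)
    · exact N.zero_mem
  have hsnd : ∑ τ ∈ range (m + 1), (if k ≤ m - τ + 1 then
      coeff (m - τ + 1 - k) (unitPathSeries e) else 0) * unitWeight e (l + τ) ∈ N := by
    refine N.sum_mem fun τ _ => N.mul_mem ?_ (natCast_mul_mem hN _ _)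
    split_ifs
    · exact coeff_unitPathSeries_mem he hN _
    · exact N.zero_mem
  rcases Nat.lt_or_ge l k with hlk | hlk
  · rw [add_sub_right_comm]
    refine N.add_mem ?_ hsnd
    by_cases h : k ≤ l + (m + 1)
    · rw [if_pos ⟨hlk, h⟩]
      -- For `l < k` the coefficient is `k - l` times a part of a coefficient of `E * V`.
      have hle : ((k - l : ℕ) : R) * coeff (l + (m + 1) - k) (PowerSeries.mk e * pathSeries e) -
          transferCoeff e m k l ∈ N := by
        have hsum : transferCoeff e m k l = ∑ v ∈ range (l + (m + 1) - k + 1),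
            if m + 1 < v + k ∧ v ≤ m then ((k - l : ℕ) : R) *
              (e (l + (m + 1) - k - v) * coeff v (pathSeries e)) else 0 := by
          rw [transferCoeff, Nat.sum_antidiagonal_eq_sum_range_succ fun v M =>
            coeff v (pathSeries e) * if M + 1 < k then
              if k ≤ l + (M + 1) then ((k - l : ℕ) : R) * e (l + (M + 1) - k) else 0
            else ((l - k : ℕ) : R) * e (l + (M + 1) - k)]
          have hsub : range (l + (m + 1) - k + 1) ⊆ range (m + 1) :=
            range_subset_range.2 (by omega)
          rw [← sum_subset hsub]
          · refine sum_congr rfl fun v hv => ?_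
            have hv := mem_range.1 hv
            by_cases hv2 : m + 1 < v + k ∧ v ≤ m
            · rw [if_pos hv2, if_pos (by omega), if_pos (by omega),
                show l + (m - v + 1) - k = l + (m + 1) - k - v by omega]
              ring
            · rw [if_neg hv2, if_neg (by omega), show l - k = 0 by omega, Nat.cast_zero,
                zero_mul, mul_zero]
          · intro v hv hv2
            have hv := mem_range.1 hv
            have hv2 := mt mem_range.2 hv2
            rw [if_pos (by omega), if_neg (by omega), mul_zero]
        rw [hsum, mul_comm (PowerSeries.mk e), coeff_mul,
          Nat.sum_antidiagonal_eq_sum_range_succ fun a b =>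
            coeff a (pathSeries e) * coeff b (PowerSeries.mk e), mul_sum, ← sum_sub_distrib]
        refine N.sum_mem fun v _ => ?_
        rw [coeff_mk]
        split_ifs
        · have : ((k - l : ℕ) : R) * (coeff v (pathSeries e) * e (l + (m + 1) - k - v)) -
              ((k - l : ℕ) : R) * (e (l + (m + 1) - k - v) * coeff v (pathSeries e)) = 0 := by
            ring
          rw [this]
          exact N.zero_mem
        · rw [sub_zero]
          exact N.mul_mem (natCast_mem N _)
            (N.mul_mem (coeff_pathSeries_mem he hN _) (hN _))
      have h2 := N.mul_mem (natCast_mem N (k - l))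
        (coeff_unitPathSeries_sub_coeff_mul_mem he hN (l + (m + 1) - k))
      have := N.add_mem h2 hle
      rwa [mul_sub, sub_add_sub_cancel] at this
    · rw [if_neg fun h2 => h h2.2]
      have : transferCoeff e m k l = 0 := by
        refine sum_eq_zero fun vM hvM => ?_
        have := mem_antidiagonal.1 hvM
        rw [if_pos (by omega), if_neg (by omega), mul_zero]
      rw [this, sub_zero]
      exact N.zero_mem
  · rw [add_sub_assoc]
    refine N.add_mem hfst ?_
    -- For `l ≥ k` the two coefficients are compared term by term.
    have hsum : transferCoeff e m k l = ∑ τ ∈ range (m + 1), (if k ≤ m - τ + 1 then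
        coeff (m - τ + 1 - k) (pathSeries e) else 0) * (((l - k : ℕ) : R) * e (l + τ)) := by
      rw [transferCoeff, Nat.sum_antidiagonal_eq_sum_range_succ fun v M =>
        coeff v (pathSeries e) * if M + 1 < k then
          if k ≤ l + (M + 1) then ((k - l : ℕ) : R) * e (l + (M + 1) - k) else 0
        else ((l - k : ℕ) : R) * e (l + (M + 1) - k)]
      rcases Nat.lt_or_ge (m + 1) k with h | h
      · rw [sum_eq_zero, sum_eq_zero]
        · intro τ _
          rw [if_neg (by omega), zero_mul]
        · intro v _
          rw [if_pos (by omega), if_pos (by omega), show k - l = 0 by omega, Nat.cast_zero,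
            zero_mul, mul_zero]
      · obtain ⟨d, hd⟩ : ∃ d, m + 1 = d + k := ⟨m + 1 - k, by omega⟩
        have hsub : range (d + 1) ⊆ range (m + 1) := range_subset_range.2 (by omega)
        rw [← sum_subset hsub, ← sum_subset hsub, ← sum_range_reflect]
        · refine sum_congr rfl fun τ hτ => ?_
          have hτ := mem_range.1 hτ
          rw [if_neg (by omega), if_pos (by omega), show d + 1 - 1 - τ = m - τ + 1 - k by omega,
            show l + (m - (m - τ + 1 - k) + 1) - k = l + τ by omega]
        · intro τ hτ hτ2
          have hτ := mem_range.1 hτ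
          have hτ2 := mt mem_range.2 hτ2
          rw [if_neg (by omega), zero_mul]
        · intro v hv hv2
          have hv := mem_range.1 hv
          have hv2 := mt mem_range.2 hv2
          rw [if_pos (by omega), show k - l = 0 by omega, Nat.cast_zero, zero_mul, ite_self,
            mul_zero]
    rw [hsum, ← sum_sub_distrib]
    refine N.sum_mem fun τ _ => ?_
    split_ifs
    · refine Subsemiring.mul_sub_mul_mem (coeff_pathSeries_mem he hN _) (natCast_mul_mem hN _ _)
        (coeff_unitPathSeries_sub_mem he hN _) ?_
      have : unitWeight e (l + τ) - ((l - k : ℕ) : R) * e (l + τ) =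
          ((k + τ : ℕ) : R) * e (l + τ) := by
        rw [unitWeight, show l + τ = (l - k) + (k + τ) by omega]
        push_cast
        ring
      rw [this]
      exact natCast_mul_mem hN _ _
    · rw [zero_mul, zero_mul, sub_zero]
      exact N.zero_mem

end Comparison

namespace EdgeOrderedGraph

open SimpleGraph

section Positivity

variable {R : Type*} [CommRing R]

open Classical in
theorem forestSum_eq (G : EdgeOrderedGraph) (q p : ℕ → R) :
    G.forestSum q p = ∑ F : {F // G.IsNonBroken F}, q #(F.1.cls G.first) *
      ∏ A ∈ (F.1.classes univ).erase (F.1.cls G.first), p #A := by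
  refine sum_congr rfl fun F _ => ?_
  rw [← mul_prod_erase _ _ (cls_mem_classes F.1 (mem_univ G.first)),
    if_pos (self_mem_cls _ _)]
  congr 1
  refine prod_congr rfl fun A hA => ?_
  rw [if_neg]
  intro hfA
  obtain ⟨hA1, hA2⟩ := mem_erase.1 hA
  obtain ⟨x, -, rfl⟩ := (F.1.mem_classes univ A).1 hA2
  rw [mem_cls, ← cls_eq_iff] at hfA
  exact hA1 hfA

theorem forestSum_congr {G : EdgeOrderedGraph} {q q' p : ℕ → R}
    (h : ∀ l, 0 < l → l ≤ G.n → q l = q' l) : G.forestSum q p = G.forestSum q' p := by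
  rw [forestSum_eq, forestSum_eq]
  refine sum_congr rfl fun F _ => ?_
  rw [h]
  · exact card_pos.2 ⟨_, self_mem_cls _ _⟩
  · exact (card_le_univ _).trans (Fintype.card_fin _).le

theorem forestSum_sum (G : EdgeOrderedGraph) {ι : Type*} (s : Finset ι) (c : ι → R)
    (q : ι → ℕ → R) (p : ℕ → R) :
    G.forestSum (fun l => ∑ i ∈ s, c i * q i l) p = ∑ i ∈ s, c i * G.forestSum (q i) p := by
  simp only [forestSum_eq, mul_sum, sum_mul]
  rw [sum_comm]
  simp only [mul_assoc]

/-- For an adjacent cycle chain, the signed count of the forest triples with first part `k` lies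
coefficientwise between zero and the count of the unit forest triples, up to the common factor
`e k`. -/
theorem IsAdjacentCycleChain.forestSum_mem {e : ℕ → R} (he : e 0 = 1) {N : Subsemiring R}
    (hN : ∀ i, e i ∈ N) {G : EdgeOrderedGraph} (hG : G.IsAdjacentCycleChain) {k : ℕ}
    (hk : 0 < k) :
    G.forestSum (shiftedInv e k) (signedPowerSum e) ∈ N ∧
      G.forestSum (sizeIs R k) (unitWeight e) -
        G.forestSum (shiftedInv e k) (signedPowerSum e) ∈ N := by
  revert k
  refine hG.induction_point (P := fun G => ∀ {k : ℕ}, 0 < k →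
    G.forestSum (shiftedInv e k) (signedPowerSum e) ∈ N ∧
      G.forestSum (sizeIs R k) (unitWeight e) -
        G.forestSum (shiftedInv e k) (signedPowerSum e) ∈ N) ?_ ?_
  · intro k hk
    have h : shiftedInv e k 1 = sizeIs R k 1 := by
      rw [shiftedInv, sizeIs]
      by_cases h : k = 1
      · subst h
        simp [invSeries]
      · rw [if_neg (by omega), if_neg (by omega)]
    rw [forestSum_point, forestSum_point, h, sub_self]
    refine ⟨?_, N.zero_mem⟩
    rw [sizeIs]
    split_ifs
    · exact N.one_mem
    · exact N.zero_mem
  · intro a ha G ih k hk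
    obtain ⟨m, rfl⟩ : ∃ m, a = m + 2 := ⟨a - 2, by omega⟩
    rw [forestSum_add_cycle, forestSum_add_cycle, show m + 2 - 1 = m + 1 by omega]
    have h1 : G.forestSum (cycleTransfer (signedPowerSum e) (m + 1) (shiftedInv e k))
        (signedPowerSum e) = ∑ l ∈ range (G.n + 1), transferCoeff e m k l *
          G.forestSum (shiftedInv e l) (signedPowerSum e) := by
      rw [← forestSum_sum]
      exact forestSum_congr fun l hl hln =>
        cycleTransfer_shiftedInv he m hk hl (Nat.lt_succ_of_le hln)
    have h2 : G.forestSum (cycleTransfer (unitWeight e) (m + 1) (sizeIs R k))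
        (unitWeight e) = ∑ l ∈ range (G.n + 1),
          cycleTransfer (unitWeight e) (m + 1) (sizeIs R k) l *
            G.forestSum (sizeIs R l) (unitWeight e) := by
      rw [← forestSum_sum]
      refine forestSum_congr fun l hl hln => ?_
      rw [sum_eq_single l]
      · rw [sizeIs, if_pos rfl, mul_one]
      · intro l' _ hl'
        rw [sizeIs, if_neg (Ne.symm hl'), mul_zero]
      · intro h
        exact absurd (mem_range.2 (Nat.lt_succ_of_le hln)) h
    -- The index `0` contributes to neither sum, because trees are not empty.
    have hzero : G.forestSum (sizeIs R 0) (unitWeight e) = 0 := by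
      rw [forestSum_eq]
      refine sum_eq_zero fun F _ => ?_
      rw [sizeIs, if_neg, zero_mul]
      exact (card_pos.2 ⟨_, self_mem_cls _ _⟩).ne'
    rw [h1, h2, ← sum_sub_distrib]
    have hc := transferCoeff_mem (N := N) he hN m k
    constructor
    · refine N.sum_mem fun l _ => ?_
      rcases Nat.eq_zero_or_pos l with rfl | hl
      · rw [transferCoeff_zero hk, zero_mul]
        exact N.zero_mem
      · exact N.mul_mem (hc l) (ih hl).1
    · refine N.sum_mem fun l _ => ?_
      rcases Nat.eq_zero_or_pos l with rfl | hl
      · rw [transferCoeff_zero hk, hzero, mul_zero, zero_mul, sub_zero]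
        exact N.zero_mem
      · obtain ⟨h3, h4⟩ := ih hl
        refine Subsemiring.mul_sub_mul_mem (hc l) ?_
          (cycleTransfer_sizeIs_sub_transferCoeff_mem he hN m l hk) h4
        have := N.add_mem h4 h3
        rwa [sub_add_cancel] at this

end Positivity

end EdgeOrderedGraph

end

/-! ### Compositions and forest triples -/

section

open Finset

/-- Compositions of a positive integer are split into the first part and the rest. -/
theorem sum_composition_succ {R : Type*} [AddCommMonoid R] (n : ℕ) (f : List ℕ → R) :
    ∑ α : Composition (n + 1), f α.blocks =
      ∑ ij ∈ antidiagonal n, ∑ β : Composition ij.2, f ((ij.1 + 1) :: β.blocks) := by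
  rw [sum_sigma']
  symm
  refine sum_bij (fun x hx => ⟨(x.1.1 + 1) :: x.2.blocks, ?_, ?_⟩) ?_ ?_ ?_ ?_
  · intro i hi
    rcases List.mem_cons.1 hi with rfl | hi
    · exact Nat.succ_pos _
    · exact x.2.blocks_pos hi
  · have := HasAntidiagonal.mem_antidiagonal.1 (mem_sigma.1 hx).1
    rw [List.sum_cons, x.2.blocks_sum]
    omega
  · exact fun _ _ => mem_univ _
  · rintro ⟨⟨i, j⟩, β⟩ hx ⟨⟨i', j'⟩, β'⟩ hx' h
    have h' := List.cons.inj (congrArg Composition.blocks h)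
    have hi : i = i' := Nat.succ_injective h'.1
    have hj : (⟨j, β⟩ : Σ n, Composition n) = ⟨j', β'⟩ :=
      Composition.sigma_eq_iff_blocks_eq.2 h'.2
    obtain ⟨rfl, hβ⟩ := Sigma.mk.inj hj
    obtain rfl := eq_of_heq hβ
    subst hi
    rfl
  · rintro ⟨blocks, hpos, hsum⟩ -
    cases blocks with
    | nil => simp at hsum
    | cons b l =>
      have hb : 0 < b := hpos List.mem_cons_self
      rw [List.sum_cons] at hsum
      refine ⟨⟨(b - 1, l.sum), ⟨l, fun hi => hpos (List.mem_cons_of_mem _ hi), rfl⟩⟩, ?_, ?_⟩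
      · rw [mem_sigma, HasAntidiagonal.mem_antidiagonal]
        exact ⟨by simp only; omega, mem_univ _⟩
      · ext1
        simp only [List.cons.injEq, and_true]
        omega
  · exact fun _ _ => rfl

/-- The data of a forest triple at a tree with `m` vertices: a composition `α` of `m` and an
integer `r` with `1 ≤ r ≤ α₁`, which is encoded by `r - 1`. -/
abbrev TreeDatum (m : ℕ) : Type := Σ α : Composition m, Fin (α.blocks.headD 0)

theorem sum_treeDatum_zero {R : Type*} [AddCommMonoid R] (w : List ℕ → ℕ → R) :
    ∑ x : TreeDatum 0, w x.1.blocks (x.2 + 1) = 0 := by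
  refine sum_eq_zero fun x _ => ?_
  have h := (Composition.blocks_eq_nil x.1).2 rfl
  have h0 : x.1.blocks.headD 0 = 0 := by rw [h]; rfl
  have := x.2.2
  omega

theorem sum_treeDatum_succ {R : Type*} [AddCommMonoid R] (m : ℕ) (w : List ℕ → ℕ → R) :
    ∑ x : TreeDatum (m + 1), w x.1.blocks (x.2 + 1) =
      ∑ ij ∈ antidiagonal m, ∑ β : Composition ij.2, ∑ r ∈ range (ij.1 + 1),
        w ((ij.1 + 1) :: β.blocks) (r + 1) := by
  rw [Fintype.sum_sigma]
  have h : ∀ α : Composition (m + 1), ∑ r : Fin (α.blocks.headD 0), w α.blocks (r + 1) =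
      ∑ r ∈ range (α.blocks.headD 0), w α.blocks (r + 1) := by
    intro α
    rw [Finset.sum_range]
  rw [Fintype.sum_congr _ _ h,
    sum_composition_succ m fun l => ∑ r ∈ range (l.headD 0), w l (r + 1)]
  rfl

section LocalSums

variable {R : Type*} [CommRing R] (e : ℕ → R)

/-- The weight `(-1) ^ (ℓ - 1) e_{α₁} ⋯ e_{α_ℓ}` of a composition `α` of length `ℓ`. -/
def signedWeight (l : List ℕ) : R := (-1) ^ (l.length - 1) * (l.map e).prod

/-- The weight `e_{α₁}` of a composition of length one; other compositions have the weight `0`. -/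
def unitCompWeight (l : List ℕ) : R := if l.length = 1 then (l.map e).prod else 0

variable {e}

/-- The signed sum over compositions inverts the series `E`. -/
theorem sum_composition_neg_one_pow (he : e 0 = 1) (n : ℕ) :
    ∑ α : Composition n, (-1) ^ α.blocks.length * (α.blocks.map e).prod =
      PowerSeries.coeff n (invSeries e) := by
  induction n using Nat.strong_induction_on with
  | _ n ih =>
    cases n with
    | zero =>
      have hnil : ∀ α : Composition 0, α.blocks = [] :=
        fun α => (Composition.blocks_eq_nil α).2 rfl
      simp only [hnil]
      simp [invSeries, composition_card]
    | succ n =>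
      rw [sum_composition_succ n fun l => (-1) ^ l.length * (l.map e).prod]
      have h := sum_mul_coeff_invSeries he (Nat.succ_pos n)
      rw [sum_range_succ', he, one_mul, Nat.sub_zero, add_comm] at h
      rw [eq_neg_of_add_eq_zero_left h, Nat.sum_antidiagonal_eq_sum_range_succ_mk,
        ← sum_neg_distrib]
      refine sum_congr rfl fun i hi => ?_
      have hi := mem_range.1 hi
      rw [show n.succ - (i + 1) = n - i by omega, ← ih (n - i) (by omega), mul_sum,
        ← sum_neg_distrib]
      refine sum_congr rfl fun β _ => ?_
      rw [List.length_cons, List.map_cons, List.prod_cons]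
      ring

theorem sum_signedWeight_cons (he : e 0 = 1) (i j : ℕ) :
    ∑ β : Composition j, signedWeight e (i :: β.blocks) =
      e i * PowerSeries.coeff j (invSeries e) := by
  rw [← sum_composition_neg_one_pow he, mul_sum]
  refine sum_congr rfl fun β _ => ?_
  rw [signedWeight, List.length_cons, List.map_cons, List.prod_cons, Nat.add_sub_cancel]
  ring

/-- The total weight of a tree: there are `α₁` choices for `r`, which turn the first factor `e_{α₁}`
into a coefficient of `D`. -/
theorem sum_treeDatum_signedWeight (he : e 0 = 1) (m : ℕ) :
    ∑ x : TreeDatum m, signedWeight e x.1.blocks = signedPowerSum e m := by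
  cases m with
  | zero => rw [sum_treeDatum_zero fun l _ => signedWeight e l, signedPowerSum_zero]
  | succ m =>
    rw [sum_treeDatum_succ m fun l _ => signedWeight e l, signedPowerSum_eq, sum_range_succ',
      Nat.cast_zero, zero_mul, zero_mul, add_zero, Nat.sum_antidiagonal_eq_sum_range_succ_mk]
    refine sum_congr rfl fun i _ => ?_
    simp only [sum_const, card_range]
    rw [← smul_sum, sum_signedWeight_cons he, nsmul_eq_mul, mul_assoc,
      show m + 1 - (i + 1) = m - i by omega]

/-- The total weight of a tree with prescribed `α₁ = k` and `r`. -/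
theorem sum_treeDatum_signedWeight_first (he : e 0 = 1) {k r : ℕ} (hr : 1 ≤ r) (hrk : r ≤ k)
    (m : ℕ) :
    ∑ x : TreeDatum m, (if x.1.blocks.headD 0 = k ∧ x.2.1 + 1 = r then
      signedWeight e x.1.blocks else 0) = e k * shiftedInv e k m := by
  cases m with
  | zero =>
    rw [sum_treeDatum_zero fun l s => if l.headD 0 = k ∧ s = r then signedWeight e l else 0,
      shiftedInv, if_neg (by omega), mul_zero]
  | succ m =>
    rw [sum_treeDatum_succ m fun l s => if l.headD 0 = k ∧ s = r then signedWeight e l else 0,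
      shiftedInv]
    have key : ∀ ij : ℕ × ℕ, ∑ β : Composition ij.2, ∑ s ∈ range (ij.1 + 1),
        (if ((ij.1 + 1) :: β.blocks).headD 0 = k ∧ s + 1 = r then
          signedWeight e ((ij.1 + 1) :: β.blocks) else 0) =
        if ij.1 + 1 = k then e k * PowerSeries.coeff ij.2 (invSeries e) else 0 := by
      intro ij
      by_cases h : ij.1 + 1 = k
      · rw [if_pos h, ← h, ← sum_signedWeight_cons he]
        refine sum_congr rfl fun β _ => ?_
        rw [sum_eq_single (r - 1)]
        · exact if_pos ⟨rfl, by omega⟩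
        · intro s _ hs
          exact if_neg fun h2 => hs (by omega)
        · intro h2
          exact absurd (mem_range.2 (by omega)) h2
      · rw [if_neg h]
        exact sum_eq_zero fun β _ => sum_eq_zero fun s _ => if_neg fun h2 => h h2.1
    simp only [key]
    split_ifs with h
    · rw [sum_eq_single (k - 1, m + 1 - k)]
      · rw [if_pos (by omega)]
      · intro ij hij hne
        rw [if_neg]
        intro h2
        have := HasAntidiagonal.mem_antidiagonal.1 hij
        exact hne (Prod.ext (by simp only; omega) (by simp only; omega))
      · intro h2
        exact absurd (HasAntidiagonal.mem_antidiagonal.2 (by simp only; omega)) h2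
    · rw [mul_zero]
      refine sum_eq_zero fun ij hij => ?_
      have := HasAntidiagonal.mem_antidiagonal.1 hij
      rw [if_neg (by omega)]

theorem sum_unitCompWeight_cons (i j : ℕ) :
    ∑ β : Composition j, unitCompWeight e (i :: β.blocks) = if j = 0 then e i else 0 := by
  have h : ∀ β : Composition j, unitCompWeight e (i :: β.blocks) = if j = 0 then e i else 0 := by
    intro β
    by_cases hj : j = 0
    · rw [if_pos hj, unitCompWeight, (Composition.blocks_eq_nil β).2 hj]
      simp
    · rw [if_neg hj, unitCompWeight, if_neg]
      intro h
      rw [List.length_cons] at h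
      have : β.blocks = [] := List.length_eq_zero_iff.1 (by omega)
      exact hj ((Composition.blocks_eq_nil β).1 this)
  rw [Fintype.sum_congr _ _ h]
  split_ifs with hj
  · subst hj
    simp [composition_card]
  · simp

theorem sum_treeDatum_unitCompWeight (m : ℕ) :
    ∑ x : TreeDatum m, unitCompWeight e x.1.blocks = unitWeight e m := by
  cases m with
  | zero => rw [sum_treeDatum_zero fun l _ => unitCompWeight e l]; simp [unitWeight]
  | succ m =>
    rw [sum_treeDatum_succ m fun l _ => unitCompWeight e l]
    simp only [sum_const, card_range, ← smul_sum, sum_unitCompWeight_cons]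
    rw [sum_eq_single (m, 0)]
    · rw [if_pos rfl, unitWeight, nsmul_eq_mul]
    · intro ij hij hne
      rw [if_neg, smul_zero]
      intro h2
      have := HasAntidiagonal.mem_antidiagonal.1 hij
      exact hne (Prod.ext (by simp only; omega) (by simp only; omega))
    · intro h2
      exact absurd (HasAntidiagonal.mem_antidiagonal.2 (by simp only; omega)) h2

theorem sum_treeDatum_unitCompWeight_first {k r : ℕ} (hr : 1 ≤ r) (hrk : r ≤ k) (m : ℕ) :
    ∑ x : TreeDatum m, (if x.1.blocks.headD 0 = k ∧ x.2.1 + 1 = r then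
      unitCompWeight e x.1.blocks else 0) = e k * sizeIs R k m := by
  cases m with
  | zero =>
    rw [sum_treeDatum_zero fun l s => if l.headD 0 = k ∧ s = r then unitCompWeight e l else 0,
      sizeIs, if_neg (by omega), mul_zero]
  | succ m =>
    rw [sum_treeDatum_succ m fun l s => if l.headD 0 = k ∧ s = r then unitCompWeight e l else 0,
      sizeIs]
    have key : ∀ ij : ℕ × ℕ, ∑ β : Composition ij.2, ∑ s ∈ range (ij.1 + 1),
        (if ((ij.1 + 1) :: β.blocks).headD 0 = k ∧ s + 1 = r then
          unitCompWeight e ((ij.1 + 1) :: β.blocks) else 0) =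
        if ij.1 + 1 = k ∧ ij.2 = 0 then e k else 0 := by
      intro ij
      by_cases h : ij.1 + 1 = k
      · simp only [h, true_and]
        rw [← sum_unitCompWeight_cons]
        refine sum_congr rfl fun β _ => ?_
        rw [sum_eq_single (r - 1)]
        · exact if_pos ⟨rfl, by omega⟩
        · intro s _ hs
          exact if_neg fun h2 => hs (by omega)
        · intro h2
          exact absurd (mem_range.2 (by omega)) h2
      · rw [if_neg fun h2 => h h2.1]
        exact sum_eq_zero fun β _ => sum_eq_zero fun s _ => if_neg fun h2 => h h2.1
    simp only [key]
    split_ifs with h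
    · rw [sum_eq_single (m, 0)]
      · rw [if_pos ⟨h, rfl⟩, mul_one]
      · intro ij hij hne
        rw [if_neg]
        intro h2
        have := HasAntidiagonal.mem_antidiagonal.1 hij
        exact hne (Prod.ext (by simp only; omega) (by simp only; omega))
      · intro h2
        exact absurd (HasAntidiagonal.mem_antidiagonal.2 (by simp only; omega)) h2
    · rw [mul_zero]
      refine sum_eq_zero fun ij hij => ?_
      have := HasAntidiagonal.mem_antidiagonal.1 hij
      rw [if_neg (by omega)]

end LocalSums

namespace EdgeOrderedGraph

open SimpleGraph

namespace ForestTriple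

variable {G : EdgeOrderedGraph}

/-- A forest triple is a non-broken circuit together with data at each of its trees. -/
def equivSigma (G : EdgeOrderedGraph) : ForestTriple G ≃
    Σ F : {F // G.IsNonBroken F}, ∀ T : F.1.ConnectedComponent, TreeDatum T.supp.ncard where
  toFun 𝓕 := ⟨⟨𝓕.forest, 𝓕.nonBroken⟩, fun T => ⟨𝓕.comp T, ⟨𝓕.r T - 1, by
    have h1 := 𝓕.one_le_r T
    have h2 := 𝓕.r_le T
    omega⟩⟩⟩
  invFun x :=
    { forest := x.1.1
      nonBroken := x.1.2
      comp := fun T => (x.2 T).1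
      r := fun T => (x.2 T).2.1 + 1
      one_le_r := fun T => Nat.le_add_left _ _
      r_le := fun T => (x.2 T).2.2 }
  left_inv 𝓕 := by
    have h : (fun T => 𝓕.r T - 1 + 1) = 𝓕.r := funext fun T => Nat.sub_add_cancel (𝓕.one_le_r T)
    cases 𝓕
    simp only at h
    simp only [h]
  right_inv x := rfl

open Classical in
noncomputable instance : Fintype (ForestTriple G) := Fintype.ofEquiv _ (equivSigma G).symm

open Classical in
/-- The generating function of the forest triples with respect to a product weight is a sum over
non-broken circuits. -/
theorem sum_prod_eq_forestSum {R : Type*} [CommSemiring R] (w₀ w₁ : List ℕ → ℕ → R) :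
    ∑ 𝓕 : ForestTriple G, ∏ T : 𝓕.forest.ConnectedComponent,
        (if T = 𝓕.minTree then w₀ (𝓕.comp T).blocks (𝓕.r T)
          else w₁ (𝓕.comp T).blocks (𝓕.r T)) =
      G.forestSum (fun m => ∑ x : TreeDatum m, w₀ x.1.blocks (x.2 + 1))
        (fun m => ∑ x : TreeDatum m, w₁ x.1.blocks (x.2 + 1)) := by
  rw [← Equiv.sum_comp (equivSigma G).symm, Fintype.sum_sigma, forestSum]
  refine sum_congr rfl fun F _ => ?_
  have h := prod_connectedComponent F.1 fun A : Finset (Fin G.n) =>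
    if G.first ∈ A then ∑ x : TreeDatum #A, w₀ x.1.blocks (x.2 + 1)
      else ∑ x : TreeDatum #A, w₁ x.1.blocks (x.2 + 1)
  rw [← h]
  have h2 : ∀ T : F.1.ConnectedComponent,
      (if G.first ∈ T.supp.toFinset then
        ∑ x : TreeDatum #T.supp.toFinset, w₀ x.1.blocks (x.2 + 1)
      else ∑ x : TreeDatum #T.supp.toFinset, w₁ x.1.blocks (x.2 + 1)) =
      ∑ x : TreeDatum T.supp.ncard, if T = F.1.connectedComponentMk G.first then
        w₀ x.1.blocks (x.2 + 1) else w₁ x.1.blocks (x.2 + 1) := by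
    intro T
    have hmem : G.first ∈ T.supp.toFinset ↔ T = F.1.connectedComponentMk G.first := by
      rw [Set.mem_toFinset, ConnectedComponent.mem_supp_iff, eq_comm]
    rw [Set.ncard_eq_toFinset_card' T.supp]
    by_cases hT : T = F.1.connectedComponentMk G.first
    · rw [if_pos (hmem.2 hT)]
      simp only [if_pos hT]
    · rw [if_neg (mt hmem.1 hT)]
      simp only [if_neg hT]
  rw [Fintype.prod_congr _ _ h2, Finset.prod_univ_sum, Fintype.piFinset_univ]
  rfl

end ForestTriple

end EdgeOrderedGraph

end

/-! ### Involutions from counting -/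

section

open Finset

/-- Two disjoint finite sets of the same size are exchanged by an involution. -/
theorem exists_involution_exchange {X : Type*} [DecidableEq X] (A D : Finset X) (h : #A = #D)
    (hAD : Disjoint A D) :
    ∃ φ : X → X, (∀ x, φ (φ x) = x) ∧ (∀ x ∈ A, φ x ∈ D) ∧ (∀ x ∈ D, φ x ∈ A) ∧
      ∀ x, x ∉ A → x ∉ D → φ x = x := by
  have f : A ≃ D := Fintype.equivOfCardEq (by simpa using h)
  have hdis : ∀ x ∈ D, x ∉ A := fun x hD hA => Finset.disjoint_left.1 hAD hA hD
  refine ⟨fun x => if hA : x ∈ A then (f ⟨x, hA⟩ : X) else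
    if hD : x ∈ D then (f.symm ⟨x, hD⟩ : X) else x, ?_, ?_, ?_, ?_⟩
  · intro x
    by_cases hA : x ∈ A
    · have h1 := hdis _ (f ⟨x, hA⟩).2
      simp [hA, h1]
    · by_cases hD : x ∈ D
      · simp [hA, hD]
      · simp [hA, hD]
  · intro x hA
    simp [hA]
  · intro x hD
    simp [hdis x hD, hD]
  · intro x hA hD
    simp [hA, hD]

/-- A sign-reversing involution within the fibres of `cl`, whose fixed points all satisfy `u`,
exists as soon as the signed count of each fibre lies between zero and the number of its elements
that satisfy `u`. -/
theorem exists_involution_of_count {X Y : Type*} [Fintype X] [DecidableEq X] [DecidableEq Y]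
    (cl : X → Y) (s : X → ℤ) (hs : ∀ x, s x = 1 ∨ s x = -1) (u : X → Prop) [DecidablePred u]
    (hu : ∀ x, u x → s x = 1)
    (h0 : ∀ y, 0 ≤ ∑ x with cl x = y, s x)
    (h1 : ∀ y, ∑ x with cl x = y, s x ≤ #{x | cl x = y ∧ u x}) :
    ∃ φ : X → X, (∀ x, φ (φ x) = x) ∧ (∀ x, cl (φ x) = cl x) ∧
      (∀ x, φ x ≠ x → s (φ x) ≠ s x) ∧ ∀ x, φ x = x → u x := by
  have key : ∀ y, ∃ φ : X → X, (∀ x, φ (φ x) = x) ∧ (∀ x, cl x = y → cl (φ x) = y) ∧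
      (∀ x, cl x = y → φ x ≠ x → s (φ x) ≠ s x) ∧ ∀ x, cl x = y → φ x = x → u x := by
    intro y
    -- The negative elements are exchanged with a set of positive ones that contains all positive
    -- elements without the property `u`.
    set A : Finset X := {x | cl x = y ∧ s x = -1} with hA
    set P : Finset X := {x | cl x = y ∧ s x = 1} with hP
    set U : Finset X := {x | cl x = y ∧ u x} with hU
    have hsum : ∑ x with cl x = y, s x = #P - #A := by
      have hsplit : ∀ x, s x = (if s x = 1 then 1 else 0) - if s x = -1 then 1 else 0 := by
        intro x
        rcases hs x with h | h <;> rw [h] <;> norm_num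
      rw [sum_congr rfl fun x _ => hsplit x, sum_sub_distrib, ← sum_filter, ← sum_filter,
        filter_filter, filter_filter, sum_const, sum_const, nsmul_one, nsmul_one]
    have hUP : U ⊆ P := by
      intro x hx
      simp only [hU, hP, mem_filter, mem_univ, true_and] at hx ⊢
      exact ⟨hx.1, hu x hx.2⟩
    have h0' := h0 y
    have h1' : ∑ x with cl x = y, s x ≤ #U := h1 y
    rw [hsum] at h0' h1'
    have hcard := card_sdiff_add_card_eq_card hUP
    obtain ⟨D, hD1, hD2, hDA⟩ := Finset.exists_subsuperset_card_eq (sdiff_subset : P \ U ⊆ P)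
      (show #(P \ U) ≤ #A by omega) (show #A ≤ #P by omega)
    have hmemP : ∀ x ∈ D, cl x = y ∧ s x = 1 := by
      intro x hx
      simpa [hP] using hD2 hx
    have hmemA : ∀ x, x ∈ A ↔ cl x = y ∧ s x = -1 := by
      intro x
      simp [hA]
    have hdis : Disjoint A D := by
      rw [Finset.disjoint_left]
      intro x hx hx'
      have h2 := ((hmemA x).1 hx).2
      rw [(hmemP x hx').2] at h2
      norm_num at h2
    obtain ⟨φ, hφ, hφA, hφD, hφ0⟩ := exists_involution_exchange A D hDA.symm hdis
    refine ⟨φ, hφ, ?_, ?_, ?_⟩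
    · intro x hx
      by_cases hxA : x ∈ A
      · exact (hmemP _ (hφA x hxA)).1
      · by_cases hxD : x ∈ D
        · exact ((hmemA _).1 (hφD x hxD)).1
        · rw [hφ0 x hxA hxD, hx]
    · intro x hx hne
      by_cases hxA : x ∈ A
      · rw [(hmemP _ (hφA x hxA)).2, ((hmemA x).1 hxA).2]
        norm_num
      · by_cases hxD : x ∈ D
        · rw [((hmemA _).1 (hφD x hxD)).2, (hmemP x hxD).2]
          norm_num
        · exact absurd (hφ0 x hxA hxD) hne
    · intro x hx hfix
      have hxA : x ∉ A := by
        intro hxA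
        have := hφA x hxA
        rw [hfix] at this
        exact Finset.disjoint_left.1 hdis hxA this
      have hxD : x ∉ D := by
        intro hxD
        have := hφD x hxD
        rw [hfix] at this
        exact Finset.disjoint_left.1 hdis this hxD
      have hxP : x ∈ P := by
        simp only [hP, mem_filter, mem_univ, true_and]
        refine ⟨hx, (hs x).resolve_right fun h => hxA ((hmemA x).2 ⟨hx, h⟩)⟩
      by_contra hux
      refine hxD (hD1 (mem_sdiff.2 ⟨hxP, fun h => hux ?_⟩))
      simp only [hU, mem_filter, mem_univ, true_and] at h
      exact h.2
  choose φ hφ1 hφ2 hφ3 hφ4 using key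
  have hcl : ∀ x, cl (φ (cl x) x) = cl x := fun x => hφ2 (cl x) x rfl
  refine ⟨fun x => φ (cl x) x, ?_, hcl, ?_, ?_⟩
  · intro x
    simp only [hcl, hφ1]
  · exact fun x => hφ3 (cl x) x rfl
  · exact fun x => hφ4 (cl x) x rfl

namespace EdgeOrderedGraph

namespace ForestTriple

variable {G : EdgeOrderedGraph}

open MvPolynomial

/-- The variables `e_1, e_2, …` of the polynomial ring, with `e_0 = 1`. -/
noncomputable def eVar (i : ℕ) : MvPolynomial ℕ ℤ := if i = 0 then 1 else X i

theorem eVar_zero : eVar 0 = 1 := if_pos rfl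

theorem eVar_of_pos {i : ℕ} (hi : 0 < i) : eVar i = X i := if_neg hi.ne'

/-- The polynomials with nonnegative coefficients. -/
noncomputable def nonnegCoeff : Subsemiring (MvPolynomial ℕ ℤ) :=
  (MvPolynomial.map (Nat.castRingHom ℤ)).rangeS

theorem coeff_nonneg_of_mem {f : MvPolynomial ℕ ℤ} (hf : f ∈ nonnegCoeff) (d : ℕ →₀ ℕ) :
    0 ≤ coeff d f := by
  obtain ⟨g, rfl⟩ := hf
  rw [coeff_map]
  exact Int.natCast_nonneg _

theorem eVar_mem (i : ℕ) : eVar i ∈ nonnegCoeff := by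
  rw [eVar]
  split_ifs
  · exact nonnegCoeff.one_mem
  · exact ⟨X i, map_X _ _⟩

open Classical in
theorem pos_of_mem_type (𝓕 : ForestTriple G) {i : ℕ} (hi : i ∈ 𝓕.type) : 0 < i := by
  rw [type, Multiset.mem_sum] at hi
  obtain ⟨T, -, hT⟩ := hi
  exact (𝓕.comp T).blocks_pos hT

/-- The monomial of a multiset of positive integers determines the multiset. -/
theorem prod_eVar {s : Multiset ℕ} (hs : ∀ i ∈ s, 0 < i) :
    (s.map eVar).prod = monomial (Multiset.toFinsupp s) 1 := by
  induction s using Multiset.induction_on with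
  | empty => simp
  | cons i s ih =>
    rw [Multiset.map_cons, Multiset.prod_cons, ih fun j hj => hs j (Multiset.mem_cons_of_mem hj),
      eVar_of_pos (hs i (Multiset.mem_cons_self i s)), ← Multiset.singleton_add, map_add,
      Multiset.toFinsupp_singleton, X, monomial_mul, one_mul]

open Classical in
theorem prod_map_type {R : Type*} [CommMonoid R] (𝓕 : ForestTriple G) (e : ℕ → R) :
    (𝓕.type.map e).prod =
      ∏ T : 𝓕.forest.ConnectedComponent, ((𝓕.comp T).blocks.map e).prod := by
  rw [type, ← Multiset.coe_mapAddMonoidHom, map_sum, Multiset.prod_sum]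
  rfl

open Classical in
theorem sign_mul_prod_map_type {R : Type*} [CommRing R] (𝓕 : ForestTriple G) (e : ℕ → R) :
    (𝓕.sign : R) * (𝓕.type.map e).prod =
      ∏ T : 𝓕.forest.ConnectedComponent, signedWeight e (𝓕.comp T).blocks := by
  simp only [signedWeight, prod_mul_distrib, prod_map_type, prod_pow_eq_pow_sum]
  rw [sign]
  push_cast
  rfl

open Classical in
theorem prod_unitCompWeight {R : Type*} [CommRing R] (𝓕 : ForestTriple G) (e : ℕ → R) :
    ∏ T : 𝓕.forest.ConnectedComponent, unitCompWeight e (𝓕.comp T).blocks =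
      if 𝓕.IsUnit then (𝓕.type.map e).prod else 0 := by
  split_ifs with h
  · rw [prod_map_type]
    exact prod_congr rfl fun T _ => if_pos (h T)
  · rw [IsUnit] at h
    push Not at h
    obtain ⟨T, hT⟩ := h
    exact prod_eq_zero (mem_univ T) (if_neg hT)

open Classical in
theorem prod_ite_minTree {R : Type*} [CommSemiring R] (𝓕 : ForestTriple G) (w : List ℕ → R)
    (k r : ℕ) :
    ∏ T : 𝓕.forest.ConnectedComponent, (if T = 𝓕.minTree then
        (if (𝓕.comp T).blocks.headD 0 = k ∧ 𝓕.r T = r then w (𝓕.comp T).blocks else 0)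
        else w (𝓕.comp T).blocks) =
      if 𝓕.minPart = k ∧ 𝓕.minR = r then
        ∏ T : 𝓕.forest.ConnectedComponent, w (𝓕.comp T).blocks else 0 := by
  split_ifs with h
  · refine prod_congr rfl fun T _ => ?_
    split_ifs with h1 h2
    · rfl
    · subst h1
      exact absurd h h2
    · rfl
  · refine prod_eq_zero (mem_univ 𝓕.minTree) ?_
    rw [if_pos rfl]
    exact if_neg h

theorem forestSum_mul_left {R : Type*} [CommRing R] (G : EdgeOrderedGraph) (c : R)
    (q p : ℕ → R) : G.forestSum (fun m => c * q m) p = c * G.forestSum q p := by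
  have := forestSum_sum G {()} (fun _ => c) (fun _ => q) p
  simpa using this

open Classical in
/-- The generating function of the signed forest triples with given first values. -/
theorem sum_sign_eq_forestSum {R : Type*} [CommRing R] {e : ℕ → R} (he : e 0 = 1) {k r : ℕ}
    (hr : 1 ≤ r) (hrk : r ≤ k) :
    (∑ 𝓕 : ForestTriple G, if 𝓕.minPart = k ∧ 𝓕.minR = r then
        (𝓕.sign : R) * (𝓕.type.map e).prod else 0) =
      e k * G.forestSum (shiftedInv e k) (signedPowerSum e) := by
  have h := sum_prod_eq_forestSum (G := G)
    (fun l s => if l.headD 0 = k ∧ s = r then signedWeight e l else 0)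
    (fun l _ => signedWeight e l)
  simp only [prod_ite_minTree, ← sign_mul_prod_map_type] at h
  rw [h, ← forestSum_mul_left]
  congr 1
  · funext m
    exact sum_treeDatum_signedWeight_first he hr hrk m
  · funext m
    exact sum_treeDatum_signedWeight he m

open Classical in
/-- The generating function of the unit forest triples with given first values. -/
theorem sum_isUnit_eq_forestSum {R : Type*} [CommRing R] {e : ℕ → R} {k r : ℕ}
    (hr : 1 ≤ r) (hrk : r ≤ k) :
    (∑ 𝓕 : ForestTriple G, if 𝓕.minPart = k ∧ 𝓕.minR = r then
        (if 𝓕.IsUnit then (𝓕.type.map e).prod else 0) else 0) =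
      e k * G.forestSum (sizeIs R k) (unitWeight e) := by
  have h := sum_prod_eq_forestSum (G := G)
    (fun l s => if l.headD 0 = k ∧ s = r then unitCompWeight e l else 0)
    (fun l _ => unitCompWeight e l)
  simp only [prod_ite_minTree, prod_unitCompWeight] at h
  rw [h, ← forestSum_mul_left]
  congr 1
  · funext m
    exact sum_treeDatum_unitCompWeight_first hr hrk m
  · funext m
    exact sum_treeDatum_unitCompWeight m

theorem sign_eq_or (𝓕 : ForestTriple G) : 𝓕.sign = 1 ∨ 𝓕.sign = -1 := neg_one_pow_eq_or ℤ _

theorem sign_eq_one_of_isUnit (𝓕 : ForestTriple G) (h : 𝓕.IsUnit) : 𝓕.sign = 1 := by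
  rw [sign, sum_eq_zero, pow_zero]
  intro T _
  exact Nat.sub_eq_zero_of_le (h T).le

theorem one_le_minR (𝓕 : ForestTriple G) : 1 ≤ 𝓕.minR := 𝓕.one_le_r _

theorem minR_le_minPart (𝓕 : ForestTriple G) : 𝓕.minR ≤ 𝓕.minPart := 𝓕.r_le _

open Classical in
/-- The signed count of a class of forest triples with the same type and the same first values
lies between zero and the number of its unit members: the class is cut out of the generating
functions by the monomial of its type. -/
theorem sum_sign_bounds (hG : G.IsAdjacentCycleChain) (y : Multiset ℕ × ℕ × ℕ) :
    0 ≤ ∑ 𝓕 : ForestTriple G with (𝓕.type, 𝓕.minPart, 𝓕.minR) = y, 𝓕.sign ∧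
      ∑ 𝓕 : ForestTriple G with (𝓕.type, 𝓕.minPart, 𝓕.minR) = y, 𝓕.sign ≤
        #{𝓕 : ForestTriple G | (𝓕.type, 𝓕.minPart, 𝓕.minR) = y ∧ 𝓕.IsUnit} := by
  obtain ⟨lam, k, r⟩ := y
  by_cases hkr : 1 ≤ r ∧ r ≤ k
  swap
  · have hempty : ∀ 𝓕 : ForestTriple G, (𝓕.type, 𝓕.minPart, 𝓕.minR) ≠ (lam, k, r) := by
      intro 𝓕 h
      simp only [Prod.mk.injEq] at h
      obtain ⟨-, rfl, rfl⟩ := h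
      exact hkr ⟨𝓕.one_le_minR, 𝓕.minR_le_minPart⟩
    simp [hempty]
  obtain ⟨hr, hrk⟩ := hkr
  have hmem := hG.forestSum_mem eVar_zero eVar_mem (k := k) (by omega)
  have hS := nonnegCoeff.mul_mem (eVar_mem k) hmem.1
  have hUS := nonnegCoeff.mul_mem (eVar_mem k) hmem.2
  rw [mul_sub] at hUS
  rw [← sum_sign_eq_forestSum eVar_zero hr hrk] at hS hUS
  rw [← sum_isUnit_eq_forestSum hr hrk] at hUS
  have hprod : ∀ 𝓕 : ForestTriple G, (𝓕.type.map eVar).prod =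
      monomial (Multiset.toFinsupp 𝓕.type) 1 := fun 𝓕 => prod_eVar fun i hi => 𝓕.pos_of_mem_type hi
  have hcoeff : ∀ (𝓕 : ForestTriple G),
      coeff (Multiset.toFinsupp lam) (𝓕.type.map eVar).prod = if 𝓕.type = lam then 1 else 0 := by
    intro 𝓕
    rw [hprod, coeff_monomial]
    simp only [EmbeddingLike.apply_eq_iff_eq]
  have hcS : coeff (Multiset.toFinsupp lam) (∑ 𝓕 : ForestTriple G,
      if 𝓕.minPart = k ∧ 𝓕.minR = r then ((𝓕.sign : ℤ) : MvPolynomial ℕ ℤ) *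
        (𝓕.type.map eVar).prod else 0) =
      ∑ 𝓕 : ForestTriple G with (𝓕.type, 𝓕.minPart, 𝓕.minR) = (lam, k, r), 𝓕.sign := by
    rw [coeff_sum, sum_filter]
    refine sum_congr rfl fun 𝓕 _ => ?_
    simp only [Prod.mk.injEq]
    rw [apply_ite (coeff (Multiset.toFinsupp lam)), coeff_zero,
      ← eq_intCast (C : ℤ →+* MvPolynomial ℕ ℤ) 𝓕.sign,
      coeff_C_mul, hcoeff]
    by_cases h1 : 𝓕.type = lam <;> simp [h1]
  have hcU : coeff (Multiset.toFinsupp lam) (∑ 𝓕 : ForestTriple G,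
      if 𝓕.minPart = k ∧ 𝓕.minR = r then
        (if 𝓕.IsUnit then (𝓕.type.map eVar).prod else 0) else 0) =
      #{𝓕 : ForestTriple G | (𝓕.type, 𝓕.minPart, 𝓕.minR) = (lam, k, r) ∧ 𝓕.IsUnit} := by
    rw [coeff_sum, card_filter, Nat.cast_sum]
    refine sum_congr rfl fun 𝓕 _ => ?_
    simp only [Prod.mk.injEq]
    rw [apply_ite (coeff (Multiset.toFinsupp lam)), apply_ite (coeff (Multiset.toFinsupp lam)),
      coeff_zero, hcoeff]
    by_cases h1 : 𝓕.type = lam <;> by_cases h2 : 𝓕.IsUnit <;> simp [h1, h2]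
  have h1 := coeff_nonneg_of_mem hS (Multiset.toFinsupp lam)
  have h2 := coeff_nonneg_of_mem hUS (Multiset.toFinsupp lam)
  rw [coeff_sub, hcS, hcU] at h2
  rw [hcS] at h1
  exact ⟨h1, sub_nonneg.1 h2⟩

end ForestTriple

theorem IsAdjacentCycleChain.exists_isFirstPreservingInvolution {G : EdgeOrderedGraph}
    (hG : G.IsAdjacentCycleChain) :
    ∃ φ : G.ForestTriple → G.ForestTriple, G.IsFirstPreservingInvolution φ := by
  classical
  obtain ⟨φ, h1, h2, h3, h4⟩ := exists_involution_of_count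
    (fun 𝓕 : ForestTriple G => (𝓕.type, 𝓕.minPart, 𝓕.minR)) (fun 𝓕 => 𝓕.sign)
    ForestTriple.sign_eq_or (fun 𝓕 => 𝓕.IsUnit) ForestTriple.sign_eq_one_of_isUnit
    (fun y => (ForestTriple.sum_sign_bounds hG y).1)
    (fun y => (ForestTriple.sum_sign_bounds hG y).2)
  refine ⟨φ, ⟨⟨h1, fun 𝓕 => ?_, h3, fun 𝓕 h => 𝓕.sign_eq_one_of_isUnit (h4 𝓕 h)⟩, h4,
    fun 𝓕 => ?_, fun 𝓕 => ?_⟩⟩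
  · exact (Prod.mk.inj (h2 𝓕)).1
  · exact (Prod.mk.inj (Prod.mk.inj (h2 𝓕)).2).1
  · exact (Prod.mk.inj (Prod.mk.inj (h2 𝓕)).2).2

end EdgeOrderedGraph

end

/-! ### Elementary symmetric functions and power sums -/

section Newton

open Finset

theorem signedPowerSum_eq_of_mul_eq {R : Type*} [CommRing R] {e : ℕ → R} (he : e 0 = 1)
    (p : ℕ → R) (h : PowerSeries.mk e * PowerSeries.mk p = derivSeries e) :
    signedPowerSum e = p := by
  have h1 : PowerSeries.mk (signedPowerSum e) = PowerSeries.mk p := by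
    rw [mk_signedPowerSum, ← h, mul_right_comm, mk_mul_invSeries he, one_mul]
  funext n
  simpa using congrArg (PowerSeries.coeff n) h1

/-- Newton's identities: for the elementary symmetric polynomials, the signed power sums are the
power sums up to sign. -/
theorem signedPowerSum_esymm (σ : Type*) [Fintype σ] (m : ℕ) :
    signedPowerSum (MvPolynomial.esymm σ ℤ) m =
      if m = 0 then 0 else (-1) ^ (m - 1) * MvPolynomial.psum σ ℤ m := by
  refine congrFun (signedPowerSum_eq_of_mul_eq (MvPolynomial.esymm_zero σ ℤ)
    (fun m => if m = 0 then 0 else (-1) ^ (m - 1) * MvPolynomial.psum σ ℤ m) ?_) m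
  ext1 k
  rw [PowerSeries.coeff_mul, derivSeries, PowerSeries.coeff_mk, MvPolynomial.mul_esymm_eq_sum,
    mul_sum, sum_filter]
  refine sum_congr rfl fun a ha => ?_
  have ha := HasAntidiagonal.mem_antidiagonal.1 ha
  rw [PowerSeries.coeff_mk, PowerSeries.coeff_mk]
  by_cases h : a.2 = 0
  · rw [if_pos h, mul_zero, if_neg (by omega)]
  · rw [if_neg h, if_pos (by omega)]
    obtain ⟨b, hb⟩ := Nat.exists_eq_succ_of_ne_zero h
    have hsign : ((-1) ^ (k + 1) * (-1) ^ a.1 : MvPolynomial σ ℤ) = (-1) ^ (a.2 - 1) := by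
      rw [← ha, hb, ← pow_add, show a.1 + b.succ + 1 + a.1 = 2 * (a.1 + 1) + b by omega, pow_add,
        pow_mul]
      simp
    rw [← mul_assoc ((-1) ^ (k + 1)), ← mul_assoc ((-1) ^ (k + 1)), hsign]
    ring

open Classical in
/-- Restricting an elementary symmetric function to finitely many variables. -/
theorem killCompl_elementarySymmetric {σ : Type*} [Fintype σ] (ι : σ ↪ ℕ) (k : ℕ) :
    MvPowerSeries.killCompl ι (elementarySymmetric k) =
      (MvPolynomial.esymm σ ℤ k : MvPowerSeries σ ℤ) := by
  ext x
  rw [MvPowerSeries.coeff_killCompl, MvPolynomial.coeff_coe, MvPolynomial.esymm_eq_sum_monomial,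
    MvPolynomial.coeff_sum]
  simp only [MvPolynomial.coeff_monomial]
  have h1 : MvPowerSeries.coeff (Finsupp.embDomain ι x) (elementarySymmetric k) =
      if (∀ i, x i ≤ 1) ∧ x.degree = k then 1 else 0 := by
    have h2 : (∀ i, Finsupp.embDomain ι x i ≤ 1) ↔ ∀ i, x i ≤ 1 := by
      refine ⟨fun h i => by simpa using h (ι i), fun h i => ?_⟩
      by_cases hi : i ∈ Set.range ι
      · obtain ⟨j, rfl⟩ := hi
        simpa using h j
      · rw [Finsupp.embDomain_of_notMem_range _ _ _ hi]
        exact Nat.zero_le _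
    have h3 : (Finsupp.embDomain ι x).degree = x.degree := by
      simp [Finsupp.degree_apply, Finsupp.support_embDomain]
    exact if_congr (and_congr h2 (by rw [h3])) rfl rfl
  rw [h1]
  have hs : ∀ (t : Finset σ) (i : σ), (∑ j ∈ t, Finsupp.single j 1 : σ →₀ ℕ) i =
      if i ∈ t then 1 else 0 := by
    intro t i
    simp [Finsupp.finsetSum_apply, Finsupp.single_apply]
  split_ifs with h
  · rw [sum_eq_single x.support]
    · rw [if_pos]
      ext i
      rw [hs]
      have := h.1 i
      split_ifs with hi
      · rw [Finsupp.mem_support_iff] at hi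
        omega
      · rw [Finsupp.mem_support_iff, not_not] at hi
        omega
    · intro t _ ht
      rw [if_neg]
      rintro rfl
      apply ht
      ext i
      rw [Finsupp.mem_support_iff, hs]
      simp
    · intro hn
      refine absurd (mem_powersetCard.2 ⟨subset_univ _, ?_⟩) hn
      rw [← h.2, Finsupp.degree_apply, card_eq_sum_ones]
      refine sum_congr rfl fun i hi => ?_
      have := h.1 i
      rw [Finsupp.mem_support_iff] at hi
      omega
  · symm
    refine sum_eq_zero fun t ht => if_neg ?_
    rintro rfl
    refine h ⟨fun i => ?_, ?_⟩
    · rw [hs]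
      split_ifs <;> simp
    · rw [map_sum]
      simpa using (mem_powersetCard.1 ht).2

end Newton

/-! ### The chromatic symmetric function of an adjacent cycle chain -/

namespace EdgeOrderedGraph

open Finset SimpleGraph

/-- The weighted count of the colourings that are constant on the trees of a forest. -/
theorem sum_prod_monoWeight {V σ : Type*} [Fintype V] [DecidableEq V] [Fintype σ] [DecidableEq σ]
    (F : SimpleGraph V) :
    ∑ κ : V → σ, ((∏ A ∈ F.classes univ, monoWeight κ A : ℤ) : MvPolynomial σ ℤ) *
        ∏ v, MvPolynomial.X (κ v) =
      ∏ A ∈ F.classes univ, (-1) ^ (#A - 1) * MvPolynomial.psum σ ℤ #A := by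
  classical
  rw [← prod_connectedComponent F fun A => (-1) ^ (#A - 1) * MvPolynomial.psum σ ℤ #A]
  simp only [MvPolynomial.psum, mul_sum]
  rw [Finset.prod_univ_sum, Fintype.piFinset_univ]
  symm
  have hmono : ∀ κ : V → σ, ∏ A ∈ F.classes univ, monoWeight κ A =
      ∏ T : F.ConnectedComponent, monoWeight κ T.supp.toFinset :=
    fun κ => (prod_connectedComponent F fun A => monoWeight κ A).symm
  refine Fintype.sum_of_injective (fun g v => g (F.connectedComponentMk v)) ?_ _ _ ?_ ?_
  · intro g g' h
    funext T
    induction T using ConnectedComponent.ind with | _ v => exact congrFun h v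
  · intro κ hκ
    have : ∃ T : F.ConnectedComponent, monoWeight κ T.supp.toFinset = 0 := by
      by_contra! hne
      refine hκ ⟨fun T => κ T.out, ?_⟩
      funext v
      have h := hne (F.connectedComponentMk v)
      rw [monoWeight] at h
      split_ifs at h with hc
      · refine hc _ ?_ _ ?_
        · rw [Set.mem_toFinset, ConnectedComponent.mem_supp_iff]
          exact (F.connectedComponentMk v).out_eq
        · simp
      · exact absurd rfl h
    obtain ⟨T, hT⟩ := this
    rw [hmono, prod_eq_zero (mem_univ T) hT, Int.cast_zero, zero_mul]
  · intro g
    rw [hmono, prod_mul_distrib]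
    push_cast
    congr 1
    · refine prod_congr rfl fun T _ => ?_
      rw [monoWeight, if_pos]
      · push_cast
        rfl
      · intro x hx y hy
        simp only [Set.mem_toFinset, ConnectedComponent.mem_supp_iff] at hx hy
        rw [hx, hy]
    · rw [← prod_fiberwise' univ F.connectedComponentMk fun T => MvPolynomial.X (g T)]
      refine prod_congr rfl fun T _ => ?_
      rw [prod_const]
      congr 2
      ext v
      simp [ConnectedComponent.mem_supp_iff]

open Classical in
/-- The chromatic symmetric polynomial of an adjacent cycle chain in finitely many variables. -/
theorem IsAdjacentCycleChain.forestSum_esymm {G : EdgeOrderedGraph} (hG : G.IsAdjacentCycleChain)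
    (σ : Type*) [Fintype σ] :
    G.forestSum (signedPowerSum (MvPolynomial.esymm σ ℤ))
        (signedPowerSum (MvPolynomial.esymm σ ℤ)) =
      ∑ κ : Fin G.n → σ with ∀ v w, G.graph.Adj v w → κ v ≠ κ w, ∏ v, MvPolynomial.X (κ v) := by
  have hpos : ∀ (F : SimpleGraph (Fin G.n)), ∀ A ∈ F.classes univ, #A ≠ 0 := by
    intro F A hA
    rw [mem_classes] at hA
    obtain ⟨v, -, rfl⟩ := hA
    exact (card_pos.2 ⟨v, by simp [mem_cls]⟩).ne'
  have hF : ∀ F : {F // G.IsNonBroken F}, (∏ A ∈ F.1.classes univ,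
      if G.first ∈ A then signedPowerSum (MvPolynomial.esymm σ ℤ) #A
        else signedPowerSum (MvPolynomial.esymm σ ℤ) #A) =
      ∑ κ : Fin G.n → σ, ((∏ A ∈ F.1.classes univ, monoWeight κ A : ℤ) : MvPolynomial σ ℤ) *
        ∏ v, MvPolynomial.X (κ v) := by
    intro F
    rw [sum_prod_monoWeight]
    refine prod_congr rfl fun A hA => ?_
    rw [ite_self, signedPowerSum_esymm, if_neg (hpos F.1 A hA)]
  rw [forestSum, sum_congr rfl fun F _ => hF F, sum_comm, sum_filter]
  refine sum_congr rfl fun κ _ => ?_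
  rw [← sum_mul, ← Int.cast_sum, hG.sum_monoWeight]
  have hiff : (∀ e ∈ G.edges, ¬ (e.map κ).IsDiag) ↔ ∀ v w, G.graph.Adj v w → κ v ≠ κ w := by
    constructor
    · intro h v w hvw
      simpa using h s(v, w) ((mem_edgeSet_graph _ _).1 hvw)
    · intro h e he
      induction e using Sym2.ind with
      | _ v w => simpa using h v w ((mem_edgeSet_graph _ _).2 he)
  rw [if_congr hiff rfl rfl]
  split_ifs <;> simp

open Classical in
/-- The chromatic symmetric function in finitely many variables. -/
theorem killCompl_chromaticSymmetricFunction {V σ : Type*} [Fintype V] [DecidableEq V] [Fintype σ]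
    (ι : σ ↪ ℕ) (G : SimpleGraph V) :
    MvPowerSeries.killCompl ι (chromaticSymmetricFunction G) =
      ((∑ κ : V → σ with ∀ v w, G.Adj v w → κ v ≠ κ w, ∏ v, MvPolynomial.X (κ v) :
        MvPolynomial σ ℤ) : MvPowerSeries σ ℤ) := by
  ext x
  rw [MvPowerSeries.coeff_killCompl, MvPolynomial.coeff_coe, MvPowerSeries.coeff_apply,
    chromaticSymmetricFunction, MvPolynomial.coeff_sum]
  have hX : ∀ κ : V → σ, MvPolynomial.coeff x (∏ v, MvPolynomial.X (κ v) : MvPolynomial σ ℤ) =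
      if ∑ v, Finsupp.single (κ v) 1 = x then 1 else 0 := by
    intro κ
    simp only [MvPolynomial.X, ← MvPolynomial.monomial_sum_one, MvPolynomial.coeff_monomial]
  simp only [hX]
  rw [sum_boole, filter_filter]
  norm_cast
  rw [← Set.ncard_coe_finset]
  symm
  have hemb : ∀ κ : V → σ, Finsupp.embDomain ι (∑ v, Finsupp.single (κ v) 1) =
      ∑ v, Finsupp.single (ι (κ v)) 1 := by
    intro κ
    rw [Finsupp.embDomain_eq_mapDomain, Finsupp.mapDomain_finsetSum]
    simp
  refine Set.ncard_congr (fun κ hκ => Coloring.mk (fun v => ι (κ v)) fun {v w} hvw h => ?_)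
    ?_ ?_ ?_
  · simp only [coe_filter, mem_univ, true_and, Set.mem_ofPred_eq] at hκ
    exact hκ.1 v w hvw (ι.injective h)
  · intro κ hκ
    simp only [coe_filter, mem_univ, true_and, Set.mem_ofPred_eq] at hκ
    exact (hemb κ).symm.trans (congrArg _ hκ.2)
  · intro κ κ' hκ hκ' h
    funext v
    exact ι.injective (DFunLike.congr_fun h v)
  · intro κ hκ
    rw [Set.mem_ofPred_eq] at hκ
    have hrange : ∀ v, κ v ∈ Set.range ι := by
      intro v
      by_contra hv
      have h1 := DFunLike.congr_fun hκ (κ v)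
      rw [Finsupp.embDomain_of_notMem_range _ _ _ hv, Finsupp.finsetSum_apply, sum_eq_zero_iff] at h1
      simpa using h1 v (mem_univ v)
    choose κ' hκ' using hrange
    refine ⟨κ', ?_, ?_⟩
    · simp only [coe_filter, mem_univ, true_and, Set.mem_ofPred_eq]
      refine ⟨fun v w hvw h => κ.valid hvw ?_, ?_⟩
      · rw [← hκ', ← hκ', h]
      · apply Finsupp.embDomain_injective ι
        rw [hemb, ← hκ]
        simp only [hκ']
    · ext v
      exact hκ' v

namespace ForestTriple

variable {G : EdgeOrderedGraph}

open Classical in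
/-- The generating function of the signed forest triples. -/
theorem sum_sign_mul_eq_forestSum {R : Type*} [CommRing R] {e : ℕ → R} (he : e 0 = 1) :
    ∑ 𝓕 : ForestTriple G, (𝓕.sign : R) * (𝓕.type.map e).prod =
      G.forestSum (signedPowerSum e) (signedPowerSum e) := by
  have h := sum_prod_eq_forestSum (G := G) (fun l _ => signedWeight e l)
    (fun l _ => signedWeight e l)
  simp only [ite_self, ← sign_mul_prod_map_type] at h
  rw [h]
  congr 1 <;> exact funext fun m => sum_treeDatum_signedWeight he m

open Classical in
theorem sum_type (𝓕 : ForestTriple G) : 𝓕.type.sum = Fintype.card (Fin G.n) := by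
  rw [type, ← Multiset.coe_sumAddMonoidHom, map_sum]
  simp only [Multiset.coe_sumAddMonoidHom, Multiset.sum_coe, Composition.blocks_sum]
  rw [← card_univ, card_eq_sum_card_fiberwise (f := 𝓕.forest.connectedComponentMk) (t := univ)
    fun _ _ => mem_univ _]
  refine sum_congr rfl fun T _ => ?_
  rw [Set.ncard_eq_toFinset_card' T.supp]
  congr 1
  ext v
  simp [ConnectedComponent.mem_supp_iff]

/-- The type of a forest triple as a partition of the number of vertices. -/
noncomputable def typePartition (𝓕 : ForestTriple G) : (Fintype.card (Fin G.n)).Partition where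
  parts := 𝓕.type
  parts_pos := 𝓕.pos_of_mem_type
  parts_sum := 𝓕.sum_type

open Classical in
theorem sum_sign_nonneg (hG : G.IsAdjacentCycleChain) (lam : (Fintype.card (Fin G.n)).Partition) :
    0 ≤ ∑ 𝓕 : ForestTriple G with 𝓕.typePartition = lam, 𝓕.sign := by
  have hlam : ∀ 𝓕 : ForestTriple G, 𝓕.typePartition = lam ↔ 𝓕.type = lam.parts :=
    fun 𝓕 => Nat.Partition.ext_iff
  rw [← sum_fiberwise_of_maps_to (t := univ.image fun 𝓕 : ForestTriple G =>
    (𝓕.type, 𝓕.minPart, 𝓕.minR)) fun 𝓕 _ => mem_image_of_mem _ (mem_univ 𝓕)]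
  refine sum_nonneg fun y _ => ?_
  by_cases hy : y.1 = lam.parts
  · rw [filter_filter]
    refine (sum_sign_bounds hG y).1.trans_eq (sum_congr (filter_congr fun 𝓕 _ => ?_) fun _ _ => rfl)
    refine (and_iff_right_of_imp ?_).symm
    rintro rfl
    exact (hlam 𝓕).2 hy
  · refine (sum_eq_zero fun 𝓕 h𝓕 => ?_).ge
    rw [filter_filter, mem_filter] at h𝓕
    obtain ⟨-, h1, rfl⟩ := h𝓕
    exact absurd ((hlam 𝓕).1 h1) hy

end ForestTriple

open Classical in
/-- The expansion of the chromatic symmetric function in the elementary symmetric functions as a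
sum over forest triples. -/
theorem IsAdjacentCycleChain.chromaticSymmetricFunction_eq {G : EdgeOrderedGraph}
    (hG : G.IsAdjacentCycleChain) :
    chromaticSymmetricFunction G.graph = ∑ 𝓕 : ForestTriple G,
      (𝓕.sign : MvPowerSeries ℕ ℤ) * (𝓕.type.map elementarySymmetric).prod := by
  ext d
  -- Only the variables that occur in the monomial matter.
  obtain ⟨N, hN⟩ := d.support.exists_nat_subset_range
  obtain ⟨x, rfl⟩ : ∃ x : Fin N →₀ ℕ, Finsupp.embDomain Fin.valEmbedding x = d := by
    have : d ∈ Set.range (Finsupp.embDomain (Fin.valEmbedding (n := N))) := by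
      rw [Finsupp.mem_range_embDomain_iff]
      intro i hi
      exact ⟨⟨i, mem_range.1 (hN hi)⟩, rfl⟩
    exact this
  rw [← MvPowerSeries.coeff_killCompl, ← MvPowerSeries.coeff_killCompl]
  congr 1
  have he : MvPolynomial.esymm (Fin N) ℤ 0 = 1 := MvPolynomial.esymm_zero _ _
  have hfin : MvPowerSeries.killCompl Fin.valEmbedding (chromaticSymmetricFunction G.graph) =
      ((G.forestSum (signedPowerSum (MvPolynomial.esymm (Fin N) ℤ))
        (signedPowerSum (MvPolynomial.esymm (Fin N) ℤ)) : MvPolynomial (Fin N) ℤ) :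
          MvPowerSeries (Fin N) ℤ) := by
    rw [killCompl_chromaticSymmetricFunction, hG.forestSum_esymm]
    congr!
  rw [hfin, ← ForestTriple.sum_sign_mul_eq_forestSum he, map_sum,
    ← MvPolynomial.coeToMvPowerSeries.ringHom_apply, map_sum]
  refine sum_congr rfl fun 𝓕 _ => ?_
  rw [map_mul, map_mul, map_intCast, map_intCast, map_multiset_prod, map_multiset_prod,
    Multiset.map_map, Multiset.map_map]
  congr 2
  refine Multiset.map_congr rfl fun k _ => ?_
  exact (killCompl_elementarySymmetric _ k).symm

theorem IsAdjacentCycleChain.isEPositive {G : EdgeOrderedGraph} (hG : G.IsAdjacentCycleChain) :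
    IsEPositive G.graph := by
  classical
  refine ⟨_, ForestTriple.sum_sign_nonneg hG, ?_⟩
  refine (hG.chromaticSymmetricFunction_eq.trans
    (sum_fiberwise univ ForestTriple.typePartition _).symm).trans ?_
  refine sum_congr rfl fun lam _ => ?_
  rw [zsmul_eq_mul, Int.cast_sum, sum_mul]
  refine sum_congr rfl fun 𝓕 h𝓕 => ?_
  rw [← (mem_filter.1 h𝓕).2]
  rfl

end EdgeOrderedGraph

theorem mainTheorem1 (G : EdgeOrderedGraph) (hG : G.IsAdjacentCycleChain) :
    (∃ φ : G.ForestTriple → G.ForestTriple, G.IsFirstPreservingInvolution φ) ∧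
      IsEPositive G.graph :=
  ⟨hG.exists_isFirstPreservingInvolution, hG.isEPositive⟩
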